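/- Let $B$ be a unital $C^*$-algebra and let $M$ be a smooth manifold (Hausdorff, second countable, possibly with boundary) with a smooth positive density. Let $E,F\to M$ be smooth vector $B$-bundles, i.e. smooth locally trivial bundles with $B$-linear trivialisations whose typical fibre is a finitely generated projective $B$-module, equipped with smooth $B$-valued Hermitian fibre metrics that make each fibre a Hilbert $B$-module (with its given topology). Let $L^2(M;E)$ be the Hilbert $B$-module obtained by completing $C_c^\infty(M;E)$ with respect to $\langle f,g\rangle=\int_M\langle f(x),g(x)\rangle\,dx\in B$, and similarly $L^2(M;F)$; $C_c^\infty(M)$ acts on them by multiplication. Let $D\colon \operatorname{Dom}D\subseteq L^2(M;E)\to L^2(M;F)$ be a regular operator: $D$ is $B$-linear, closed and densely defined, its adjoint $D^*$ is densely defined, and $1+D^*D$ has dense range. Assume that for some $s>0$ one has $\operatorname{Dom}D\subseteq H^s_{\mathrm{loc}}(M;E)$, the local Sobolev space of sections that, in charts and trivialisations, locally belong to the completion $H^s(\mathbb R^n;W)$ of the $W$-valued Schwartz functions ($W$ the typical fibre of $E$) in the norm $\big\|\int(1+|\xi|^2)^s\langle\hat u(\xi),\hat u(\xi)\rangle\,d\xi\big\|_B^{1/2}$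 (restricted to the half-space in boundary charts). Then the following are equivalent: 1. $D$ is left-$B$-Fredholm: regarding $\operatorname{Dom}D$ as a Hilbert $B$-module with the graph inner product $\langle f,g\rangle+\langle Df,Dg\rangle$, there is an adjointable operator $S\colon L^2(M;F)\to\operatorname{Dom}D$ such that $1-SD$ is $B$-compact on $\operatorname{Dom} D$, i.e. a norm limit of $B$-finite rank operators. 2. There is $k\in C_c^\infty(M)$ with $k\ge 0$ such that $k+D^*D$, with domain $\operatorname{Dom}D^*D$, is invertible, i.e. has an everywhere defined adjointable two-sided inverse on $L^2(M;E)$. 3. There are $k\in C_c^\infty(M)$, a core $\mathcal C$ of $D$ and a constant $C$ such that $\|f\|\le C\,(\|kf\|+\|Df\|)$ for all $f\in\mathcal C$. -/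

import Mathlib

open scoped Manifold ContDiff ComplexOrder FourierTransform Topology
open MeasureTheory Bundle Filter

noncomputable section

/-! ### Hilbert modules over a unital C⋆-algebra

Mathlib's `CStarModule B X` is used throughout for (pre-)Hilbert `B`-modules.  With Mathlib's
conventions the inner product is `B`-valued, additive and `B`-linear in the second variable. -/

section HilbertModule

variable {B : Type*} [CStarAlgebra B] [PartialOrder B] [StarOrderedRing B]

/-- The complex and the `B`-module structure of a Hilbert `B`-module are compatible. -/
instance CStarModule.isScalarTower_complex {X : Type*} [AddCommGroup X] [Module ℂ X] [Module B X]
    [Norm X] [CStarModule B X] : IsScalarTower ℂ B X := by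
  refine ⟨fun z b x => ?_⟩
  rw [← sub_eq_zero, ← CStarModule.inner_self (A := B)]
  simp only [CStarModule.inner_sub_right, CStarModule.inner_op_smul_right,
    CStarModule.inner_smul_right_complex, smul_mul_assoc, sub_self]

/-- The action of `B` on a Hilbert `B`-module is by bounded maps. -/
theorem CStarModule.norm_base_smul_le {X : Type*} [NormedAddCommGroup X] [NormedSpace ℂ X]
    [Module B X] [CStarModule B X] (b : B) (x : X) : ‖b • x‖ ≤ ‖b‖ * ‖x‖ := by
  refine le_of_sq_le_sq ?_ (by positivity)
  rw [CStarModule.norm_sq_eq B, CStarModule.inner_op_smul_right, CStarModule.inner_op_smul_left,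
    mul_pow, CStarModule.norm_sq_eq B (x := x)]
  calc ‖b * (inner B x x * star b)‖ ≤ ‖b‖ * (‖inner B x x‖ * ‖star b‖) :=
        (norm_mul_le _ _).trans (by gcongr; exact norm_mul_le _ _)
    _ = ‖b‖ ^ 2 * ‖inner B x x‖ := by rw [norm_star]; ring

instance CStarModule.uniformContinuousConstSMul {X : Type*} [NormedAddCommGroup X]
    [NormedSpace ℂ X] [Module B X] [CStarModule B X] : UniformContinuousConstSMul B X := by
  refine ⟨fun b => ?_⟩
  refine (LipschitzWith.of_dist_le_mul (K := ‖b‖₊) fun x y => ?_).uniformContinuous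
  rw [dist_eq_norm, dist_eq_norm, ← smul_sub]
  exact CStarModule.norm_base_smul_le b (x - y)

/-- The inner product of the completion of a pre-Hilbert `B`-module is the unique continuous
extension of the given one (`UniformSpace.Completion.toInner`). -/
theorem CStarModule.completion_inner_coe {X : Type*} [NormedAddCommGroup X] [NormedSpace ℂ X]
    [Module B X] [CStarModule B X] (x y : X) :
    inner B (x : UniformSpace.Completion X) (y : UniformSpace.Completion X) = inner B x y :=
  (UniformSpace.Completion.isDenseInducing_coe.prodMap
    UniformSpace.Completion.isDenseInducing_coe).extend_eq
    (CStarModule.continuous_inner : Continuous (fun p : X × X => inner B p.1 p.2)) (x, y)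

theorem CStarModule.completion_continuous_inner {X : Type*} [NormedAddCommGroup X]
    [NormedSpace ℂ X] [Module B X] [CStarModule B X] :
    Continuous (fun p : UniformSpace.Completion X × UniformSpace.Completion X =>
      inner B p.1 p.2) := by
  let inner' : X →+ X →+ B :=
    { toFun := fun x => ((CStarModule.innerₛₗ (A := B) x : X →ₗ[ℂ] B)).toAddMonoidHom
      map_zero' := by ext x; exact CStarModule.inner_zero_left
      map_add' := fun x y => by ext z; exact CStarModule.inner_add_left }
  have h : Continuous fun p : X × X => inner' p.1 p.2 := CStarModule.continuous_inner
  exact (UniformSpace.Completion.isDenseInducing_toCompl X).extend_Z_bilin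
    (UniformSpace.Completion.isDenseInducing_toCompl X) h

/-- The completion of a pre-Hilbert `B`-module is a Hilbert `B`-module. -/
instance CStarModule.completion {X : Type*} [NormedAddCommGroup X] [NormedSpace ℂ X]
    [Module B X] [CStarModule B X] : CStarModule B (UniformSpace.Completion X) where
  inner_add_right {x y z} := by
    have hc := CStarModule.completion_continuous_inner (B := B) (X := X)
    refine UniformSpace.Completion.induction_on₃ x y z
      (isClosed_eq (hc.comp (by fun_prop : Continuous fun p : _ × _ × _ => (p.1, p.2.1 + p.2.2)))
        ((hc.comp (by fun_prop : Continuous fun p : _ × _ × _ => (p.1, p.2.1))).add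
          (hc.comp (by fun_prop : Continuous fun p : _ × _ × _ => (p.1, p.2.2))))) ?_
    intro a b c
    rw [← UniformSpace.Completion.coe_add]
    simp only [CStarModule.completion_inner_coe, CStarModule.inner_add_right]
  inner_self_nonneg {x} := by
    have hc := CStarModule.completion_continuous_inner (B := B) (X := X)
    refine UniformSpace.Completion.induction_on x
      (isClosed_le continuous_const (hc.comp (by fun_prop : Continuous fun p => (p, p)))) ?_
    intro a
    rw [CStarModule.completion_inner_coe]
    exact CStarModule.inner_self_nonneg
  inner_self {x} := by
    have hc := CStarModule.completion_continuous_inner (B := B) (X := X)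
    have hn : ‖x‖ ^ 2 = ‖inner B x x‖ := by
      refine UniformSpace.Completion.induction_on x
        (isClosed_eq (by fun_prop) (hc.comp (by fun_prop : Continuous fun p => (p, p))).norm) ?_
      intro a
      rw [CStarModule.completion_inner_coe, UniformSpace.Completion.norm_coe,
        CStarModule.norm_sq_eq B]
    rw [← norm_eq_zero, ← hn, sq_eq_zero_iff, norm_eq_zero]
  inner_op_smul_right {b x y} := by
    have hc := CStarModule.completion_continuous_inner (B := B) (X := X)
    refine UniformSpace.Completion.induction_on₂ x y
      (isClosed_eq
        (hc.comp (continuous_fst.prodMk (continuous_snd.const_smul b)))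
        (continuous_const.mul hc)) ?_
    intro u v
    rw [← UniformSpace.Completion.coe_smul]
    simp only [CStarModule.completion_inner_coe, CStarModule.inner_op_smul_right]
  inner_smul_right_complex {z x y} := by
    have hc := CStarModule.completion_continuous_inner (B := B) (X := X)
    refine UniformSpace.Completion.induction_on₂ x y
      (isClosed_eq
        (hc.comp (continuous_fst.prodMk (continuous_snd.const_smul z)))
        (hc.const_smul z)) ?_
    intro u v
    rw [← UniformSpace.Completion.coe_smul]
    simp only [CStarModule.completion_inner_coe, CStarModule.inner_smul_right_complex]
  star_inner x y := by
    have hc := CStarModule.completion_continuous_inner (B := B) (X := X)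
    refine UniformSpace.Completion.induction_on₂ x y
      (isClosed_eq hc.star
        (hc.comp (continuous_snd.prodMk continuous_fst))) ?_
    intro u v
    simp only [CStarModule.completion_inner_coe, CStarModule.star_inner]
  norm_eq_sqrt_norm_inner_self x := by
    have hc := CStarModule.completion_continuous_inner (B := B) (X := X)
    refine UniformSpace.Completion.induction_on x
      (isClosed_eq (by fun_prop)
        (hc.comp (by fun_prop : Continuous fun p => (p, p))).norm.sqrt) ?_
    intro a
    rw [CStarModule.completion_inner_coe, UniformSpace.Completion.norm_coe,
      CStarModule.norm_eq_sqrt_norm_inner_self (A := B)]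

section Operators

variable (B)
variable {X Y : Type*} [NormedAddCommGroup X] [NormedSpace ℂ X] [Module B X] [CStarModule B X]
  [NormedAddCommGroup Y] [NormedSpace ℂ Y] [Module B Y] [CStarModule B Y]

/-- `T ∈ 𝓛(X, Y)`: the bounded operator `T` is adjointable. -/
def IsAdjointable (T : X →L[ℂ] Y) : Prop :=
  ∃ S : Y →L[ℂ] X, ∀ (x : X) (y : Y), inner B (T x) y = inner B x (S y)

/-- `T ∈ 𝓚(X, Y)`: the operator `T` is `B`-compact, i.e. a limit in operator norm of `B`-finite
rank operators, the finite sums of the rank one operators `z ↦ y ⟨x, z⟩` (the scalar is written on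
the left, as always for `CStarModule`). -/
def IsBCompact (T : X →L[ℂ] Y) : Prop :=
  T ∈ closure
    (Submodule.span ℂ {R : X →L[ℂ] Y | ∃ (x : X) (y : Y), ∀ z : X, R z = inner B x z • y} :
      Set (X →L[ℂ] Y))

/-- `T : X → Y` is left-`B`-Fredholm: there is an adjointable `S : Y → X` such that `1 - S T` is
`B`-compact. -/
def IsLeftBFredholm (T : X →L[ℂ] Y) : Prop :=
  ∃ S : Y →L[ℂ] X, IsAdjointable B S ∧
    IsBCompact B (ContinuousLinearMap.id ℂ X - S.comp T)

end Operators

/-! ### Unbounded operators between Hilbert modules -/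

namespace UnboundedOp

variable {X Y : Type*} [NormedAddCommGroup X] [NormedSpace ℂ X] [Module B X] [CStarModule B X]
  [NormedAddCommGroup Y] [NormedSpace ℂ Y] [Module B Y] [CStarModule B Y]

/-- The graph of the adjoint `D*`: `y ∈ Dom D*` and `D* y = z` if and only if
`⟨D x, y⟩ = ⟨x, z⟩` for all `x ∈ Dom D`.  (For densely defined `D` the value `z` is unique.) -/
def AdjointRel (D : X →ₗ.[B] Y) (y : Y) (z : X) : Prop :=
  ∀ x : D.domain, inner B (D x) y = inner B (x : X) z

/-- The graph of `D* D`: `x ∈ Dom D`, `D x ∈ Dom D*` and `D* (D x) = z`. -/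
def AdjointCompRel (D : X →ₗ.[B] Y) (x z : X) : Prop :=
  ∃ hx : x ∈ D.domain, AdjointRel D (D ⟨x, hx⟩) z

/-- A regular operator: closed and densely defined, with densely defined adjoint, and such that
`1 + D* D` has dense range. -/
structure IsRegular (D : X →ₗ.[B] Y) : Prop where
  isClosed_graph : IsClosed (D.graph : Set (X × Y))
  dense_domain : Dense (D.domain : Set X)
  dense_domain_adjoint : Dense {y : Y | ∃ z : X, AdjointRel D y z}
  dense_range : Dense {w : X | ∃ x z : X, AdjointCompRel D x z ∧ x + z = w}

/-- `𝓒 ⊆ Dom D` is a core of `D`: a submodule of the domain that is dense in the graph norm. -/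
def IsCore (D : X →ₗ.[B] Y) (𝓒 : Submodule B X) : Prop :=
  𝓒 ≤ D.domain ∧
    ∀ x : D.domain, ((x : X), D x) ∈ closure {p : X × Y | ∃ c : D.domain, (c : X) ∈ 𝓒 ∧
      p = ((c : X), D c)}

/-- For a bounded operator `K` on `X`, the operator `K + D* D` (with domain `Dom D* D`) is
invertible: it has a two-sided inverse in `𝓛(X)`. -/
def IsInvertibleAdd (K : X →L[ℂ] X) (D : X →ₗ.[B] Y) : Prop :=
  ∃ G : X →L[ℂ] X, IsAdjointable B G ∧
    (∀ y : X, ∃ z : X, AdjointCompRel D (G y) z ∧ K (G y) + z = y) ∧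
    (∀ x z : X, AdjointCompRel D x z → G (K x + z) = x)

/-- The domain of `D` as a Hilbert `B`-module, with the graph inner product. -/
def GraphDomain (D : X →ₗ.[B] Y) : Type _ := D.domain

namespace GraphDomain

variable (D : X →ₗ.[B] Y)

instance : AddCommGroup (GraphDomain D) := inferInstanceAs (AddCommGroup D.domain)
instance : Module B (GraphDomain D) := inferInstanceAs (Module B D.domain)
instance : Module ℂ (GraphDomain D) := inferInstanceAs (Module ℂ D.domain)

/-- The inclusion `Dom D → X`. -/
def incl : GraphDomain D →ₗ[B] X := D.domain.subtype

/-- The operator `D` on its domain. -/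
def op : GraphDomain D →ₗ[B] Y := D.toFun

instance : Inner B (GraphDomain D) :=
  ⟨fun x y => inner B (incl D x) (incl D y) + inner B (op D x) (op D y)⟩

theorem inner_def (x y : GraphDomain D) :
    inner B x y = inner B (incl D x) (incl D y) + inner B (op D x) (op D y) := rfl

instance : Norm (GraphDomain D) := ⟨fun x => √‖inner B x x‖⟩

theorem incl_smul_complex (z : ℂ) (x : GraphDomain D) : incl D (z • x) = z • incl D x := rfl

theorem op_smul_complex (z : ℂ) (x : GraphDomain D) : op D (z • x) = z • op D x := by
  have h1 : z • x = (z • (1 : B)) • x := by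
    apply Subtype.ext
    change z • incl D x = (z • (1 : B)) • incl D x
    rw [smul_assoc, one_smul]
  rw [h1, map_smul, smul_assoc, one_smul]

instance : CStarModule B (GraphDomain D) where
  inner_add_right {x y z} := by
    simp only [inner_def, map_add, CStarModule.inner_add_right]; abel
  inner_self_nonneg {x} :=
    add_nonneg CStarModule.inner_self_nonneg CStarModule.inner_self_nonneg
  inner_self {x} := by
    constructor
    · intro h
      rw [inner_def] at h
      have h' := ((add_eq_zero_iff_of_nonneg (CStarModule.inner_self_nonneg (A := B))
        (CStarModule.inner_self_nonneg (A := B))).1 h).1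
      rw [CStarModule.inner_self] at h'
      exact Subtype.ext h'
    · rintro rfl
      simp [inner_def]
  inner_op_smul_right {b x y} := by
    simp only [inner_def, map_smul, CStarModule.inner_op_smul_right, mul_add]
  inner_smul_right_complex {z x y} := by
    simp only [inner_def, incl_smul_complex, op_smul_complex,
      CStarModule.inner_smul_right_complex, smul_add]
  star_inner x y := by
    simp only [inner_def, star_add, CStarModule.star_inner]
  norm_eq_sqrt_norm_inner_self _ := rfl

instance : NormedAddCommGroup (GraphDomain D) := CStarModule.normedAddCommGroup B
instance : NormedSpace ℂ (GraphDomain D) := .ofCore (CStarModule.normedSpaceCore B)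

/-- `D` as a bounded operator from its domain, with the graph norm, to `Y`. -/
def opL : GraphDomain D →L[ℂ] Y :=
  LinearMap.mkContinuous
    { toFun := op D
      map_add' := map_add _
      map_smul' := op_smul_complex D } 1 fun x => by
    rw [one_mul]
    refine le_of_sq_le_sq ?_ (norm_nonneg _)
    rw [CStarModule.norm_sq_eq B, CStarModule.norm_sq_eq B (x := x)]
    refine CStarAlgebra.norm_le_norm_of_nonneg_of_le CStarModule.inner_self_nonneg ?_
    rw [inner_def]
    exact le_add_of_nonneg_left CStarModule.inner_self_nonneg

end GraphDomain

/-- An unbounded operator `D` is left-`B`-Fredholm if it is so as a bounded operator from its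
domain. -/
def IsLeftBFredholm (D : X →ₗ.[B] Y) : Prop :=
  _root_.IsLeftBFredholm B (GraphDomain.opL D)

end UnboundedOp

end HilbertModule

/-! ### Functions and sections on manifolds -/

/-- `C_c^∞(M)`: the smooth compactly supported complex functions. -/
structure TestFun {n : ℕ} {H : Type*} [TopologicalSpace H]
    (I : ModelWithCorners ℝ (EuclideanSpace ℝ (Fin n)) H)
    (M : Type*) [TopologicalSpace M] [ChartedSpace H M] where
  toFun : M → ℂ
  contMDiff : ContMDiff I 𝓘(ℝ, ℂ) ∞ toFun
  hasCompactSupport : HasCompactSupport toFun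

instance {n : ℕ} {H : Type*} [TopologicalSpace H]
    (I : ModelWithCorners ℝ (EuclideanSpace ℝ (Fin n)) H)
    (M : Type*) [TopologicalSpace M] [ChartedSpace H M] :
    CoeFun (TestFun I M) (fun _ => M → ℂ) := ⟨TestFun.toFun⟩

/-- `μ` is a smooth positive density on `M`: in every chart of the atlas it has a smooth positive
density with respect to Lebesgue measure. -/
def IsSmoothDensity {n : ℕ} {H : Type*} [TopologicalSpace H]
    (I : ModelWithCorners ℝ (EuclideanSpace ℝ (Fin n)) H)
    {M : Type*} [TopologicalSpace M] [ChartedSpace H M] [MeasurableSpace M]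
    (μ : Measure M) : Prop :=
  ∀ e ∈ atlas H M, ∃ ρ : EuclideanSpace ℝ (Fin n) → ℝ,
    ContDiffOn ℝ ∞ ρ (e.extend I).target ∧ (∀ y ∈ (e.extend I).target, 0 < ρ y) ∧
    ∀ A : Set M, MeasurableSet A → A ⊆ e.source →
      μ A = ∫⁻ y in e.extend I '' A, ENNReal.ofReal (ρ y)

section Bundles

variable {n : ℕ} {H : Type*} [TopologicalSpace H]
  (I : ModelWithCorners ℝ (EuclideanSpace ℝ (Fin n)) H)
  {M : Type*} [TopologicalSpace M] [ChartedSpace H M]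
  (B : Type*) [CStarAlgebra B] [PartialOrder B] [StarOrderedRing B]
  (W : Type*) [NormedAddCommGroup W] [NormedSpace ℂ W] [Module B W] [CStarModule B W]
  (E : M → Type*) [TopologicalSpace (TotalSpace W E)]
  [∀ x, NormedAddCommGroup (E x)] [∀ x, NormedSpace ℂ (E x)] [∀ x, Module B (E x)]
  [∀ x, CStarModule B (E x)] [FiberBundle W E] [VectorBundle ℝ W E]

/-- A smooth vector bundle `E` with typical fibre `W`, whose fibres are Hilbert `B`-modules, is a
Hermitian `B`-bundle if its trivialisations are `B`-linear and its `B`-valued fibre metric is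
smooth.  (The topology of every fibre is the one given by its inner product.) -/
class IsHermitianBBundle : Prop where
  trivialization_smul : ∀ (e : Trivialization W (π W E)) [MemTrivializationAtlas e],
    ∀ x ∈ e.baseSet, ∀ (b : B) (v : E x), (e ⟨x, b • v⟩).2 = b • (e ⟨x, v⟩).2
  contMDiff_inner : ∀ s t : (x : M) → E x,
    ContMDiff I (I.prod 𝓘(ℝ, W)) ∞ (fun x => TotalSpace.mk' W x (s x)) →
    ContMDiff I (I.prod 𝓘(ℝ, W)) ∞ (fun x => TotalSpace.mk' W x (t x)) →
    ContMDiff I 𝓘(ℝ, B) ∞ (fun x => (inner B (s x) (t x) : B))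

variable [IsManifold I ∞ M] [ContMDiffVectorBundle ∞ W E I]

variable {W E} in
theorem IsHermitianBBundle.contMDiff_base_smul (hE : IsHermitianBBundle I B W E) {s : (x : M) → E x}
    (hs : ContMDiff I (I.prod 𝓘(ℝ, W)) ∞ (fun x => TotalSpace.mk' W x (s x))) (b : B) :
    ContMDiff I (I.prod 𝓘(ℝ, W)) ∞ (fun x => TotalSpace.mk' W x (b • s x)) := by
  intro x₀
  have h := (contMDiffAt_section x₀).1 (hs x₀)
  rw [contMDiffAt_section]
  let L : W →L[ℂ] W := LinearMap.mkContinuous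
    { toFun := fun w => b • w
      map_add' := smul_add b
      map_smul' := fun z w => by
        have hz : z • w = (z • (1 : B)) • w := by rw [smul_assoc, one_smul]
        rw [RingHom.id_apply, hz, ← smul_assoc z, smul_smul, mul_smul_comm, mul_one] } ‖b‖ (CStarModule.norm_base_smul_le b)
  have hL : ContMDiffAt I 𝓘(ℝ, W) ∞
      (fun x => (L.restrictScalars ℝ) (trivializationAt W E x₀ ⟨x, s x⟩).2) x₀ :=
    (L.restrictScalars ℝ).contMDiff.contMDiffAt.comp x₀ h
  refine hL.congr_of_eventuallyEq ?_
  filter_upwards [(trivializationAt W E x₀).open_baseSet.mem_nhds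
    (FiberBundle.mem_baseSet_trivializationAt' x₀)] with x hx
  exact hE.trivialization_smul (trivializationAt W E x₀) x hx b (s x)

variable {W E} in
theorem IsHermitianBBundle.contMDiff_testFun_smul (hE : IsHermitianBBundle I B W E)
    {s : (x : M) → E x}
    (hs : ContMDiff I (I.prod 𝓘(ℝ, W)) ∞ (fun x => TotalSpace.mk' W x (s x))) (k : TestFun I M) :
    ContMDiff I (I.prod 𝓘(ℝ, W)) ∞ (fun x => TotalSpace.mk' W x (k x • s x)) := by
  intro x₀
  have h := (contMDiffAt_section x₀).1 (hs x₀)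
  rw [contMDiffAt_section]
  have hL : ContMDiffAt I 𝓘(ℝ, W) ∞
      (fun x => k x • (trivializationAt W E x₀ ⟨x, s x⟩).2) x₀ :=
    ((ContinuousLinearMap.lsmul ℝ ℂ : ℂ →L[ℝ] W →L[ℝ] W).contMDiff.contMDiffAt.comp x₀
      (k.contMDiff x₀)).clm_apply h
  refine hL.congr_of_eventuallyEq ?_
  filter_upwards [(trivializationAt W E x₀).open_baseSet.mem_nhds
    (FiberBundle.mem_baseSet_trivializationAt' x₀)] with x hx
  have h1 : ∀ v : E x, k x • v = (k x • (1 : B)) • v := fun v => by rw [smul_assoc, one_smul]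
  have h2 : ∀ v : W, k x • v = (k x • (1 : B)) • v := fun v => by rw [smul_assoc, one_smul]
  rw [h1, h2]
  exact hE.trivialization_smul (trivializationAt W E x₀) x hx _ (s x)

variable [IsHermitianBBundle I B W E]

/-- The space `C_c^∞(M; E)` of smooth compactly supported sections, as a `B`-module. -/
def testSections : Submodule B ((x : M) → E x) where
  carrier := {s | ContMDiff I (I.prod 𝓘(ℝ, W)) ∞ (fun x => TotalSpace.mk' W x (s x)) ∧
    ∃ K : Set M, IsCompact K ∧ ∀ x ∉ K, s x = 0}
  add_mem' := by
    rintro s t ⟨hs, K, hK, hsK⟩ ⟨ht, L, hL, htL⟩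
    refine ⟨hs.add_section ht, K ∪ L, hK.union hL, fun x hx => ?_⟩
    rw [Set.mem_union, not_or] at hx
    simp [hsK x hx.1, htL x hx.2]
  zero_mem' := ⟨contMDiff_zeroSection ℝ E, ∅, isCompact_empty, fun _ _ => rfl⟩
  smul_mem' := by
    rintro b s ⟨hs, K, hK, hsK⟩
    exact ⟨IsHermitianBBundle.contMDiff_base_smul I B inferInstance hs b, K, hK, fun x hx => by
      simp [hsK x hx]⟩

variable [MeasurableSpace M] (μ : Measure M)

/-- `C_c^∞(M; E)` as a pre-Hilbert `B`-module, with inner product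
`⟨s, t⟩ = ∫ ⟨s x, t x⟩ dμ(x)`. -/
def TestSec (_μ : Measure M) : Type _ := testSections I B W E

namespace TestSec

instance : AddCommGroup (TestSec I B W E μ) := inferInstanceAs (AddCommGroup (testSections I B W E))
instance : Module B (TestSec I B W E μ) := inferInstanceAs (Module B (testSections I B W E))
instance : Module ℂ (TestSec I B W E μ) := inferInstanceAs (Module ℂ (testSections I B W E))

variable {I B W E μ} in
/-- The underlying section. -/
def toFun (s : TestSec I B W E μ) : (x : M) → E x :=
  Subtype.val (p := fun s => s ∈ testSections I B W E) s

instance : CoeFun (TestSec I B W E μ) (fun _ => (x : M) → E x) :=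
  ⟨toFun⟩

instance : Inner B (TestSec I B W E μ) := ⟨fun s t => ∫ x, inner B (s x) (t x) ∂μ⟩
instance : Norm (TestSec I B W E μ) := ⟨fun s => √‖inner B s s‖⟩

variable {I B W E μ}

theorem inner_def (s t : TestSec I B W E μ) :
    inner B s t = ∫ x, inner B (s x) (t x) ∂μ := rfl

@[simp] theorem add_apply (s t : TestSec I B W E μ) (x : M) : (s + t) x = s x + t x := rfl
@[simp] theorem zero_apply (x : M) : (0 : TestSec I B W E μ) x = 0 := rfl
@[simp] theorem base_smul_apply (b : B) (s : TestSec I B W E μ) (x : M) :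
    (b • s) x = b • s x := rfl
@[simp] theorem smul_apply (z : ℂ) (s : TestSec I B W E μ) (x : M) : (z • s) x = z • s x := rfl

@[ext] theorem ext {s t : TestSec I B W E μ} (h : ∀ x, s x = t x) : s = t :=
  Subtype.ext (funext h)

theorem contMDiff (s : TestSec I B W E μ) :
    ContMDiff I (I.prod 𝓘(ℝ, W)) ∞ (fun x => TotalSpace.mk' W x (s x)) := s.2.1

theorem continuous_inner (s t : TestSec I B W E μ) :
    Continuous (fun x => (inner B (s x) (t x) : B)) :=
  (IsHermitianBBundle.contMDiff_inner (W := W) (I := I) (B := B) s t s.contMDiff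
    t.contMDiff).continuous

variable [T2Space M]

theorem hasCompactSupport_inner (s t : TestSec I B W E μ) :
    HasCompactSupport (fun x => (inner B (s x) (t x) : B)) := by
  obtain ⟨K, hK, hsK⟩ := s.2.2
  exact HasCompactSupport.intro hK fun x hx => by
    rw [show s x = 0 from hsK x hx]
    exact CStarModule.inner_zero_left

variable [BorelSpace M] [IsFiniteMeasureOnCompacts μ]

theorem integrable_inner (s t : TestSec I B W E μ) :
    Integrable (fun x => (inner B (s x) (t x) : B)) μ :=
  (continuous_inner s t).integrable_of_hasCompactSupport (hasCompactSupport_inner s t)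

theorem eq_zero_of_inner_self [μ.IsOpenPosMeasure] (s : TestSec I B W E μ)
    (h : inner B s s = 0) : s = 0 := by
  set f : M → B := fun x => inner B (s x) (s x) with hf
  have hfc : Continuous f := continuous_inner s s
  have hfi : Integrable f μ := integrable_inner s s
  have hf0 : ∀ x, 0 ≤ f x := fun x => CStarModule.inner_self_nonneg
  have key : ∀ x, f x = 0 := by
    intro x₀
    by_contra hx
    have hpos : 0 < ‖f x₀‖ := norm_pos_iff.2 hx
    set U : Set M := {x | ‖f x - f x₀‖ < ‖f x₀‖ / 2} with hU
    have hUo : IsOpen U := isOpen_lt (hfc.sub continuous_const).norm continuous_const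
    have hUx : x₀ ∈ U := by simp [hU, hpos]
    have hUK : U ⊆ tsupport f := fun x hx' => by
      refine subset_tsupport f (Function.mem_support.2 fun h0 => ?_)
      rw [hU, Set.mem_ofPred_eq, h0, zero_sub, norm_neg] at hx'
      linarith
    have hUfin : μ U < ⊤ :=
      (measure_mono hUK).trans_lt (hasCompactSupport_inner s s).isCompact.measure_lt_top
    have hUpos : 0 < μ.real U :=
      ENNReal.toReal_pos (hUo.measure_pos μ ⟨x₀, hUx⟩).ne' hUfin.ne
    have hsum : ∫ x in U, f x ∂μ + ∫ x in Uᶜ, f x ∂μ = 0 := by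
      rw [integral_add_compl hUo.measurableSet hfi]; exact h
    have hzero : ∫ x in U, f x ∂μ = 0 :=
      ((add_eq_zero_iff_of_nonneg (integral_nonneg fun x => hf0 x)
        (integral_nonneg fun x => hf0 x)).1 hsum).1
    have hle : ‖∫ x in U, (f x - f x₀) ∂μ‖ ≤ ‖f x₀‖ / 2 * μ.real U :=
      norm_setIntegral_le_of_norm_le_const hUfin fun x hx' => le_of_lt hx'
    rw [integral_sub hfi.integrableOn (integrableOn_const hUfin.ne), hzero, setIntegral_const,
      zero_sub, norm_neg, norm_smul, Real.norm_of_nonneg hUpos.le] at hle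
    nlinarith
  ext x
  exact (CStarModule.inner_self (A := B)).1 (key x)

variable [μ.IsOpenPosMeasure]

instance : CStarModule B (TestSec I B W E μ) where
  inner_add_right {r s t} := by
    simp only [inner_def, add_apply, CStarModule.inner_add_right]
    exact integral_add (integrable_inner r s) (integrable_inner r t)
  inner_self_nonneg {s} := integral_nonneg fun x => CStarModule.inner_self_nonneg
  inner_self {s} := ⟨eq_zero_of_inner_self s, by rintro rfl; simp [inner_def]⟩
  inner_op_smul_right {b s t} := by
    simp only [inner_def, base_smul_apply, CStarModule.inner_op_smul_right]
    exact ((ContinuousLinearMap.mul ℂ B b).integral_comp_comm (integrable_inner s t))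
  inner_smul_right_complex {z s t} := by
    simp only [inner_def, smul_apply, CStarModule.inner_smul_right_complex]
    exact integral_smul z _
  star_inner s t := by
    have h := (starL' ℝ : B ≃L[ℝ] B).integral_comp_comm (μ := μ)
      (fun x => (inner B (s x) (t x) : B))
    refine h.symm.trans (integral_congr_ae (Eventually.of_forall fun x => ?_))
    exact CStarModule.star_inner (s x) (t x)
  norm_eq_sqrt_norm_inner_self _ := rfl

instance : NormedAddCommGroup (TestSec I B W E μ) := CStarModule.normedAddCommGroup B
instance : NormedSpace ℂ (TestSec I B W E μ) := .ofCore (CStarModule.normedSpaceCore B)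

/-- Multiplication of sections by a function `k ∈ C_c^∞(M)`. -/
def mul (k : TestFun I M) : TestSec I B W E μ →ₗ[ℂ] TestSec I B W E μ where
  toFun s := ⟨fun x => k x • s x,
    IsHermitianBBundle.contMDiff_testFun_smul I B inferInstance s.contMDiff k,
    tsupport k, k.hasCompactSupport, fun x hx => by
      change k x • s x = 0
      rw [image_eq_zero_of_notMem_tsupport hx, zero_smul]⟩
  map_add' s t := ext fun x => smul_add (k x) (s x) (t x)
  map_smul' z s := ext fun x => smul_comm (k x) z (s x)

@[simp] theorem mul_apply (k : TestFun I M) (s : TestSec I B W E μ) (x : M) :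
    mul k s x = k x • s x := rfl

theorem exists_norm_mul_le (k : TestFun I M) :
    ∃ C : ℝ, ∀ s : TestSec I B W E μ, ‖mul k s‖ ≤ C * ‖s‖ := by
  obtain ⟨C, hC⟩ := k.contMDiff.continuous.bounded_above_of_compact_support k.hasCompactSupport
  refine ⟨max C 0, fun s => ?_⟩
  refine le_of_sq_le_sq ?_ (by positivity)
  rw [mul_pow, CStarModule.norm_sq_eq B, CStarModule.norm_sq_eq B (x := s)]
  have h1 : ‖(max C 0) ^ 2 • (inner B s s : B)‖ = (max C 0) ^ 2 * ‖(inner B s s : B)‖ := by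
    rw [norm_smul, Real.norm_of_nonneg (by positivity)]
  rw [← h1]
  refine CStarAlgebra.norm_le_norm_of_nonneg_of_le CStarModule.inner_self_nonneg ?_
  rw [inner_def, inner_def, ← integral_smul]
  refine integral_mono (integrable_inner _ _) ((integrable_inner s s).smul _) fun x => ?_
  have h2 : (inner B (mul k s x) (mul k s x) : B) = (‖k x‖ ^ 2 : ℝ) • inner B (s x) (s x) := by
    rw [mul_apply, CStarModule.inner_smul_right_complex, CStarModule.inner_smul_left_complex,
      smul_smul, ← Complex.coe_smul]
    congr 1
    rw [Complex.star_def, Complex.mul_conj, Complex.normSq_eq_norm_sq]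
  change (inner B (mul k s x) (mul k s x) : B) ≤ (max C 0) ^ 2 • inner B (s x) (s x)
  rw [h2]
  have h3 : ‖k x‖ ^ 2 ≤ (max C 0) ^ 2 := by
    gcongr; exact (hC x).trans (le_max_left _ _)
  exact smul_le_smul_of_nonneg_right h3 CStarModule.inner_self_nonneg

/-- Multiplication by `k ∈ C_c^∞(M)` as a bounded operator on sections. -/
def mulL (k : TestFun I M) : TestSec I B W E μ →L[ℂ] TestSec I B W E μ :=
  (mul k).mkContinuousOfExistsBound (exists_norm_mul_le k)

end TestSec

variable [T2Space M] [BorelSpace M] [IsFiniteMeasureOnCompacts μ] [μ.IsOpenPosMeasure]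

/-- The Hilbert `B`-module `L²(M; E)`: the completion of `C_c^∞(M; E)`. -/
abbrev L2Sec : Type _ := UniformSpace.Completion (TestSec I B W E μ)

variable {I B W E μ}

/-- Multiplication by `k ∈ C_c^∞(M)` on `L²(M; E)`: the continuous extension of pointwise
multiplication of sections. -/
def L2Sec.mul (k : TestFun I M) : L2Sec I B W E μ →L[ℂ] L2Sec I B W E μ :=
  (TestSec.mulL k).completion

/-- The `B`-valued Sobolev norm of order `s` of a Schwartz function `u : ℝⁿ → W`,
`‖∫ (1 + |ξ|²)^s ⟨û(ξ), û(ξ)⟩ dξ‖^{1/2}`. -/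
def sobolevNorm (B : Type*) [CStarAlgebra B] {W : Type*} [NormedAddCommGroup W] [NormedSpace ℂ W]
    [Inner B W] (s : ℝ) (u : SchwartzMap (EuclideanSpace ℝ (Fin n)) W) : ℝ :=
  √‖∫ ξ, (1 + ‖ξ‖ ^ 2) ^ s • (inner B (𝓕 u ξ) (𝓕 u ξ) : B)‖

/-- `f ∈ L²(M; E)` belongs to the local Sobolev space `H^s_loc(M; E)`, `s ≥ 0`.

The space `H^s(ℝⁿ; W) ⊆ L²(ℝⁿ; W)` is the completion of the Schwartz space for the Sobolev norm,
so its elements are given by `H^s`-Cauchy sequences `u` of Schwartz functions.  The section `f` is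
locally `H^s` if, for every chart `e` of `M`, every trivialisation `t` of `E` and every cutoff `χ`
with compact support where both are defined, `χ f` is in these coordinates equal to `χ` times an
element of `H^s(ℝⁿ; W)` (restricted to the range of the chart if `M` has a boundary). -/
def MemSobolevLoc (s : ℝ) (f : L2Sec I B W E μ) : Prop :=
  ∀ e ∈ atlas H M, ∀ (t : Trivialization W (π W E)) [MemTrivializationAtlas t],
    ∀ χ : TestFun I M, tsupport χ ⊆ e.source ∩ t.baseSet →
      ∃ u : ℕ → SchwartzMap (EuclideanSpace ℝ (Fin n)) W,
        (∀ ε > 0, ∃ N, ∀ i ≥ N, ∀ j ≥ N, sobolevNorm B s (u i - u j) < ε) ∧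
        ∃ σ : ℕ → TestSec I B W E μ,
          (∀ j x, σ j x = χ x • t.symm x (u j (e.extend I x))) ∧
          Tendsto (fun j => (σ j : L2Sec I B W E μ)) atTop (𝓝 (L2Sec.mul χ f))

end Bundles

end

set_option linter.unusedSectionVars false

noncomputable section

section HilbertModule

variable {B : Type*} [CStarAlgebra B] [PartialOrder B] [StarOrderedRing B]
variable {X : Type*} [NormedAddCommGroup X] [NormedSpace ℂ X] [Module B X] [CStarModule B X]
variable {Y : Type*} [NormedAddCommGroup Y] [NormedSpace ℂ Y] [Module B Y] [CStarModule B Y]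
variable {Z : Type*} [NormedAddCommGroup Z] [NormedSpace ℂ Z] [Module B Z] [CStarModule B Z]

/-! ### Coercive operators and frames in Hilbert modules -/

namespace CStarModule

/-! The estimate in 3 is the hub. Let `Z` be the domain of `D` with its graph inner product, `ι : Z
→ X` the inclusion and `T : Z → Y` the operator `D`. Regularity enters through three facts: `Z` is
complete, and both `ι` and `T` are adjointable (on the range of `1 + D*D` the adjoint of `ι` sends
`x + D*Dx` to `x`).

From 3 to 1 and 2: the estimate passes from the core to `Z` and says that the form `⟨kf, kg⟩ + ⟨Df,
Dg⟩` is coercive for the graph norm. A positive coercive operator on a Hilbert module is invertible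
(`isUnit_of_coercive`), so the form is represented by an operator on `Z` with inverse `G`, as in the
Lax-Milgram theorem (`exists_form_inverse`). Then `ι G ι*` inverts `|k|² + D*D`, which is 2. For 1
take `S = G T*`: the remainder is `1 - S T = G ι* k̄ k ι`, which is `B`-compact as soon as `k ι` is.

From 1 to 3: modulo an error absorbed on the left, `1 - S T` has finite rank, so `f` is controlled
by `Df` and finitely many functionals `⟨x, f⟩`. By density each `x` may be taken in `C_c^∞`, and
these see only `kf` for a suitable cutoff `k`. From 2 to 3: write `f = kg + D*Dg` and pair with `f`.

What remains is a Rellich theorem: `k ι` is `B`-compact if the domain lies in `H^s_loc`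
(`UnboundedOp.IsRegular.isBCompact_mul`). Bounded sets of a finitely generated `B`-module need not
be precompact, so finite rank approximants are written down explicitly: local averages at scale `δ`,
glued by a partition of unity. Plancherel and Jensen's inequality, both in the order of `B`, bound
the error by a constant times `δ^σ` and the Sobolev norm, where `σ = min s 1`
(`exists_finiteRank_approx`). Smooth dual frames turn these averages into `B`-valued inner products
with test sections. The Sobolev norm is not assumed to be controlled by the graph norm; the
Banach-Steinhaus theorem applied to the errors divided by `δ^σ` makes the rate uniform on the unit
ball of `Z`. -/

variable (B) in
theorem ext_inner_left {x y : X} (h : ∀ z : X, inner B z x = inner B z y) : x = y := by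
  rw [← sub_eq_zero, ← CStarModule.inner_self (A := B), CStarModule.inner_sub_right, h, sub_self]

theorem norm_sub_swap_inner (x y : X) : ‖(inner B x y : B)‖ = ‖(inner B y x : B)‖ := by
  rw [← CStarModule.star_inner, norm_star]

/-- A bounded operator on a Hilbert module whose quadratic form is positive and coercive is
invertible. -/
theorem isUnit_of_coercive [CompleteSpace X] (Q : X →L[ℂ] X)
    (hpos : ∀ x, 0 ≤ (inner B x (Q x) : B)) (C : ℝ)
    (hC : ∀ x, ‖x‖ ^ 2 ≤ C * ‖(inner B x (Q x) : B)‖) : IsUnit Q := by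
  -- The continuity method along `Q + t`, `t ≥ 0`, with no use of an adjoint of `Q`. Replacing `C`
  -- by a number at least 1 makes it positive.
  set C' : ℝ := max C 1 with hC'
  have hC1 : 1 ≤ C' := le_max_right _ _
  have hC0 : 0 < C' := by linarith
  -- The lower bound is uniform in `t`, because adding `t ≥ 0` only increases the quadratic form.
  have hlow : ∀ (t : ℝ), 0 ≤ t → ∀ x, ‖x‖ ≤ C' * ‖(Q + (t : ℂ) • (1 : X →L[ℂ] X)) x‖ := by
    intro t ht x
    have h1 : (inner B x (Q x) : B) ≤ inner B x ((Q + (t : ℂ) • (1 : X →L[ℂ] X)) x) := by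
      simp only [add_apply, smul_apply,
        one_apply_eq_self, CStarModule.inner_add_right,
        CStarModule.inner_smul_right_complex]
      refine le_add_of_nonneg_right ?_
      rw [Complex.coe_smul]
      exact smul_nonneg ht CStarModule.inner_self_nonneg
    have h2 := CStarAlgebra.norm_le_norm_of_nonneg_of_le (hpos x) h1
    have h3 : ‖x‖ ^ 2 ≤ C' * (‖x‖ * ‖(Q + (t : ℂ) • (1 : X →L[ℂ] X)) x‖) := by
      calc ‖x‖ ^ 2 ≤ C * ‖(inner B x (Q x) : B)‖ := hC x
        _ ≤ C' * ‖(inner B x (Q x) : B)‖ := by gcongr; exact le_max_left _ _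
        _ ≤ _ := by gcongr; exact h2.trans (CStarModule.norm_inner_le X)
    rcases (norm_nonneg x).eq_or_lt with h0 | h0
    · rw [← h0]; positivity
    · nlinarith
  -- By `hlow` every inverse along the path has norm at most `C'`, so invertibility propagates over
  -- a distance independent of `t`.
  have hstep : ∀ (t t' : ℝ), 0 ≤ t → |t - t'| < C'⁻¹ →
      IsUnit (Q + (t : ℂ) • (1 : X →L[ℂ] X)) → IsUnit (Q + (t' : ℂ) • (1 : X →L[ℂ] X)) := by
    rintro t t' ht htt ⟨u, hu⟩
    have hnorm : ‖((u⁻¹ : (X →L[ℂ] X)ˣ) : X →L[ℂ] X)‖ ≤ C' := by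
      refine ContinuousLinearMap.opNorm_le_bound _ hC0.le fun x => ?_
      have h := hlow t ht (((u⁻¹ : (X →L[ℂ] X)ˣ) : X →L[ℂ] X) x)
      rw [← hu, ← mul_apply_eq_comp, Units.mul_inv,
        one_apply_eq_self] at h
      exact h
    -- A vanishing inverse means that the operator ring is trivial; there the radius `‖u⁻¹‖⁻¹` of
    -- the perturbation argument would be `0⁻¹ = 0`.
    by_cases hz : ‖((u⁻¹ : (X →L[ℂ] X)ˣ) : X →L[ℂ] X)‖ = 0
    · have h1 : (1 : X →L[ℂ] X) = 0 := by
        rw [← Units.mul_inv u, norm_eq_zero.1 hz, mul_zero]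
      have : Subsingleton (X →L[ℂ] X) := subsingleton_of_zero_eq_one h1.symm
      exact isUnit_of_subsingleton _
    · refine ⟨Units.ofNearby u _ ?_, rfl⟩
      have h2 : (Q + (t' : ℂ) • (1 : X →L[ℂ] X)) - u = ((t' - t : ℝ) : ℂ) • (1 : X →L[ℂ] X) := by
        rw [hu]; push_cast; rw [sub_smul]; abel
      rw [h2, norm_smul, Complex.norm_real, Real.norm_eq_abs, abs_sub_comm]
      have h3 : ‖(1 : X →L[ℂ] X)‖ ≤ 1 := ContinuousLinearMap.norm_id_le
      calc |t - t'| * ‖(1 : X →L[ℂ] X)‖ ≤ |t - t'| * 1 := by gcongr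
        _ < C'⁻¹ := by simpa using htt
        _ ≤ _ := by
          gcongr
  set h : ℝ := (2 * C')⁻¹ with hh
  have hh0 : 0 < h := by positivity
  have hhC : h < C'⁻¹ := by rw [hh]; gcongr; linarith
  obtain ⟨N, hN⟩ := exists_nat_gt (‖Q‖ / h)
  have hNQ : ‖Q‖ < N * h := by rwa [div_lt_iff₀ hh0] at hN
  -- Start at `t = N h > ‖Q‖`, where the Neumann series applies, and descend to `t = 0` in `N` steps
  -- of length `h`.
  have hmain : ∀ m : ℕ, m ≤ N → IsUnit (Q + (((N - m : ℕ) * h : ℝ) : ℂ) • (1 : X →L[ℂ] X)) := by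
    intro m
    induction m with
    | zero =>
      intro _
      have hT : 0 < (N : ℝ) * h := (norm_nonneg Q).trans_lt hNQ
      have hT' : (((N : ℝ) * h : ℝ) : ℂ) ≠ 0 := by exact_mod_cast hT.ne'
      have h1 : IsUnit ((1 : X →L[ℂ] X) - (-((((N : ℝ) * h : ℝ) : ℂ)⁻¹ • Q))) := by
        refine isUnit_one_sub_of_norm_lt_one ?_
        rw [norm_neg, norm_smul, norm_inv, Complex.norm_real, Real.norm_of_nonneg hT.le,
          inv_mul_lt_iff₀ hT]
        simpa using hNQ
      have h2 : Q + (((N - 0 : ℕ) * h : ℝ) : ℂ) • (1 : X →L[ℂ] X)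
          = (Units.mk0 _ hT') • ((1 : X →L[ℂ] X) - (-((((N : ℝ) * h : ℝ) : ℂ)⁻¹ • Q))) := by
        rw [Units.smul_def, Units.val_mk0, sub_neg_eq_add, smul_add, smul_smul,
          mul_inv_cancel₀ hT', one_smul, Nat.sub_zero, add_comm]
      rw [h2]
      exact h1.smul _
    | succ m ih =>
      intro hm
      refine hstep (((N - m : ℕ) : ℝ) * h) _ (by positivity) ?_ (ih (by omega))
      have : N - m = (N - (m + 1)) + 1 := by omega
      rw [this, ← sub_mul]
      push_cast
      rw [add_sub_cancel_left, one_mul, abs_of_pos hh0]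
      exact hhC
  simpa using hmain N le_rfl

/-- The rank one operator `z ↦ ⟨x, z⟩ y`. -/
def rankOne (x : X) (y : Y) : X →L[ℂ] Y :=
  LinearMap.mkContinuous
    { toFun := fun z => (inner B x z : B) • y
      map_add' := fun z w => by rw [CStarModule.inner_add_right, add_smul]
      map_smul' := fun c z => by
        rw [CStarModule.inner_smul_right_complex, RingHom.id_apply, smul_assoc] }
    (‖x‖ * ‖y‖) fun z => by
      refine (CStarModule.norm_base_smul_le _ _).trans ?_
      calc ‖(inner B x z : B)‖ * ‖y‖ ≤ (‖x‖ * ‖z‖) * ‖y‖ := by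
            gcongr; exact CStarModule.norm_inner_le X
        _ = _ := by ring

@[simp] theorem rankOne_apply (x : X) (y : Y) (z : X) :
    rankOne (B := B) x y z = (inner B x z : B) • y := rfl

theorem inner_rankOne_left (x : X) (y : Y) (z : X) (v : Y) :
    (inner B (rankOne (B := B) x y z) v : B) = inner B z (rankOne (B := B) y x v) := by
  simp only [rankOne_apply, CStarModule.inner_op_smul_left, CStarModule.inner_op_smul_right,
    CStarModule.star_inner]

/-- The map `b ↦ b x`. -/
def smulVec (x : X) : B →L[ℂ] X :=
  LinearMap.mkContinuous
    { toFun := fun b => b • x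
      map_add' := fun b c => add_smul b c x
      map_smul' := fun c b => by rw [RingHom.id_apply, smul_assoc] }
    ‖x‖ fun b => by
      rw [mul_comm]; exact CStarModule.norm_base_smul_le b x

@[simp] theorem smulVec_apply (x : X) (b : B) : smulVec x b = b • x := rfl

variable (B) in
/-- The frame operator `z ↦ ∑ ⟨wᵢ, z⟩ wᵢ`. -/
def frameOp {ι : Type*} [Fintype ι] (w : ι → X) : X →L[ℂ] X :=
  ∑ i, rankOne (B := B) (w i) (w i)

theorem frameOp_apply {ι : Type*} [Fintype ι] (w : ι → X) (z : X) :
    frameOp B w z = ∑ i, (inner B (w i) z : B) • w i := by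
  simp [frameOp]

theorem inner_frameOp_left {ι : Type*} [Fintype ι] (w : ι → X) (x y : X) :
    (inner B (frameOp B w x) y : B) = inner B x (frameOp B w y) := by
  simp only [frameOp, sum_apply, CStarModule.inner_sum_left,
    CStarModule.inner_sum_right, inner_rankOne_left]

/-- A finite generating family of a Hilbert module is a frame: its frame operator is invertible. -/
theorem isUnit_frameOp [CompleteSpace X] {ι : Type*} [Fintype ι] (w : ι → X)
    (hw : Submodule.span B (Set.range w) = ⊤) : IsUnit (frameOp B w) := by
  have hAA : ∀ z, (inner B z (frameOp B w z) : B)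
      = ∑ i, (inner B (w i) z : B) * star (inner B (w i) z) := fun z => by
    rw [frameOp_apply, CStarModule.inner_sum_right]
    simp only [CStarModule.inner_op_smul_right, CStarModule.star_inner]
  have hterm : ∀ z i, 0 ≤ (inner B (w i) z : B) * star (inner B (w i) z) :=
    fun z i => mul_star_self_nonneg _
  let T : (ι → B) →L[ℂ] X := ∑ i, (smulVec (w i)).comp (ContinuousLinearMap.proj i)
  have hT : ∀ b, T b = ∑ i, b i • w i := fun b => by simp [T]
  have hsurj : Function.Surjective T := fun z => by
    obtain ⟨c, hc⟩ := (Submodule.mem_span_range_iff_exists_fun B).1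
      (hw ▸ Submodule.mem_top : z ∈ Submodule.span B (Set.range w))
    exact ⟨c, (hT c).trans hc⟩
  -- The open mapping theorem gives coefficients `b` of `z` with `‖b‖ ≤ C ‖z‖`. Expanding one `z` in
  -- `⟨z, z⟩` and using that each `‖⟨wᵢ, z⟩‖²` is at most the norm of the quadratic form yields
  -- coercivity.
  obtain ⟨C, hC, hTC⟩ := T.exists_preimage_norm_le hsurj
  refine isUnit_of_coercive (B := B) _ (fun z => ?_) ((C * Fintype.card ι) ^ 2) fun z => ?_
  · rw [hAA]; exact Finset.sum_nonneg fun i _ => hterm z i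
  · obtain ⟨b, hb, hbC⟩ := hTC z
    set q : ℝ := ‖(inner B z (frameOp B w z) : B)‖ with hq
    have hi : ∀ i, ‖(inner B (w i) z : B)‖ ≤ √q := fun i => by
      refine Real.le_sqrt_of_sq_le ?_
      rw [pow_two, ← CStarRing.norm_self_mul_star, hq, hAA]
      refine CStarAlgebra.norm_le_norm_of_nonneg_of_le (hterm z i) ?_
      exact Finset.single_le_sum (f := fun i => (inner B (w i) z : B) * star (inner B (w i) z))
        (fun j _ => hterm z j) (Finset.mem_univ i)
    have h1 : ‖z‖ ^ 2 ≤ ‖z‖ * (C * Fintype.card ι * √q) := by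
      calc ‖z‖ ^ 2 = ‖∑ i, b i * (inner B z (w i) : B)‖ := by
            rw [CStarModule.norm_sq_eq B]
            conv_lhs => rw [← hb, hT, CStarModule.inner_sum_right, ← hT, hb]
            simp only [CStarModule.inner_op_smul_right]
        _ ≤ ∑ i, ‖b i * (inner B z (w i) : B)‖ := norm_sum_le _ _
        _ ≤ ∑ _i : ι, (C * ‖z‖) * √q := by
            refine Finset.sum_le_sum fun i _ => (norm_mul_le _ _).trans ?_
            rw [norm_sub_swap_inner]
            exact mul_le_mul ((norm_le_pi_norm b i).trans hbC) (hi i) (norm_nonneg _)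
              (by positivity)
        _ = _ := by simp; ring
    have h2 : ‖z‖ ≤ C * Fintype.card ι * √q := by
      rcases (norm_nonneg z).eq_or_lt with h0 | h0
      · rw [← h0]; positivity
      · nlinarith
    calc ‖z‖ ^ 2 ≤ (C * Fintype.card ι * √q) ^ 2 := by gcongr
      _ = _ := by rw [mul_pow, Real.sq_sqrt (norm_nonneg _)]

theorem apply_inverse_apply {A : X →L[ℂ] X} (hA : IsUnit A) (z : X) :
    A (Ring.inverse A z) = z := by
  rw [← mul_apply_eq_comp, Ring.mul_inverse_cancel _ hA, one_apply_eq_self]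

theorem inverse_apply_apply {A : X →L[ℂ] X} (hA : IsUnit A) (z : X) :
    Ring.inverse A (A z) = z := by
  rw [← mul_apply_eq_comp, Ring.inverse_mul_cancel _ hA, one_apply_eq_self]

theorem inner_inverse_left {A : X →L[ℂ] X} (hA : IsUnit A)
    (hs : ∀ x y, (inner B (A x) y : B) = inner B x (A y)) (x y : X) :
    (inner B (Ring.inverse A x) y : B) = inner B x (Ring.inverse A y) := by
  conv_lhs => rw [← apply_inverse_apply hA y]
  rw [← hs, apply_inverse_apply hA]

/-- Reconstruction from the canonical dual frame. -/
theorem sum_inner_inverse_frameOp_smul [CompleteSpace X] {ι : Type*} [Fintype ι] (w : ι → X)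
    (hw : Submodule.span B (Set.range w) = ⊤) (z : X) :
    ∑ i, (inner B (Ring.inverse (frameOp B w) (w i)) z : B) • w i = z := by
  have hA := isUnit_frameOp w hw
  simp only [inner_inverse_left hA (inner_frameOp_left w)]
  rw [← frameOp_apply, apply_inverse_apply hA]

end CStarModule

/-! ### Adjointable and compact operators -/

open CStarModule

theorem IsAdjointable.comp {S : Y →L[ℂ] Z} {T : X →L[ℂ] Y} (hS : IsAdjointable B S)
    (hT : IsAdjointable B T) : IsAdjointable B (S.comp T) := by
  obtain ⟨S', hS'⟩ := hS
  obtain ⟨T', hT'⟩ := hT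
  exact ⟨T'.comp S', fun x y => by
    rw [ContinuousLinearMap.comp_apply, hS', hT', ContinuousLinearMap.comp_apply]⟩

theorem inner_swap_of_adjoint {T : X →L[ℂ] Y} {T' : Y →L[ℂ] X}
    (h : ∀ x y, (inner B (T x) y : B) = inner B x (T' y)) (x : X) (y : Y) :
    (inner B (T' y) x : B) = inner B y (T x) := by
  rw [← CStarModule.star_inner, ← h, CStarModule.star_inner]

/-- Bounded operators are bundled as `ℂ`-linear maps only; the adjoint supplies `B`-linearity, by
testing against inner products. -/
theorem IsAdjointable.map_base_smul {T : X →L[ℂ] Y} (hT : IsAdjointable B T) (b : B) (x : X) :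
    T (b • x) = b • T x := by
  obtain ⟨T', h⟩ := hT
  refine ext_inner_left B fun z => ?_
  rw [← inner_swap_of_adjoint h, CStarModule.inner_op_smul_right, CStarModule.inner_op_smul_right,
    inner_swap_of_adjoint h]

namespace IsBCompact

variable (B X Y) in
/-- The `B`-finite rank operators. -/
def finiteRank : Submodule ℂ (X →L[ℂ] Y) :=
  Submodule.span ℂ {R : X →L[ℂ] Y | ∃ (x : X) (y : Y), ∀ z : X, R z = (inner B x z : B) • y}

theorem rankOne_mem (x : X) (y : Y) : rankOne (B := B) x y ∈ finiteRank B X Y :=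
  Submodule.subset_span ⟨x, y, fun _ => rfl⟩

theorem sum {ι : Type*} (t : Finset ι) {T : ι → X →L[ℂ] Y}
    (h : ∀ i ∈ t, IsBCompact B (T i)) : IsBCompact B (∑ i ∈ t, T i) :=
  Submodule.sum_mem (finiteRank B X Y).topologicalClosure h

theorem of_forall_exists {T : X →L[ℂ] Y}
    (h : ∀ ε > 0, ∃ S ∈ finiteRank B X Y, ‖T - S‖ < ε) : IsBCompact B T :=
  Metric.mem_closure_iff.2 fun ε hε => by
    obtain ⟨S, hS, h⟩ := h ε hε
    exact ⟨S, hS, by rwa [dist_eq_norm]⟩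

theorem comp_left {T : X →L[ℂ] Y} (hT : IsBCompact B T) {S : Y →L[ℂ] Z}
    (hS : IsAdjointable B S) : IsBCompact B (S.comp T) := by
  refine map_mem_closure (f := fun T : X →L[ℂ] Y => S.comp T)
    ((ContinuousLinearMap.compL ℂ X Y Z S).continuous) hT fun R hR => ?_
  refine Submodule.span_induction ?_ ?_ ?_ ?_ hR
  · rintro R ⟨x, y, h⟩
    refine Submodule.subset_span ⟨x, S y, fun z => ?_⟩
    rw [ContinuousLinearMap.comp_apply, h, hS.map_base_smul]
  · simp
  · intro R R' _ _ h h'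
    simpa [ContinuousLinearMap.comp_add] using Submodule.add_mem _ h h'
  · intro c R _ h
    simpa using Submodule.smul_mem _ c h

theorem rankOne_comp {A : Z →L[ℂ] X} {A' : X →L[ℂ] Z}
    (hA : ∀ x y, (inner B (A x) y : B) = inner B x (A' y)) (x : X) (y : Y) :
    (rankOne (B := B) x y).comp A = rankOne (B := B) (A' x) y := by
  ext z
  rw [ContinuousLinearMap.comp_apply, rankOne_apply, rankOne_apply, inner_swap_of_adjoint hA]

end IsBCompact

/-- An operator that has an adjoint on a dense set of vectors is adjointable. -/
theorem isAdjointable_of_dense [CompleteSpace X] (A : X →L[ℂ] Y)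
    (hd : Dense {y : Y | ∃ h : X, ∀ f : X, (inner B (A f) y : B) = inner B f h}) :
    IsAdjointable B A := by
  -- Where the adjoint is defined it is bounded by `‖A‖`, so it carries Cauchy sequences to Cauchy
  -- sequences and extends to the closure of its domain.
  have hbound : ∀ (y : Y) (h : X), (∀ f : X, (inner B (A f) y : B) = inner B f h) →
      ‖h‖ ≤ ‖A‖ * ‖y‖ := by
    intro y h hy
    have h1 : ‖h‖ ^ 2 ≤ ‖h‖ * (‖A‖ * ‖y‖) := by
      rw [CStarModule.norm_sq_eq B, ← hy]
      calc ‖(inner B (A h) y : B)‖ ≤ ‖A h‖ * ‖y‖ := CStarModule.norm_inner_le Y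
        _ ≤ (‖A‖ * ‖h‖) * ‖y‖ := by gcongr; exact A.le_opNorm h
        _ = _ := by ring
    rcases (norm_nonneg h).eq_or_lt with h0 | h0
    · rw [← h0]; positivity
    · nlinarith
  have hall : ∀ y : Y, ∃ h : X, ∀ f : X, (inner B (A f) y : B) = inner B f h := by
    intro y
    obtain ⟨u, hu, huy⟩ := mem_closure_iff_seq_limit.1 (hd y)
    choose h hh using hu
    have hcau : CauchySeq h := by
      refine Metric.cauchySeq_iff.2 fun ε hε => ?_
      have hc := Metric.cauchySeq_iff.1 huy.cauchySeq (ε / (‖A‖ + 1)) (by positivity)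
      obtain ⟨N, hN⟩ := hc
      refine ⟨N, fun m hm n hn => ?_⟩
      rw [dist_eq_norm]
      have h1 := hbound (u m - u n) (h m - h n) fun f => by
        rw [CStarModule.inner_sub_right, CStarModule.inner_sub_right, hh, hh]
      have h2 := hN m hm n hn
      rw [dist_eq_norm, lt_div_iff₀ (by positivity)] at h2
      have := norm_nonneg (u m - u n)
      nlinarith
    obtain ⟨h', hh'⟩ := cauchySeq_tendsto_of_complete hcau
    refine ⟨h', fun f => ?_⟩
    have h1 : Tendsto (fun n => (inner B (A f) (u n) : B)) atTop (𝓝 (inner B (A f) y)) :=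
      ((CStarModule.continuous_inner (A := B)).tendsto (A f, y)).comp
        (tendsto_const_nhds.prodMk_nhds huy)
    have h2 : Tendsto (fun n => (inner B f (h n) : B)) atTop (𝓝 (inner B f h')) :=
      ((CStarModule.continuous_inner (A := B)).tendsto (f, h')).comp
        (tendsto_const_nhds.prodMk_nhds hh')
    simp only [hh] at h1
    exact tendsto_nhds_unique h1 h2
  choose S hS using hall
  refine ⟨LinearMap.mkContinuous
    { toFun := S
      map_add' := fun x y => ext_inner_left B fun f => by
        rw [← hS, CStarModule.inner_add_right, CStarModule.inner_add_right, hS, hS]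
      map_smul' := fun c x => ext_inner_left B fun f => by
        rw [← hS, RingHom.id_apply, CStarModule.inner_smul_right_complex,
          CStarModule.inner_smul_right_complex, hS] } ‖A‖
    fun y => hbound y _ (hS y), fun x y => hS y x⟩

/-- Let the inner product of `Z` be the sum of the pullbacks along `ι : Z → X` and `T : Z → Y`, and
let `‖ι f‖ ≤ C (‖K ι f‖ + ‖T f‖)`.  Then the form `⟨K ι f, K ι g⟩ + ⟨T f, T g⟩` on `Z` is
represented by an invertible operator. -/
theorem exists_form_inverse [CompleteSpace Z] (ι : Z →L[ℂ] X) (T : Z →L[ℂ] Y)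
    (hin : ∀ f g, (inner B f g : B) = inner B (ι f) (ι g) + inner B (T f) (T g))
    {R : X →L[ℂ] Z} (hR : ∀ x y, (inner B (ι x) y : B) = inner B x (R y))
    {P : Y →L[ℂ] Z} (hP : ∀ x y, (inner B (T x) y : B) = inner B x (P y))
    {K K' : X →L[ℂ] X} (hK : ∀ x y, (inner B (K x) y : B) = inner B x (K' y)) (C : ℝ)
    (hC : ∀ f, ‖ι f‖ ≤ C * (‖K (ι f)‖ + ‖T f‖)) :
    ∃ G : Z →L[ℂ] Z, (∀ f g, (inner B (G f) g : B) = inner B f (G g)) ∧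
      (∀ f g, (inner B f g : B)
        = inner B (K (ι f)) (K (ι (G g))) + inner B (T f) (T (G g))) ∧
      ∀ f, G (R (K' (K (ι f))) + P (T f)) = f := by
  set Q : Z →L[ℂ] Z := R.comp ((K'.comp K).comp ι) + P.comp T with hQ
  have hQi : ∀ f g, (inner B f (Q g) : B)
      = inner B (K (ι f)) (K (ι g)) + inner B (T f) (T g) := fun f g => by
    simp only [hQ, add_apply, ContinuousLinearMap.comp_apply,
      CStarModule.inner_add_right, ← hR, ← hP, ← hK]
  have hQs : ∀ f g, (inner B (Q f) g : B) = inner B f (Q g) := fun f g => by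
    rw [← CStarModule.star_inner, hQi, hQi, star_add, CStarModule.star_inner,
      CStarModule.star_inner]
  have hunit : IsUnit Q := by
    -- With `q` the norm of the form at `f`, both `‖K ι f‖²` and `‖T f‖²` are at most `q`. Hence `‖ι
    -- f‖² ≤ C² · 4q` and `‖f‖² ≤ ‖ι f‖² + ‖T f‖² ≤ (4C² + 1) q`.
    refine isUnit_of_coercive (B := B) Q (fun f => ?_) (4 * C ^ 2 + 1) fun f => ?_
    · rw [hQi]; exact add_nonneg CStarModule.inner_self_nonneg CStarModule.inner_self_nonneg
    · set q : ℝ := ‖(inner B f (Q f) : B)‖ with hq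
      have h1 : ‖K (ι f)‖ ^ 2 ≤ q := by
        rw [CStarModule.norm_sq_eq B, hq, hQi]
        exact CStarAlgebra.norm_le_norm_of_nonneg_of_le CStarModule.inner_self_nonneg
          (le_add_of_nonneg_right CStarModule.inner_self_nonneg)
      have h2 : ‖T f‖ ^ 2 ≤ q := by
        rw [CStarModule.norm_sq_eq B, hq, hQi]
        exact CStarAlgebra.norm_le_norm_of_nonneg_of_le CStarModule.inner_self_nonneg
          (le_add_of_nonneg_left CStarModule.inner_self_nonneg)
      have h3 : ‖ι f‖ ≤ C * (‖K (ι f)‖ + ‖T f‖) := hC f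
      have h4 : ‖f‖ ^ 2 ≤ ‖ι f‖ ^ 2 + ‖T f‖ ^ 2 := by
        rw [CStarModule.norm_sq_eq B, hin, CStarModule.norm_sq_eq B,
          CStarModule.norm_sq_eq B (x := T f)]
        exact norm_add_le _ _
      have h5 : ‖ι f‖ ^ 2 ≤ C ^ 2 * (‖K (ι f)‖ + ‖T f‖) ^ 2 := by
        rw [← mul_pow]; gcongr
      have h6 : (‖K (ι f)‖ + ‖T f‖) ^ 2 ≤ 4 * q := by
        nlinarith [sq_nonneg (‖K (ι f)‖ - ‖T f‖)]
      nlinarith [sq_nonneg C, mul_le_mul_of_nonneg_left h6 (sq_nonneg C)]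
  refine ⟨Ring.inverse Q, inner_inverse_left hunit hQs, fun f g => ?_,
    fun f => inverse_apply_apply hunit f⟩
  rw [← hQi, apply_inverse_apply hunit]

/-- From `1 = G (ι* K* K ι + T* T)` one reads off `1 - (G T*) T = G ι* K* (K ι)`, a compact operator
followed by adjointable ones. -/
theorem isLeftBFredholm_of_parametrix {ι : Z →L[ℂ] X} {T : Z →L[ℂ] Y}
    {R : X →L[ℂ] Z} (hR : ∀ x y, (inner B (ι x) y : B) = inner B x (R y))
    {P : Y →L[ℂ] Z} (hP : ∀ x y, (inner B (T x) y : B) = inner B x (P y))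
    {K K' : X →L[ℂ] X} (hK : ∀ x y, (inner B (K x) y : B) = inner B x (K' y))
    {G : Z →L[ℂ] Z} (hGs : ∀ f g, (inner B (G f) g : B) = inner B f (G g))
    (hG : ∀ f, G (R (K' (K (ι f))) + P (T f)) = f) (hcpt : IsBCompact B (K.comp ι)) :
    IsLeftBFredholm B T := by
  refine ⟨G.comp P, IsAdjointable.comp ⟨G, hGs⟩ ⟨T, fun x y => inner_swap_of_adjoint hP y x⟩, ?_⟩
  have h : ContinuousLinearMap.id ℂ Z - (G.comp P).comp T
      = (G.comp (R.comp K')).comp (K.comp ι) := by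
    ext f
    have := hG f
    rw [map_add] at this
    exact sub_eq_of_eq_add this.symm
  rw [h]
  refine hcpt.comp_left (IsAdjointable.comp ⟨G, hGs⟩ (IsAdjointable.comp ?_ ?_))
  · exact ⟨ι, fun x y => inner_swap_of_adjoint hR y x⟩
  · exact ⟨K, fun x y => inner_swap_of_adjoint hK y x⟩

/-- A left Fredholm operator is bounded below up to finitely many functionals from a dense set. -/
theorem IsLeftBFredholm.exists_bound {ι : Z →L[ℂ] X} {A : Z →L[ℂ] Y} (h : IsLeftBFredholm B A)
    (hin : ∀ f g, (inner B f g : B) = inner B (ι f) (ι g) + inner B (A f) (A g))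
    (hι : ∀ f, ‖ι f‖ ≤ ‖f‖) {S : Set X} (hS : Dense S) :
    ∃ (t : Finset X) (C : ℝ), (t : Set X) ⊆ S ∧
      ∀ f : Z, ‖ι f‖ ≤ C * (∑ x ∈ t, ‖(inner B x (ι f) : B)‖ + ‖A f‖) := by
  classical
  obtain ⟨T, -, hT⟩ := h
  -- every finite rank operator is controlled by finitely many functionals, up to a small error
  have key : ∀ R ∈ IsBCompact.finiteRank B Z Z, ∀ ε > 0,
      ∃ (t : Finset X) (C : ℝ), 0 ≤ C ∧ (t : Set X) ⊆ S ∧ ∀ f : Z,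
        ‖R f‖ ≤ C * (∑ x ∈ t, ‖(inner B x (ι f) : B)‖ + ‖A f‖) + ε * ‖f‖ := by
    intro R hR
    refine Submodule.span_induction ?_ ?_ ?_ ?_ hR
    · rintro R ⟨x, y, h⟩ ε hε
      -- The graph functional splits as `⟨x, f⟩ = ⟨ι x, ι f⟩ + ⟨A x, A f⟩`. Only `ι x` has to be
      -- moved into `S`, at the cost of a small multiple of `‖f‖`; the second term is absorbed by
      -- `‖A f‖`.
      obtain ⟨s, hs, hsx⟩ := Metric.mem_closure_iff.1 (hS (ι x)) (ε / (‖y‖ + 1))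
        (by positivity)
      refine ⟨{s}, ‖y‖ * (1 + ‖A x‖), by positivity, by simpa using hs, fun f => ?_⟩
      rw [dist_eq_norm, lt_div_iff₀ (by positivity)] at hsx
      rw [h, Finset.sum_singleton]
      set a := ‖(inner B s (ι f) : B)‖
      have h1 : ‖(inner B x f : B)‖ ≤ ‖ι x - s‖ * ‖f‖ + a + ‖A x‖ * ‖A f‖ := by
        have : (inner B x f : B) = inner B (ι x - s) (ι f) + inner B s (ι f)
            + inner B (A x) (A f) := by
          rw [hin, CStarModule.inner_sub_left]; abel
        rw [this]
        refine (norm_add₃_le).trans (add_le_add_three ?_ le_rfl (CStarModule.norm_inner_le Y))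
        refine (CStarModule.norm_inner_le X).trans ?_
        gcongr
        exact hι f
      refine (CStarModule.norm_base_smul_le _ _).trans ?_
      have h2 := mul_le_mul_of_nonneg_right h1 (norm_nonneg y)
      have ha : 0 ≤ a := norm_nonneg _
      have hy := norm_nonneg y
      have hf := norm_nonneg f
      have h4 : ‖ι x - s‖ * ‖y‖ * ‖f‖ ≤ ε * ‖f‖ := by
        gcongr
        nlinarith [norm_nonneg (ι x - s)]
      have h5 := mul_nonneg (mul_nonneg hy (norm_nonneg (A x))) ha
      have h6 := mul_nonneg hy (norm_nonneg (A f))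
      nlinarith
    · intro ε hε
      exact ⟨∅, 0, le_rfl, by simp, fun f => by simp; positivity⟩
    · intro R R' _ _ hR hR' ε hε
      obtain ⟨t, C, hC, ht, h⟩ := hR (ε / 2) (by positivity)
      obtain ⟨t', C', hC', ht', h'⟩ := hR' (ε / 2) (by positivity)
      refine ⟨t ∪ t', C + C', by positivity, by simp [ht, ht'], fun f => ?_⟩
      have h1 : ∑ x ∈ t, ‖(inner B x (ι f) : B)‖
          ≤ ∑ x ∈ t ∪ t', ‖(inner B x (ι f) : B)‖ :=
        Finset.sum_le_sum_of_subset_of_nonneg Finset.subset_union_left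
          fun _ _ _ => norm_nonneg _
      have h2 : ∑ x ∈ t', ‖(inner B x (ι f) : B)‖
          ≤ ∑ x ∈ t ∪ t', ‖(inner B x (ι f) : B)‖ :=
        Finset.sum_le_sum_of_subset_of_nonneg Finset.subset_union_right
          fun _ _ _ => norm_nonneg _
      have h3 := mul_le_mul_of_nonneg_left h1 hC
      have h4 := mul_le_mul_of_nonneg_left h2 hC'
      calc ‖(R + R') f‖ ≤ ‖R f‖ + ‖R' f‖ := norm_add_le _ _
        _ ≤ _ := add_le_add (h f) (h' f)
        _ ≤ _ := by linarith
    · intro c R _ hR ε hε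
      obtain ⟨t, C, hC, ht, h⟩ := hR (ε / (‖c‖ + 1)) (by positivity)
      refine ⟨t, ‖c‖ * C, by positivity, ht, fun f => ?_⟩
      have h1 : ‖c‖ * (ε / (‖c‖ + 1)) ≤ ε := by
        rw [mul_div_assoc', div_le_iff₀ (by positivity)]
        nlinarith [norm_nonneg c]
      calc ‖(c • R) f‖ = ‖c‖ * ‖R f‖ := norm_smul _ _
        _ ≤ _ := mul_le_mul_of_nonneg_left (h f) (norm_nonneg c)
        _ ≤ _ := by
          have := mul_le_mul_of_nonneg_right h1 (norm_nonneg f)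
          linarith
  -- The two errors of `1/4` add up to half of `‖f‖`, which is absorbed on the left; this is the
  -- factor 2 in the constant below.
  obtain ⟨R, hR, hTR⟩ := Metric.mem_closure_iff.1 hT (1 / 4) (by positivity)
  rw [dist_eq_norm] at hTR
  obtain ⟨t, C, hC, ht, h⟩ := key R hR (1 / 4) (by positivity)
  refine ⟨t, 2 * (C + ‖T‖), ht, fun f => ?_⟩
  have h1 : ∀ f : Z, ‖f‖ ≤ ‖T‖ * ‖A f‖ + 1 / 4 * ‖f‖ + ‖R f‖ := fun f => by
    have : f = T (A f) + (ContinuousLinearMap.id ℂ Z - T.comp A - R) f + R f := by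
      simp only [sub_apply, ContinuousLinearMap.comp_apply, ContinuousLinearMap.id_apply]
      abel
    calc ‖f‖ = ‖T (A f) + (ContinuousLinearMap.id ℂ Z - T.comp A - R) f + R f‖ := by
          rw [← this]
      _ ≤ _ := norm_add₃_le
      _ ≤ _ := add_le_add_three (T.le_opNorm _)
          ((ContinuousLinearMap.le_opNorm _ _).trans (by gcongr)) le_rfl
  have h5 : 0 ≤ ‖T‖ * ∑ x ∈ t, ‖(inner B x (ι f) : B)‖ :=
    mul_nonneg (norm_nonneg _) (Finset.sum_nonneg fun _ _ => norm_nonneg _)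
  linarith [h1 f, h f, hι f]

/-! ### Regular operators -/

namespace UnboundedOp

namespace GraphDomain

theorem norm_sq_le (D : X →ₗ.[B] Y) (x : GraphDomain D) :
    ‖x‖ ^ 2 ≤ ‖incl D x‖ ^ 2 + ‖opL D x‖ ^ 2 := by
  rw [CStarModule.norm_sq_eq B, inner_def, CStarModule.norm_sq_eq B,
    CStarModule.norm_sq_eq B (x := opL D x)]
  exact norm_add_le _ _

/-- The inclusion of the domain, with the graph norm, as a bounded operator. -/
def inclL (D : X →ₗ.[B] Y) : GraphDomain D →L[ℂ] X :=
  LinearMap.mkContinuous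
    { toFun := incl D
      map_add' := map_add _
      map_smul' := incl_smul_complex D } 1 fun x => by
    rw [one_mul]
    refine le_of_sq_le_sq ?_ (norm_nonneg _)
    rw [CStarModule.norm_sq_eq B, CStarModule.norm_sq_eq B (x := x)]
    refine CStarAlgebra.norm_le_norm_of_nonneg_of_le CStarModule.inner_self_nonneg ?_
    rw [inner_def]
    exact le_add_of_nonneg_right CStarModule.inner_self_nonneg

theorem inner_eq (D : X →ₗ.[B] Y) (x y : GraphDomain D) :
    (inner B x y : B) = inner B (inclL D x) (inclL D y) + inner B (opL D x) (opL D y) := rfl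

theorem norm_inclL_le (D : X →ₗ.[B] Y) (x : GraphDomain D) : ‖inclL D x‖ ≤ ‖x‖ := by
  simpa using (inclL D).le_of_opNorm_le
    (LinearMap.mkContinuous_norm_le _ zero_le_one _) x

/-- The graph norm is equivalent to the norm of `X × Y` restricted to the graph, which is closed and
therefore complete. -/
theorem completeSpace [CompleteSpace X] [CompleteSpace Y] {D : X →ₗ.[B] Y}
    (hD : IsClosed (D.graph : Set (X × Y))) : CompleteSpace (GraphDomain D) := by
  let J : GraphDomain D →L[ℂ] X × Y := (inclL D).prod (opL D)
  have hJ : AntilipschitzWith 2 J := J.antilipschitz_of_bound fun x => by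
    have h1 := norm_sq_le D x
    have h2 : ‖incl D x‖ ≤ ‖J x‖ := le_max_left _ _
    have h3 : ‖opL D x‖ ≤ ‖J x‖ := le_max_right _ _
    refine le_of_sq_le_sq ?_ (by positivity)
    have h4 := norm_nonneg (incl D x)
    have h5 := norm_nonneg (opL D x)
    push_cast
    nlinarith
  have hr : Set.range J = (D.graph : Set (X × Y)) := by
    ext ⟨x, y⟩
    simp only [Set.mem_range, SetLike.mem_coe, LinearPMap.mem_graph_iff]
    constructor
    · rintro ⟨z, hz⟩
      exact ⟨z, congrArg Prod.fst hz, congrArg Prod.snd hz⟩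
    · rintro ⟨z, hz1, hz2⟩
      exact ⟨z, Prod.ext hz1 hz2⟩
  rw [completeSpace_iff_isComplete_range (hJ.isUniformInducing J.uniformContinuous), hr]
  exact hD.isComplete

end GraphDomain

open GraphDomain

/-- For `w = x + D*Dx` one has `⟨f, w⟩ = ⟨f, x⟩ + ⟨Df, Dx⟩`, the graph inner product of `f` and `x`.
So the inclusion has an adjoint on the range of `1 + D*D`, which is dense, and there it acts as `(1
+ D*D)⁻¹`. -/
theorem IsRegular.isAdjointable_inclL [CompleteSpace X] [CompleteSpace Y] {D : X →ₗ.[B] Y}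
    (hD : IsRegular D) : IsAdjointable B (inclL D) := by
  have := completeSpace hD.isClosed_graph
  refine isAdjointable_of_dense _ (hD.dense_range.mono ?_)
  rintro w ⟨x, z, ⟨hx, hz⟩, rfl⟩
  refine ⟨(⟨x, hx⟩ : D.domain), fun f => ?_⟩
  rw [CStarModule.inner_add_right]
  exact congrArg _ (hz f).symm

/-- On the dense domain of `D*` the adjoint is `ι* D*`. -/
theorem IsRegular.isAdjointable_opL [CompleteSpace X] [CompleteSpace Y] {D : X →ₗ.[B] Y}
    (hD : IsRegular D) : IsAdjointable B (opL D) := by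
  have := completeSpace hD.isClosed_graph
  obtain ⟨R, hR⟩ := hD.isAdjointable_inclL
  refine isAdjointable_of_dense _ (hD.dense_domain_adjoint.mono ?_)
  rintro y ⟨z, hz⟩
  exact ⟨R z, fun f => (hz f).trans (hR f z)⟩

/-- The inverse is `ι G ι*`. The identity `⟨f, ι* y⟩ = ⟨Kf, Kg⟩ + ⟨Df, Dg⟩` for `g = G ι* y` is the
weak form of `K*K g + D*D g = y`; as it holds for all `f` in the domain, it puts `Dg` into the
domain of `D*`. -/
theorem IsRegular.invertible_of_bound [CompleteSpace X] [CompleteSpace Y] {D : X →ₗ.[B] Y}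
    (hD : IsRegular D) (K K' : X →L[ℂ] X)
    (hK : ∀ x y, (inner B (K x) y : B) = inner B x (K' y)) (C : ℝ)
    (hC : ∀ f : D.domain, ‖(f : X)‖ ≤ C * (‖K f‖ + ‖D f‖)) :
    IsInvertibleAdd (K'.comp K) D := by
  have hcomp := completeSpace hD.isClosed_graph
  obtain ⟨R, hR⟩ := hD.isAdjointable_inclL
  obtain ⟨P, hP⟩ := hD.isAdjointable_opL
  obtain ⟨G, hGs, hG, hG'⟩ := exists_form_inverse (inclL D) (opL D) (inner_eq D) hR hP hK C hC
  refine ⟨(inclL D).comp (G.comp R), IsAdjointable.comp ⟨R, hR⟩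
    (IsAdjointable.comp ⟨G, hGs⟩ ⟨inclL D, fun x y => inner_swap_of_adjoint hR y x⟩),
    fun y => ?_, ?_⟩
  · refine ⟨y - K' (K (inclL D (G (R y)))), ⟨(G (R y)).2, fun f => ?_⟩, ?_⟩
    · rw [CStarModule.inner_sub_right, ← hK]
      exact eq_sub_of_add_eq' ((hG f (R y)).symm.trans (hR f y).symm)
    · exact add_sub_cancel _ _
  · rintro x z ⟨hx, hz⟩
    have h : R z = P (opL D (⟨x, hx⟩ : D.domain)) :=
      ext_inner_left B fun f => (hR f z).symm.trans ((hz f).symm.trans (hP f _))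
    have h' : R (K' (K x) + z) = R (K' (K x)) + P (opL D (⟨x, hx⟩ : D.domain)) :=
      (map_add R _ _).trans (congrArg _ h)
    exact (congrArg (fun g => inclL D (G g)) h').trans
      (congrArg (inclL D) (hG' (⟨x, hx⟩ : D.domain)))

/-- The parametrix is `G T*`, with the same `G` as for the inverse of `K*K + D*D`. -/
theorem IsRegular.isLeftBFredholm_of_bound [CompleteSpace X] [CompleteSpace Y] {D : X →ₗ.[B] Y}
    (hD : IsRegular D) (K K' : X →L[ℂ] X)
    (hK : ∀ x y, (inner B (K x) y : B) = inner B x (K' y)) (C : ℝ)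
    (hC : ∀ f : D.domain, ‖(f : X)‖ ≤ C * (‖K f‖ + ‖D f‖))
    (hcpt : IsBCompact B (K.comp (inclL D))) : UnboundedOp.IsLeftBFredholm D := by
  have hcomp := completeSpace hD.isClosed_graph
  obtain ⟨R, hR⟩ := hD.isAdjointable_inclL
  obtain ⟨P, hP⟩ := hD.isAdjointable_opL
  obtain ⟨G, hGs, -, hG'⟩ := exists_form_inverse (inclL D) (opL D) (inner_eq D) hR hP hK C hC
  exact isLeftBFredholm_of_parametrix hR hP hK hGs hG' hcpt

/-- An estimate with respect to the graph norm extends from a core to the domain. -/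
theorem IsCore.bound {D : X →ₗ.[B] Y} {𝓒 : Submodule B X} (h𝓒 : IsCore D 𝓒) (K : X →L[ℂ] X)
    (C : ℝ) (hC : ∀ f : D.domain, (f : X) ∈ 𝓒 → ‖(f : X)‖ ≤ C * (‖K f‖ + ‖D f‖))
    (f : D.domain) : ‖(f : X)‖ ≤ C * (‖K f‖ + ‖D f‖) := by
  have hcl : IsClosed {p : X × Y | ‖p.1‖ ≤ C * (‖K p.1‖ + ‖p.2‖)} :=
    isClosed_le (by fun_prop) (by fun_prop)
  refine closure_minimal ?_ hcl (h𝓒.2 f)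
  rintro _ ⟨c, hc, rfl⟩
  exact hC c hc

/-- If `K + D* D` is invertible for some symmetric `K`, then `‖f‖ ≤ C (‖K f‖ + ‖D f‖)`. -/
theorem IsInvertibleAdd.exists_bound {D : X →ₗ.[B] Y} {K : X →L[ℂ] X}
    (hK : ∀ x y, (inner B (K x) y : B) = inner B x (K y)) (h : IsInvertibleAdd K D) :
    ∃ C : ℝ, ∀ f : D.domain, ‖(f : X)‖ ≤ C * (‖K f‖ + ‖D f‖) := by
  obtain ⟨G, -, hG, -⟩ := h
  -- For `g = Gf` this is the constant in `‖Dg‖² = ‖⟨g, D*Dg⟩‖ ≤ ‖g‖ ‖f - Kg‖ ≤ c ‖f‖²`.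
  set c : ℝ := ‖G‖ * (1 + ‖K‖ * ‖G‖) with hc
  have hc0 : 0 ≤ c := by positivity
  refine ⟨‖G‖ + √c, fun f => ?_⟩
  obtain ⟨z, ⟨hz, hadj⟩, hKz⟩ := hG f
  set g : X := G f with hg
  have hgn : ‖g‖ ≤ ‖G‖ * ‖(f : X)‖ := G.le_opNorm f
  have hDg : ‖D ⟨g, hz⟩‖ ≤ √c * ‖(f : X)‖ := by
    refine le_of_sq_le_sq ?_ (by positivity)
    rw [mul_pow, Real.sq_sqrt hc0, CStarModule.norm_sq_eq B, hadj]
    have hzn : ‖z‖ ≤ (1 + ‖K‖ * ‖G‖) * ‖(f : X)‖ := by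
      rw [eq_sub_of_add_eq' hKz]
      calc ‖(f : X) - K g‖ ≤ ‖(f : X)‖ + ‖K g‖ := norm_sub_le _ _
        _ ≤ ‖(f : X)‖ + ‖K‖ * (‖G‖ * ‖(f : X)‖) := by
            gcongr; exact (K.le_opNorm g).trans (by gcongr)
        _ = _ := by ring
    calc ‖(inner B g z : B)‖ ≤ ‖g‖ * ‖z‖ := CStarModule.norm_inner_le X
      _ ≤ (‖G‖ * ‖(f : X)‖) * ((1 + ‖K‖ * ‖G‖) * ‖(f : X)‖) := by gcongr
      _ = _ := by rw [hc]; ring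
  -- Pairing `f = Kg + D*Dg` with `f` moves `K` and `D*` onto `f`. The factors `g` and `Dg` are
  -- bounded by `‖f‖`, so one power of `‖f‖` cancels.
  have hff : (inner B (f : X) (f : X) : B) = inner B (K f) g + inner B (D f) (D ⟨g, hz⟩) := by
    conv_lhs => rw [← hKz, CStarModule.inner_add_right, hKz]
    rw [hK, hadj f]
  have h1 : ‖(f : X)‖ ^ 2 ≤ ‖(f : X)‖ * ((‖G‖ + √c) * (‖K f‖ + ‖D f‖)) := by
    calc ‖(f : X)‖ ^ 2 = ‖(inner B (K f) g + inner B (D f) (D ⟨g, hz⟩) : B)‖ := by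
          rw [← hff, CStarModule.norm_sq_eq B]
      _ ≤ ‖K f‖ * ‖g‖ + ‖D f‖ * ‖D ⟨g, hz⟩‖ := (norm_add_le _ _).trans
          (add_le_add (CStarModule.norm_inner_le X) (CStarModule.norm_inner_le Y))
      _ ≤ ‖K f‖ * (‖G‖ * ‖(f : X)‖) + ‖D f‖ * (√c * ‖(f : X)‖) := by gcongr
      _ ≤ _ := by
          have := mul_nonneg (mul_nonneg (norm_nonneg (f : X)) (norm_nonneg (K f)))
            (Real.sqrt_nonneg c)
          have := mul_nonneg (mul_nonneg (norm_nonneg (f : X)) (norm_nonneg (D f)))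
            (norm_nonneg G)
          nlinarith
  rcases (norm_nonneg (f : X)).eq_or_lt with h0 | h0
  · rw [← h0]; positivity
  · nlinarith

theorem isCore_domain (D : X →ₗ.[B] Y) : IsCore D D.domain :=
  ⟨le_rfl, fun x => subset_closure ⟨x, x.2, rfl⟩⟩

theorem IsLeftBFredholm.exists_bound {D : X →ₗ.[B] Y} (h : UnboundedOp.IsLeftBFredholm D)
    {S : Set X} (hS : Dense S) :
    ∃ (t : Finset X) (C : ℝ), (t : Set X) ⊆ S ∧
      ∀ f : D.domain, ‖(f : X)‖ ≤ C * (∑ x ∈ t, ‖(inner B x (f : X) : B)‖ + ‖D f‖) := by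
  obtain ⟨t, C, ht, hC⟩ :=
    _root_.IsLeftBFredholm.exists_bound (ι := inclL D) h (inner_eq D) (norm_inclL_le D) hS
  exact ⟨t, C, ht, hC⟩

end UnboundedOp
end HilbertModule

/-! ### Translations of Sobolev functions and averaging operators -/

section Euclidean

variable {B : Type*} [CStarAlgebra B] [PartialOrder B] [StarOrderedRing B]
variable {W : Type*} [NormedAddCommGroup W] [NormedSpace ℂ W] [Module B W] [CStarModule B W]
variable {V : Type*} [NormedAddCommGroup V] [InnerProductSpace ℝ V] [FiniteDimensional ℝ V]
  [MeasurableSpace V] [BorelSpace V]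

theorem CStarModule.inner_smul_smul_real (c : ℝ) (w : W) :
    (inner B (c • w) (c • w) : B) = c ^ 2 • inner B w w := by
  rw [CStarModule.inner_smul_left_real, CStarModule.inner_smul_right_real, smul_smul, pow_two]

theorem CStarModule.inner_smul_smul_complex (c : ℂ) (w : W) :
    (inner B (c • w) (c • w) : B) = ‖c‖ ^ 2 • inner B w w := by
  rw [CStarModule.inner_smul_right_complex, CStarModule.inner_smul_left_complex, smul_smul,
    ← Complex.coe_smul]
  congr 1
  rw [Complex.star_def, Complex.mul_conj, Complex.normSq_eq_norm_sq]

theorem CStarModule.inner_sub_sub_self (v w : W) : (inner B (v - w) (v - w) : B)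
    = inner B v v - (inner B w v + star (inner B w v)) + inner B w w := by
  simp only [CStarModule.inner_sub_left, CStarModule.inner_sub_right, CStarModule.star_inner]
  abel

namespace SchwartzMap

theorem integrable_inner (f g : SchwartzMap V W) :
    Integrable (fun x => (inner B (f x) (g x) : B)) := by
  refine Integrable.mono' ((g.integrable (μ := volume)).norm.const_mul
    (SchwartzMap.seminorm ℝ 0 0 f))
    ?_ (Eventually.of_forall fun x => ?_)
  · exact (CStarModule.continuous_inner.comp
      (f.continuous.prodMk g.continuous)).aestronglyMeasurable
  · refine (CStarModule.norm_inner_le W).trans ?_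
    gcongr
    exact norm_le_seminorm ℝ f x

/-- The weight has temperate growth, so it can be absorbed into one of the two Schwartz factors. -/
theorem integrable_rpow_smul_inner (s : ℝ) (g : SchwartzMap V W) :
    Integrable (fun x => (1 + ‖x‖ ^ 2) ^ s • (inner B (g x) (g x) : B)) := by
  refine (integrable_inner g (smulLeftCLM W (fun x : V => (1 + ‖x‖ ^ 2) ^ s) g)).congr
    (Eventually.of_forall fun x => ?_)
  simp only
  rw [smulLeftCLM_apply_apply (Function.hasTemperateGrowth_one_add_norm_sq_rpow V s),
    CStarModule.inner_smul_right_real]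

theorem fourier_compSubConst (f : SchwartzMap V W) (a ξ : V) :
    𝓕 (f.compSubConstCLM ℂ a) ξ = Real.fourierChar (-inner ℝ a ξ) • 𝓕 f ξ := by
  have h := congrFun (VectorFourier.fourierIntegral_comp_add_right Real.fourierChar volume
    (innerₗ V) f (-a)) ξ
  rw [fourier_coe, fourier_coe]
  have h2 : ((f.compSubConstCLM ℂ a : SchwartzMap V W) : V → W) = f ∘ fun v => v + -a := by
    ext v
    simp [sub_eq_add_neg]
  rw [h2]
  refine h.trans ?_
  simp only [innerₗ_apply_apply, inner_neg_left]
  rfl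

end SchwartzMap

/-- Interpolation between `|e^{it} - 1| ≤ |t|`, used for `|t| ≤ 1`, and `|e^{it} - 1| ≤ 2`, used
beyond. It converts `σ` derivatives into a power of the translation length. -/
theorem norm_fourierChar_sub_one_le {σ : ℝ} (hσ0 : 0 < σ) (hσ1 : σ ≤ 1) (θ : ℝ) :
    ‖((Real.fourierChar θ : Circle) : ℂ) - 1‖ ≤ 2 * |2 * Real.pi * θ| ^ σ := by
  set t : ℝ := 2 * Real.pi * θ with ht
  have h1 : ‖((Real.fourierChar θ : Circle) : ℂ) - 1‖ ≤ |t| := by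
    have := Real.norm_exp_I_mul_ofReal_sub_one_le (x := t)
    rw [Real.fourierChar_apply, ← ht, mul_comm]
    exact this
  have h2 : ‖((Real.fourierChar θ : Circle) : ℂ) - 1‖ ≤ 2 := by
    refine (norm_sub_le _ _).trans ?_
    simp only [Circle.norm_coe, norm_one]
    norm_num
  rcases le_total |t| 1 with h | h
  · have h3 : |t| ≤ |t| ^ σ := by
      rcases (abs_nonneg t).eq_or_lt with h0 | h0
      · rw [← h0]; positivity
      · conv_lhs => rw [← Real.rpow_one |t|]
        exact Real.rpow_le_rpow_of_exponent_ge h0 h hσ1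
    have := Real.rpow_nonneg (abs_nonneg t) σ
    linarith
  · have h3 : 1 ≤ |t| ^ σ := Real.one_le_rpow h hσ0.le
    linarith

/-- The `L²`-modulus of continuity of a function in `H^s`. -/
theorem SchwartzMap.integral_inner_sub_translate_le [CompleteSpace W] {s σ : ℝ} (hσ0 : 0 < σ)
    (hσ1 : σ ≤ 1) (hσs : σ ≤ s) (f : SchwartzMap V W) {r : ℝ} (a : V) (ha : ‖a‖ ≤ r) :
    ∫ x, (inner B (f x - f (x - a)) (f x - f (x - a)) : B)
      ≤ (4 * (2 * Real.pi * r) ^ (2 * σ)) •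
        ∫ ξ, (1 + ‖ξ‖ ^ 2) ^ s • (inner B (𝓕 f ξ) (𝓕 f ξ) : B) := by
  have hr : 0 ≤ r := (norm_nonneg a).trans ha
  set g : SchwartzMap V W := f - f.compSubConstCLM ℂ a with hg
  -- Plancherel for the `B`-valued inner product. It reduces the claim to a pointwise comparison of
  -- scalar weights in front of the positive elements `⟨f̂(ξ), f̂(ξ)⟩`, which is why the bound holds
  -- in the order of `B` and not merely in norm.
  have h1 : ∫ x, (inner B (f x - f (x - a)) (f x - f (x - a)) : B)
      = ∫ ξ, (inner B (𝓕 g ξ) (𝓕 g ξ) : B) :=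
    (SchwartzMap.integral_sesq_fourier_fourier g g (CStarModule.innerSL (A := B))).symm
  have h2 : ∀ ξ, 𝓕 g ξ = -(((Real.fourierChar (-inner ℝ a ξ) : Circle) : ℂ) - 1) • 𝓕 f ξ := by
    intro ξ
    have : 𝓕 g = 𝓕 f - 𝓕 (f.compSubConstCLM ℂ a) := by
      rw [hg]; exact map_sub (FourierTransform.fourierCLM ℂ (SchwartzMap V W)) _ _
    rw [this, sub_apply, SchwartzMap.fourier_compSubConst, Circle.smul_def, neg_sub,
      sub_smul, one_smul]
  rw [h1, ← integral_smul]
  refine integral_mono (SchwartzMap.integrable_inner _ _)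
    ((SchwartzMap.integrable_rpow_smul_inner s _).smul _) fun ξ => ?_
  simp only
  rw [h2, CStarModule.inner_smul_smul_complex, smul_smul, norm_neg]
  refine smul_le_smul_of_nonneg_right ?_ CStarModule.inner_self_nonneg
  have h3 := norm_fourierChar_sub_one_le hσ0 hσ1 (-inner ℝ a ξ)
  have h4 : |2 * Real.pi * -inner ℝ a ξ| ≤ (2 * Real.pi * r) * ‖ξ‖ := by
    rw [abs_mul, abs_neg, abs_of_pos (by positivity), mul_assoc (2 * Real.pi)]
    gcongr
    exact (abs_real_inner_le_norm a ξ).trans (by gcongr)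
  have h5 : ‖((Real.fourierChar (-inner ℝ a ξ) : Circle) : ℂ) - 1‖
      ≤ 2 * ((2 * Real.pi * r) * ‖ξ‖) ^ σ := h3.trans (by gcongr)
  calc ‖((Real.fourierChar (-inner ℝ a ξ) : Circle) : ℂ) - 1‖ ^ 2
      ≤ (2 * ((2 * Real.pi * r) * ‖ξ‖) ^ σ) ^ 2 := by gcongr
    _ = 4 * (2 * Real.pi * r) ^ (2 * σ) * (‖ξ‖ ^ 2) ^ σ := by
      have e1 : (2 * Real.pi * r) ^ (2 * σ) = ((2 * Real.pi * r) ^ σ) ^ 2 := by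
        rw [mul_comm 2 σ, Real.rpow_mul (by positivity), Real.rpow_two]
      have e2 : (‖ξ‖ ^ 2) ^ σ = (‖ξ‖ ^ σ) ^ 2 := by
        rw [← Real.rpow_two, ← Real.rpow_mul (norm_nonneg ξ), mul_comm,
          Real.rpow_mul (norm_nonneg ξ), Real.rpow_two]
      rw [Real.mul_rpow (by positivity) (norm_nonneg ξ), e1, e2]
      ring
    _ ≤ 4 * (2 * Real.pi * r) ^ (2 * σ) * (1 + ‖ξ‖ ^ 2) ^ s := by
      gcongr
      calc (‖ξ‖ ^ 2) ^ σ ≤ (1 + ‖ξ‖ ^ 2) ^ σ := by gcongr; linarith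
        _ ≤ (1 + ‖ξ‖ ^ 2) ^ s :=
          Real.rpow_le_rpow_of_exponent_le (by nlinarith [sq_nonneg ‖ξ‖]) hσs

/-- Jensen's inequality for the inner product of a Hilbert module. -/
theorem CStarModule.inner_integral_le [CompleteSpace W] {ψ : V → ℝ} (hψ : Continuous ψ)
    (hψc : HasCompactSupport ψ) (hψ0 : ∀ y, 0 ≤ ψ y) (hψ1 : ∫ y, ψ y = 1) {f : V → W}
    (hf : Continuous f) :
    (inner B (∫ y, ψ y • f y) (∫ y, ψ y • f y) : B) ≤ ∫ y, ψ y • (inner B (f y) (f y) : B) := by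
  set m := ∫ y, ψ y • f y with hm
  have hint : ∀ {g : V → B},
      Continuous g → Integrable fun y => ψ y • g y := fun hg =>
    (hψ.smul hg).integrable_of_hasCompactSupport hψc.smul_right
  have hfi : Integrable fun y => ψ y • f y :=
    (hψ.smul hf).integrable_of_hasCompactSupport hψc.smul_right
  have hff : Continuous fun y => (inner B (f y) (f y) : B) :=
    CStarModule.continuous_inner.comp (hf.prodMk hf)
  have hmf : Continuous fun y => (inner B m (f y) : B) :=
    CStarModule.continuous_inner.comp (continuous_const.prodMk hf)
  have h1 : ∫ y, ψ y • (inner B m (f y) : B) = inner B m m := by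
    have := (CStarModule.innerSL (A := B) m).integral_comp_comm hfi
    rw [← hm] at this
    refine Eq.trans (integral_congr_ae (Eventually.of_forall fun y => ?_)) this
    exact (CStarModule.inner_smul_right_real (A := B) (x := m) (y := f y) (z := ψ y)).symm
  have h2 : ∫ y, ψ y • star (inner B m (f y) : B) = inner B m m := by
    have := (starL' ℝ : B ≃L[ℝ] B).integral_comp_comm (μ := volume)
      (fun y => ψ y • (inner B m (f y) : B))
    rw [h1] at this
    refine Eq.trans (integral_congr_ae (Eventually.of_forall fun y => ?_))
      (this.trans (CStarModule.star_inner m m))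
    change _ = star (ψ y • (inner B m (f y) : B))
    rw [star_smul, star_trivial]
  -- The variance identity: the mean of `⟨f - m, f - m⟩` is the mean of `⟨f, f⟩` minus `⟨m, m⟩`. The
  -- cross term `⟨m, f⟩` and its adjoint are integrated separately, and each contributes `⟨m, m⟩`.
  have h3 : ∫ y, ψ y • (inner B (f y - m) (f y - m) : B)
      = (∫ y, ψ y • (inner B (f y) (f y) : B)) - inner B m m := by
    have : ∀ y, ψ y • (inner B (f y - m) (f y - m) : B) = ψ y • (inner B (f y) (f y) : B)
        - (ψ y • (inner B m (f y) : B) + ψ y • star (inner B m (f y) : B))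
        + ψ y • inner B m m := fun y => by
      rw [CStarModule.inner_sub_sub_self, smul_add, smul_sub, smul_add]
    simp only [this]
    have i1 := hint hff
    have i2 := hint hmf
    have i3 : Integrable fun y => ψ y • star (inner B m (f y) : B) := hint hmf.star
    have i23 : Integrable fun y => ψ y • (inner B m (f y) : B) + ψ y • star (inner B m (f y) : B) :=
      i2.add i3
    have i4 : Integrable fun y => ψ y • (inner B m m : B) := hint continuous_const
    rw [integral_add (f := fun y => ψ y • (inner B (f y) (f y) : B)
      - (ψ y • (inner B m (f y) : B) + ψ y • star (inner B m (f y) : B))) (i1.sub i23) i4,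
      integral_sub i1 i23, integral_add i2 i3, h1, h2, integral_smul_const, hψ1, one_smul]
    abel
  have h4 : 0 ≤ ∫ y, ψ y • (inner B (f y - m) (f y - m) : B) :=
    integral_nonneg fun y => smul_nonneg (hψ0 y) CStarModule.inner_self_nonneg
  rw [h3] at h4
  exact sub_nonneg.1 h4

/-- Jensen's inequality for finite convex combinations in a Hilbert module. -/
theorem CStarModule.inner_sum_smul_le {ι : Type*} [Fintype ι] {c : ι → ℝ} (hc : ∀ i, 0 ≤ c i)
    (hc1 : ∑ i, c i = 1) (w : ι → W) :
    (inner B (∑ i, c i • w i) (∑ i, c i • w i) : B) ≤ ∑ i, c i • (inner B (w i) (w i) : B) := by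
  set m := ∑ i, c i • w i with hm
  have h1 : ∑ i, c i • (inner B m (w i) : B) = inner B m m := by
    conv_rhs => rw [hm, CStarModule.inner_sum_right, ← hm]
    simp only [CStarModule.inner_smul_right_real]
  have h2 : ∑ i, c i • star (inner B m (w i) : B) = inner B m m := by
    rw [← CStarModule.star_inner m m, ← h1, star_sum]
    simp only [star_smul, star_trivial]
  have h3 : ∑ i, c i • (inner B (w i - m) (w i - m) : B)
      = ∑ i, c i • (inner B (w i) (w i) : B) - inner B m m := by
    simp only [CStarModule.inner_sub_sub_self, smul_add, smul_sub, Finset.sum_add_distrib,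
      Finset.sum_sub_distrib, h1, h2, ← Finset.sum_smul, hc1, one_smul]
    abel
  have h4 : 0 ≤ ∑ i, c i • (inner B (w i - m) (w i - m) : B) :=
    Finset.sum_nonneg fun i _ => smul_nonneg (hc i) CStarModule.inner_self_nonneg
  rw [h3] at h4
  exact sub_nonneg.1 h4

/-- Approximation of `H^s`-functions by local averages. -/
theorem SchwartzMap.integral_inner_sub_average_le [CompleteSpace W] {s σ : ℝ} (hσ0 : 0 < σ)
    (hσ1 : σ ≤ 1) (hσs : σ ≤ s) {K : Set V} (hK : IsCompact K) {ι : Type*} [Fintype ι]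
    {φ ψ : ι → V → ℝ} (hφ : ∀ i, Continuous (φ i)) (hφ0 : ∀ i x, 0 ≤ φ i x)
    (hφ1 : ∀ x ∈ K, ∑ i, φ i x = 1) (hψ : ∀ i, Continuous (ψ i))
    (hψc : ∀ i, HasCompactSupport (ψ i)) (hψ0 : ∀ i y, 0 ≤ ψ i y) (hψ1 : ∀ i, ∫ y, ψ i y = 1)
    {κ r : ℝ} (hκ0 : 0 ≤ κ) (hκ : ∀ i y, ψ i y ≤ κ)
    (hφψ : ∀ i x y, φ i x ≠ 0 → ψ i y ≠ 0 → ‖x - y‖ ≤ r) (f : SchwartzMap V W) :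
    ∫ x in K, (inner B (f x - ∑ i, φ i x • ∫ y, ψ i y • f y)
        (f x - ∑ i, φ i x • ∫ y, ψ i y • f y) : B)
      ≤ (κ * volume.real (Metric.closedBall (0 : V) r) * (4 * (2 * Real.pi * r) ^ (2 * σ))) •
        ∫ ξ, (1 + ‖ξ‖ ^ 2) ^ s • (inner B (𝓕 f ξ) (𝓕 f ξ) : B) := by
  set Z := ∫ ξ, (1 + ‖ξ‖ ^ 2) ^ s • (inner B (𝓕 f ξ) (𝓕 f ξ) : B) with hZ
  set N : V → V → B := fun x a => inner B (f x - f (x - a)) (f x - f (x - a)) with hN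
  have hNc : Continuous (Function.uncurry N) := by
    have h1 : Continuous fun p : V × V => f p.1 - f (p.1 - p.2) :=
      (f.continuous.comp continuous_fst).sub
        (f.continuous.comp (continuous_fst.sub continuous_snd))
    exact CStarModule.continuous_inner.comp (h1.prodMk h1)
  have hN0 : ∀ x a, 0 ≤ N x a := fun x a => CStarModule.inner_self_nonneg
  set b := Metric.closedBall (0 : V) r with hb
  have hbc : IsCompact b := isCompact_closedBall _ _
  -- At `x` the error is a convex combination of weighted means of `f x - f y` over `‖x - y‖ ≤ r`.
  -- Jensen's inequality, once for the sum over `i` and once for each integral, moves the inner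
  -- product inside, and then `ψᵢ ≤ κ` is inserted.
  have hpt : ∀ x ∈ K, (inner B (f x - ∑ i, φ i x • ∫ y, ψ i y • f y)
      (f x - ∑ i, φ i x • ∫ y, ψ i y • f y) : B) ≤ κ • ∫ a in b, N x a := by
    intro x hx
    have h1 : f x - ∑ i, φ i x • ∫ y, ψ i y • f y
        = ∑ i, φ i x • ∫ y, ψ i y • (f x - f y) := by
      have : ∀ i, ∫ y, ψ i y • (f x - f y) = f x - ∫ y, ψ i y • f y := fun i => by
        simp only [smul_sub (ψ i _)]
        rw [integral_sub, integral_smul_const, hψ1, one_smul]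
        · exact ((hψ i).smul continuous_const).integrable_of_hasCompactSupport
            (hψc i).smul_right
        · exact ((hψ i).smul f.continuous).integrable_of_hasCompactSupport
            (hψc i).smul_right
      simp only [this]
      simp only [smul_sub, Finset.sum_sub_distrib, ← Finset.sum_smul, hφ1 x hx, one_smul]
    rw [h1]
    refine (CStarModule.inner_sum_smul_le (fun i => hφ0 i x) (hφ1 x hx) _).trans ?_
    rw [← one_smul ℝ (κ • ∫ a in b, N x a), ← hφ1 x hx, Finset.sum_smul]
    refine Finset.sum_le_sum fun i _ => ?_
    rcases eq_or_ne (φ i x) 0 with h0 | h0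
    · rw [h0, zero_smul, zero_smul]
    refine smul_le_smul_of_nonneg_left ?_ (hφ0 i x)
    refine (CStarModule.inner_integral_le (hψ i) (hψc i) (hψ0 i) (hψ1 i)
      (continuous_const.sub f.continuous)).trans ?_
    -- Substitute `y = x - a`; since `φᵢ x ≠ 0`, the kernel vanishes unless `a` lies in the ball of
    -- radius `r`.
    rw [← integral_smul, ← integral_sub_left_eq_self _ volume x, ← integral_indicator
      hbc.measurableSet]
    have hc1 : Continuous fun a => N x a := hNc.comp (continuous_const.prodMk continuous_id)
    refine integral_mono ?_ ?_ fun a => ?_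
    · have : HasCompactSupport fun a => ψ i (x - a) :=
        (hψc i).comp_homeomorph (Homeomorph.subLeft x)
      exact (((hψ i).comp (continuous_const.sub continuous_id)).smul
        hc1).integrable_of_hasCompactSupport this.smul_right
    · exact ((hc1.const_smul κ).continuousOn.integrableOn_compact hbc).integrable_indicator
        hbc.measurableSet
    · change ψ i (x - a) • N x a ≤ b.indicator (fun a => κ • N x a) a
      by_cases ha : a ∈ b
      · rw [Set.indicator_of_mem ha]
        exact smul_le_smul_of_nonneg_right (hκ i _) (hN0 x a)
      · rw [Set.indicator_of_notMem ha]
        have : ψ i (x - a) = 0 := by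
          by_contra hne
          refine ha ?_
          have := hφψ i x (x - a) h0 hne
          rw [hb, mem_closedBall_zero_iff]
          simpa using this
        rw [this, zero_smul]
  have hprod : Integrable (Function.uncurry N) ((volume.restrict K).prod (volume.restrict b)) := by
    rw [Measure.prod_restrict]
    exact hNc.continuousOn.integrableOn_compact (hK.prod hbc)
  have hd : Continuous fun x => f x - ∑ i, φ i x • ∫ y, ψ i y • f y :=
    f.continuous.sub (continuous_finsetSum _ fun i _ => (hφ i).smul continuous_const)
  -- After exchanging the integrals, the inner one is the `L²`-modulus of continuity at the
  -- translation `a`, bounded uniformly in `‖a‖ ≤ r`.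
  calc ∫ x in K, (inner B (f x - ∑ i, φ i x • ∫ y, ψ i y • f y)
        (f x - ∑ i, φ i x • ∫ y, ψ i y • f y) : B)
      ≤ ∫ x in K, κ • ∫ a in b, N x a :=
        setIntegral_mono_on
          ((CStarModule.continuous_inner.comp (hd.prodMk hd)).continuousOn.integrableOn_compact hK)
          (hprod.integral_prod_left.smul κ) hK.measurableSet hpt
    _ = κ • ∫ a in b, ∫ x in K, N x a := by
        rw [integral_smul, integral_integral_swap hprod]
    _ ≤ κ • ∫ a in b, (4 * (2 * Real.pi * r) ^ (2 * σ)) • Z := by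
        refine smul_le_smul_of_nonneg_left ?_ hκ0
        refine setIntegral_mono_on hprod.integral_prod_right
          (integrableOn_const hbc.measure_lt_top.ne) hbc.measurableSet fun a ha => ?_
        refine le_trans ?_ (f.integral_inner_sub_translate_le (B := B) hσ0 hσ1 hσs a
          (mem_closedBall_zero_iff.1 ha))
        refine setIntegral_le_integral ?_ (Eventually.of_forall fun x => hN0 x a)
        exact SchwartzMap.integrable_inner (f - f.compSubConstCLM ℂ a)
          (f - f.compSubConstCLM ℂ a)
    _ = _ := by
        rw [setIntegral_const, smul_smul, smul_smul, mul_assoc]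

end Euclidean

/-! ### Test functions -/

section TestFunctions

variable {n : ℕ} {H : Type*} [TopologicalSpace H]
  {I : ModelWithCorners ℝ (EuclideanSpace ℝ (Fin n)) H}
  {M : Type*} [TopologicalSpace M] [ChartedSpace H M]

namespace TestFun

/-- The complex conjugate of a test function. -/
def conj (k : TestFun I M) : TestFun I M where
  toFun x := star (k x)
  contMDiff := ((starL' ℝ : ℂ ≃L[ℝ] ℂ) : ℂ →L[ℝ] ℂ).contMDiff.comp k.contMDiff
  hasCompactSupport := k.hasCompactSupport.comp_left (g := star) (star_zero ℂ)

/-- The product of two test functions. -/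
def times (k l : TestFun I M) : TestFun I M where
  toFun x := k x * l x
  contMDiff := ((ContinuousLinearMap.mul ℝ ℂ).contMDiff.comp k.contMDiff).clm_apply l.contMDiff
  hasCompactSupport := l.hasCompactSupport.mul_left

@[simp] theorem conj_apply (k : TestFun I M) (x : M) : k.conj x = star (k x) := rfl

@[simp] theorem times_apply (k l : TestFun I M) (x : M) : k.times l x = k x * l x := rfl

theorem times_nonneg (k : TestFun I M) (x : M) : 0 ≤ k.conj.times k x := star_mul_self_nonneg (k x)

theorem exists_norm_le (k : TestFun I M) : ∃ C : ℝ, 0 ≤ C ∧ ∀ x, ‖k x‖ ≤ C := by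
  obtain ⟨C, hC⟩ := k.contMDiff.continuous.bounded_above_of_compact_support k.hasCompactSupport
  exact ⟨max C 0, le_max_right _ _, fun x => (hC x).trans (le_max_left _ _)⟩

variable (I) in
/-- A test function made from a real smooth function. -/
def ofReal (f : M → ℝ) (hf : ContMDiff I 𝓘(ℝ, ℝ) ∞ f) (hfc : HasCompactSupport f) :
    TestFun I M where
  toFun x := (f x : ℂ)
  contMDiff := Complex.ofRealCLM.contMDiff.comp hf
  hasCompactSupport := hfc.comp_left (g := ((↑) : ℝ → ℂ)) Complex.ofReal_zero

variable (I) in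
/-- Cutoff functions. -/
theorem exists_cutoff [IsManifold I ∞ M] [T2Space M] [SecondCountableTopology M] {K U : Set M}
    (hK : IsCompact K) (hU : IsOpen U) (hKU : K ⊆ U) :
    ∃ χ : TestFun I M, tsupport χ ⊆ U ∧ ∀ᶠ x in 𝓝ˢ K, χ x = 1 := by
  have : LocallyCompactSpace M := Manifold.locallyCompact_of_finiteDimensional I
  obtain ⟨L, hL, hKL, hLU⟩ := exists_compact_between hK hU hKU
  obtain ⟨f, hf1, hf0, -⟩ := exists_contMDiffMap_one_nhds_of_subset_interior (n := ⊤) I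
    hK.isClosed hKL
  have hfL : tsupport f ⊆ L := closure_minimal
    (fun x hx => by_contra fun h => hx (hf0 x h)) hL.isClosed
  refine ⟨ofReal I f f.contMDiff (hL.of_isClosed_subset (isClosed_tsupport f) hfL), ?_, ?_⟩
  · refine (closure_mono fun x hx => ?_).trans (hfL.trans hLU)
    intro h
    exact hx ((congrArg _ h).trans Complex.ofReal_zero)
  · filter_upwards [hf1] with x hx
    exact (congrArg _ hx).trans Complex.ofReal_one

end TestFun

end TestFunctions

section Bundles

variable {n : ℕ} {H : Type*} [TopologicalSpace H]
  {I : ModelWithCorners ℝ (EuclideanSpace ℝ (Fin n)) H}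
  {M : Type*} [TopologicalSpace M] [ChartedSpace H M]
  {B : Type*} [CStarAlgebra B] [PartialOrder B] [StarOrderedRing B]
  {W : Type*} [NormedAddCommGroup W] [NormedSpace ℂ W] [Module B W] [CStarModule B W]
  {E : M → Type*} [TopologicalSpace (TotalSpace W E)]
  [∀ x, NormedAddCommGroup (E x)] [∀ x, NormedSpace ℂ (E x)] [∀ x, Module B (E x)]
  [∀ x, CStarModule B (E x)] [FiberBundle W E] [VectorBundle ℝ W E]
  [IsManifold I ∞ M] [ContMDiffVectorBundle ∞ W E I] [IsHermitianBBundle I B W E]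
  [MeasurableSpace M] {μ : Measure M}

/-! ### Multiplication operators -/

section Mul

variable [T2Space M] [BorelSpace M] [IsFiniteMeasureOnCompacts μ] [μ.IsOpenPosMeasure]

theorem TestSec.inner_mul_left (k : TestFun I M) (s t : TestSec I B W E μ) :
    (inner B (TestSec.mul k s) t : B) = inner B s (TestSec.mul k.conj t) := by
  rw [TestSec.inner_def, TestSec.inner_def]
  refine integral_congr_ae (Eventually.of_forall fun x => ?_)
  simp only [TestSec.mul_apply, TestFun.conj_apply, CStarModule.inner_smul_left_complex,
    CStarModule.inner_smul_right_complex]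

theorem L2Sec.mul_coe (k : TestFun I M) (s : TestSec I B W E μ) :
    L2Sec.mul k (s : L2Sec I B W E μ) = (TestSec.mul k s : TestSec I B W E μ) :=
  ContinuousLinearMap.completion_apply_coe (TestSec.mulL k) s

theorem L2Sec.continuous_inner {α : Type*} [TopologicalSpace α] {f g : α → L2Sec I B W E μ}
    (hf : Continuous f) (hg : Continuous g) : Continuous fun a => (inner B (f a) (g a) : B) :=
  CStarModule.completion_continuous_inner.comp (hf.prodMk hg)

theorem L2Sec.inner_mul_left (k : TestFun I M) (f g : L2Sec I B W E μ) :
    (inner B (L2Sec.mul k f) g : B) = inner B f (L2Sec.mul k.conj g) := by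
  refine UniformSpace.Completion.induction_on₂ f g (isClosed_eq
    (L2Sec.continuous_inner ((L2Sec.mul k).continuous.comp continuous_fst) continuous_snd)
    (L2Sec.continuous_inner continuous_fst ((L2Sec.mul k.conj).continuous.comp continuous_snd)))
    fun s t => ?_
  rw [L2Sec.mul_coe, L2Sec.mul_coe, CStarModule.completion_inner_coe,
    CStarModule.completion_inner_coe, TestSec.inner_mul_left]

theorem L2Sec.mul_eq_comp {k l m : TestFun I M} (h : ∀ x, m x = k x * l x) :
    (L2Sec.mul m : L2Sec I B W E μ →L[ℂ] L2Sec I B W E μ) = (L2Sec.mul k).comp (L2Sec.mul l) := by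
  ext f
  refine UniformSpace.Completion.induction_on f (isClosed_eq (L2Sec.mul m).continuous
    ((L2Sec.mul k).comp (L2Sec.mul l)).continuous) fun s => ?_
  rw [ContinuousLinearMap.comp_apply, L2Sec.mul_coe, L2Sec.mul_coe, L2Sec.mul_coe]
  congr 1
  ext x
  simp only [TestSec.mul_apply, h, mul_smul]

theorem L2Sec.isAdjointable_mul (k : TestFun I M) :
    IsAdjointable B (L2Sec.mul k : L2Sec I B W E μ →L[ℂ] L2Sec I B W E μ) :=
  ⟨L2Sec.mul k.conj, L2Sec.inner_mul_left k⟩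

theorem TestSec.sum_apply {ι : Type*} (t : Finset ι) (s : ι → TestSec I B W E μ) (x : M) :
    (∑ i ∈ t, s i) x = ∑ i ∈ t, s i x := by
  classical
  refine Finset.induction_on t rfl fun i u hi ih => ?_
  rw [Finset.sum_insert hi, Finset.sum_insert hi, TestSec.add_apply, ih]

theorem L2Sec.mul_sum {ι : Type*} (t : Finset ι) (k : ι → TestFun I M) (m : TestFun I M)
    (h : ∀ x, m x = ∑ i ∈ t, k i x) :
    (L2Sec.mul m : L2Sec I B W E μ →L[ℂ] L2Sec I B W E μ) = ∑ i ∈ t, L2Sec.mul (k i) := by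
  ext f
  refine UniformSpace.Completion.induction_on f (isClosed_eq (L2Sec.mul m).continuous
    (∑ i ∈ t, L2Sec.mul (k i) : L2Sec I B W E μ →L[ℂ] L2Sec I B W E μ).continuous) fun s => ?_
  rw [sum_apply]
  simp only [L2Sec.mul_coe]
  have : TestSec.mul m s = ∑ i ∈ t, TestSec.mul (k i) s := by
    ext x
    rw [TestSec.sum_apply]
    simp only [TestSec.mul_apply, h, Finset.sum_smul]
  rw [this]
  exact map_sum UniformSpace.Completion.toCompl _ _

end Mul

/-! ### Sections in a trivialisation -/

section Trivialization

variable (t : Trivialization W (π W E)) [MemTrivializationAtlas t]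

/-- Over the base set this is the inverse of a `B`-linear map; elsewhere `symmL` is zero. -/
theorem Bundle.Trivialization.symmL_base_smul (hE : IsHermitianBBundle I B W E) (x : M)
    (b : B) (a : W) :
    t.symmL ℝ x (b • a) = b • t.symmL ℝ x a := by
  by_cases hx : x ∈ t.baseSet
  · have hinj := (t.continuousLinearEquivAt ℝ x hx).injective
    apply hinj
    simp only [Trivialization.continuousLinearEquivAt_apply]
    have h := fun c : W => t.continuousLinearMapAt_symmL (R := ℝ) hx c
    simp only [Trivialization.continuousLinearMapAt_apply,
      Trivialization.linearMapAt_apply, if_pos hx] at h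
    rw [h, hE.trivialization_smul t x hx b, h]
  · rw [t.symmL_apply_of_notMem hx, t.symmL_apply_of_notMem hx, smul_zero]

/-- The trivialisation is bundled as real linear; complex scalars `z` act through `z • 1` in `B`. -/
theorem Bundle.Trivialization.symmL_complex_smul (hE : IsHermitianBBundle I B W E) (x : M)
    (z : ℂ) (a : W) :
    t.symmL ℝ x (z • a) = z • t.symmL ℝ x a := by
  have h1 : z • a = (z • (1 : B)) • a := by rw [smul_assoc, one_smul]
  rw [h1, t.symmL_base_smul hE, smul_assoc, one_smul]

theorem Bundle.Trivialization.apply_symmL {x : M} (hx : x ∈ t.baseSet) (a : W) :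
    (t ⟨x, t.symmL ℝ x a⟩).2 = a := by
  rw [t.symmL_apply hx, t.apply_mk_symm hx]

theorem Bundle.Trivialization.symmL_apply_snd {x : M} (hx : x ∈ t.baseSet) (v : E x) :
    t.symmL ℝ x (t ⟨x, v⟩).2 = v := by
  rw [t.symmL_apply hx]
  exact t.symm_apply_apply_mk hx v

variable [T2Space M]

/-- A compactly supported function that is smooth in a trivialisation defines a smooth section. -/
theorem Bundle.Trivialization.contMDiff_symmL {K : Set M} (hK : IsCompact K)
    (hKt : K ⊆ t.baseSet) {g : M → W} (hg : ∀ x ∈ K, ContMDiffAt I 𝓘(ℝ, W) ∞ g x)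
    (hg0 : ∀ x ∉ K, g x = 0) :
    ContMDiff I (I.prod 𝓘(ℝ, W)) ∞ (fun x => TotalSpace.mk' W x (t.symmL ℝ x (g x))) := by
  intro x
  by_cases hx : x ∈ K
  · rw [t.contMDiffAt_section_iff (hKt hx)]
    refine (hg x hx).congr_of_eventuallyEq ?_
    filter_upwards [t.open_baseSet.mem_nhds (hKt hx)] with y hy
    exact t.apply_symmL hy (g y)
  · refine (contMDiff_zeroSection ℝ E x).congr_of_eventuallyEq ?_
    filter_upwards [hK.isClosed.isOpen_compl.mem_nhds hx] with y hy
    rw [hg0 y hy, map_zero]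
    rfl

variable (μ) in
theorem TestSec.exists_of_trivialization (hE : IsHermitianBBundle I B W E) {K : Set M}
    (hK : IsCompact K) (hKt : K ⊆ t.baseSet) {g : M → W}
    (hg : ∀ x ∈ K, ContMDiffAt I 𝓘(ℝ, W) ∞ g x) (hg0 : ∀ x ∉ K, g x = 0) :
    ∃ σ : TestSec I B W E μ, ∀ x, σ x = t.symmL ℝ x (g x) :=
  ⟨⟨fun x => t.symmL ℝ x (g x), t.contMDiff_symmL hK hKt hg hg0, K, hK, fun x hx =>
    (congrArg (t.symmL ℝ x) (hg0 x hx)).trans (map_zero _)⟩, fun _ => rfl⟩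

/-- Cut off constant sections. -/
theorem Bundle.Trivialization.contMDiff_symmL_smul_const {χ : TestFun I M}
    (hχ : tsupport χ ⊆ t.baseSet) (w : W) :
    ContMDiff I (I.prod 𝓘(ℝ, W)) ∞ (fun x => TotalSpace.mk' W x (t.symmL ℝ x (χ x • w))) :=
  t.contMDiff_symmL χ.hasCompactSupport hχ
    (fun x _ => ((ContinuousLinearMap.lsmul ℝ ℂ : ℂ →L[ℝ] W →L[ℝ] W).contMDiff.contMDiffAt.comp x
      (χ.contMDiff x)).clm_apply contMDiffAt_const)
    (fun x hx => by rw [image_eq_zero_of_notMem_tsupport hx, zero_smul])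

/-- Fibres inherit completeness from `W`, so the frame theorem applies in each of them. -/
theorem Bundle.Trivialization.completeSpace_fiber [CompleteSpace W] {x : M} (hx : x ∈ t.baseSet) :
    CompleteSpace (E x) :=
  (completeSpace_congr (e := (t.continuousLinearEquivAt ℝ x hx).toEquiv)
    (t.continuousLinearEquivAt ℝ x hx).isUniformEmbedding).2 inferInstance

variable [CompleteSpace W]

/-- In a trivialisation, the constant frames have smooth dual frames for the Hermitian metric. -/
theorem IsHermitianBBundle.exists_dual_frame (hE : IsHermitianBBundle I B W E)
    {χ : TestFun I M} (hχ : tsupport χ ⊆ t.baseSet)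
    {ι : Type*} [Fintype ι] (w : ι → W) (hw : Submodule.span B (Set.range w) = ⊤) :
    ∃ ν : ι → M → W, (∀ i x, χ x = 1 → ContMDiffAt I 𝓘(ℝ, W) ∞ (ν i) x) ∧
      ∀ x, χ x = 1 → ∀ a : W,
        ∑ i, (inner B (t.symmL ℝ x (ν i x)) (t.symmL ℝ x a) : B) • w i = a := by
  set v : ι → W := fun i => Ring.inverse (CStarModule.frameOp B w) (w i) with hv
  have hvw : ∀ a, ∑ j, (inner B (v j) a : B) • w j = a :=
    CStarModule.sum_inner_inverse_frameOp_smul w hw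
  let S : ι → (x : M) → E x := fun i x => t.symmL ℝ x (χ x • w i)
  -- The operator `a ↦ ⟨vⱼ, a⟩ b wᵢ` depends on `b` linearly and continuously. Hence `A x`, a sum of
  -- these over the Gram coefficients `b` of the constant sections, is smooth in `x` for the
  -- operator norm.
  let L : ι → ι → B →L[ℂ] W →L[ℂ] W := fun i j =>
    ((ContinuousLinearMap.compL ℂ W B W (CStarModule.smulVec (w i))).comp
      ((ContinuousLinearMap.compL ℂ W B B).flip (CStarModule.innerSL (A := B) (v j)))).comp
      (ContinuousLinearMap.mul ℂ B).flip
  have hL : ∀ i j b a, L i j b a = ((inner B (v j) a : B) * b) • w i := fun i j b a => rfl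
  set A : M → W →L[ℂ] W := fun x => ∑ i, ∑ j, L i j (inner B (S i x) (S j x)) with hA
  have hAs : ContMDiff I 𝓘(ℝ, W →L[ℂ] W) ∞ A := by
    refine contMDiff_finsetSum fun i _ => contMDiff_finsetSum fun j _ => ?_
    exact ((L i j).restrictScalars ℝ).contMDiff.comp
      (hE.contMDiff_inner (S i) (S j) (t.contMDiff_symmL_smul_const hχ _)
        (t.contMDiff_symmL_smul_const hχ _))
  have hAx : ∀ x, χ x = 1 → ∀ a, A x a
      = ∑ i, (inner B (t.symmL ℝ x (w i)) (t.symmL ℝ x a) : B) • w i := fun x hx a => by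
    simp only [hA, sum_apply, hL, ← Finset.sum_smul]
    refine Finset.sum_congr rfl fun i _ => ?_
    congr 1
    conv_rhs => rw [← hvw a, map_sum, CStarModule.inner_sum_right]
    refine Finset.sum_congr rfl fun j _ => ?_
    rw [t.symmL_base_smul hE, CStarModule.inner_op_smul_right]
    simp only [S, hx, one_smul]
  have hmem : ∀ x, χ x = 1 → x ∈ t.baseSet := fun x hx =>
    hχ (subset_tsupport _ (by rw [Function.mem_support, hx]; exact one_ne_zero))
  have hspan : ∀ x, χ x = 1 →
      Submodule.span B (Set.range fun i => t.symmL ℝ x (w i)) = ⊤ := fun x hx => by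
    refine eq_top_iff.2 fun z _ => ?_
    rw [Submodule.mem_span_range_iff_exists_fun]
    refine ⟨fun j => inner B (v j) (t ⟨x, z⟩).2, ?_⟩
    simp only [← t.symmL_base_smul hE, ← map_sum, hvw]
    exact t.symmL_apply_snd (hmem x hx) z
  -- Where `χ = 1`, `A x` is the frame operator of the fibre metric transported to `W`, so it is
  -- invertible.
  have hTA : ∀ x, χ x = 1 → ∀ a, t.symmL ℝ x (A x a)
      = CStarModule.frameOp B (fun i => t.symmL ℝ x (w i)) (t.symmL ℝ x a) := fun x hx a => by
    rw [hAx x hx, CStarModule.frameOp_apply, map_sum]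
    simp only [t.symmL_base_smul hE]
  have hunit : ∀ x, χ x = 1 → IsUnit (A x) := fun x hx => by
    have hxt := hmem x hx
    have := t.completeSpace_fiber hxt
    have hF := CStarModule.isUnit_frameOp (B := B) _ (hspan x hx)
    have hbij := ContinuousLinearMap.isUnit_iff_bijective.1 hF
    refine ContinuousLinearMap.isUnit_iff_bijective.2 ⟨fun a b hab => ?_, fun b => ?_⟩
    · have h1 := hbij.1 ((hTA x hx a).symm.trans ((congrArg _ hab).trans (hTA x hx b)))
      rw [← t.apply_symmL hxt a, h1, t.apply_symmL hxt]
    · obtain ⟨z, hz⟩ := hbij.2 (t.symmL ℝ x b)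
      refine ⟨(t ⟨x, z⟩).2, ?_⟩
      have h1 := hTA x hx (t ⟨x, z⟩).2
      rw [t.symmL_apply_snd hxt, hz] at h1
      rw [← t.apply_symmL hxt b, ← h1, t.apply_symmL hxt]
  -- The canonical dual frame, seen in `W`. It is smooth since inversion is smooth on the units of a
  -- Banach algebra.
  refine ⟨fun i x => Ring.inverse (A x) (w i), fun i x hx => ?_, fun x hx a => ?_⟩
  · obtain ⟨u, hu⟩ := hunit x hx
    have h1 : ContDiffAt ℝ ∞ (Ring.inverse : (W →L[ℂ] W) → (W →L[ℂ] W)) (A x) :=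
      hu ▸ contDiffAt_ringInverse ℝ u
    have h2 : ContMDiffAt I 𝓘(ℝ, W →L[ℂ] W) ∞ (fun y => Ring.inverse (A y)) x :=
      h1.contMDiffAt.comp x (hAs x)
    exact (((ContinuousLinearMap.apply ℂ W (w i)).restrictScalars ℝ).contMDiff.contMDiffAt).comp
      x h2
  · have hxt := hmem x hx
    have := t.completeSpace_fiber hxt
    have hF := CStarModule.isUnit_frameOp (B := B) _ (hspan x hx)
    have hinv : ∀ i, t.symmL ℝ x (Ring.inverse (A x) (w i))
        = Ring.inverse (CStarModule.frameOp B fun i => t.symmL ℝ x (w i)) (t.symmL ℝ x (w i)) := by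
      intro i
      rw [← CStarModule.inverse_apply_apply hF (t.symmL ℝ x (Ring.inverse (A x) (w i))),
        ← hTA x hx, CStarModule.apply_inverse_apply (hunit x hx)]
    have h := CStarModule.sum_inner_inverse_frameOp_smul (B := B) _ (hspan x hx) (t.symmL ℝ x a)
    simp only [← hinv, ← t.symmL_base_smul hE, ← map_sum] at h
    rw [← t.apply_symmL hxt (∑ i, _), h, t.apply_symmL hxt]

/-- On compact sets, the Hermitian metric is dominated by the metric of the typical fibre. -/
theorem IsHermitianBBundle.exists_inner_symmL_le [Module.Finite B W]
    (hE : IsHermitianBBundle I B W E) {χ : TestFun I M} (hχ : tsupport χ ⊆ t.baseSet) :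
    ∃ C : ℝ, 0 ≤ C ∧ ∀ x, χ x = 1 → ∀ a : W,
      (inner B (t.symmL ℝ x a) (t.symmL ℝ x a) : B) ≤ C • inner B a a := by
  obtain ⟨m, w, hw⟩ := Module.Finite.exists_fin (R := B) (M := W)
  set v : Fin m → W := fun i => Ring.inverse (CStarModule.frameOp B w) (w i) with hv
  have hvw : ∀ a, ∑ j, (inner B (v j) a : B) • w j = a :=
    CStarModule.sum_inner_inverse_frameOp_smul w hw
  let S : Fin m → (x : M) → E x := fun i x => t.symmL ℝ x (χ x • w i)
  have hbd : ∀ i, ∃ c : ℝ, ∀ x, ‖(inner B (S i x) (S i x) : B)‖ ≤ c := fun i => by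
    have hc : HasCompactSupport fun x => (inner B (S i x) (S i x) : B) :=
      HasCompactSupport.intro χ.hasCompactSupport fun x hx => by
        simp only [S]
        rw [image_eq_zero_of_notMem_tsupport hx, zero_smul, map_zero, CStarModule.inner_zero_left]
    exact (hE.contMDiff_inner (S i) (S i) (t.contMDiff_symmL_smul_const hχ _)
        (t.contMDiff_symmL_smul_const hχ _)).continuous.bounded_above_of_compact_support hc
  choose c hc using hbd
  rcases Nat.eq_zero_or_pos m with rfl | hm
  · refine ⟨0, le_rfl, fun x _ a => ?_⟩
    rw [← hvw a]
    simp
  have hm0 : (m : ℝ) ≠ 0 := by positivity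
  refine ⟨m * ∑ i, |c i| * ‖v i‖ ^ 2, by positivity, fun x hx a => ?_⟩
  -- The sum of `m` terms is written as an average of `m` times each term, so that Jensen's
  -- inequality applies.
  have hz : t.symmL ℝ x a
      = ∑ j : Fin m, (m : ℝ)⁻¹ • ((m : ℝ) • ((inner B (v j) a : B) • t.symmL ℝ x (w j))) := by
    conv_lhs => rw [← hvw a, map_sum]
    simp only [t.symmL_base_smul hE, smul_smul, inv_mul_cancel₀ hm0, one_smul]
  rw [hz]
  refine (CStarModule.inner_sum_smul_le (fun _ => by positivity) (by simp [hm0]) _).trans ?_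
  rw [mul_smul, Finset.sum_smul, Finset.smul_sum]
  refine Finset.sum_le_sum fun j _ => ?_
  rw [CStarModule.inner_smul_smul_real, smul_smul]
  have e1 : (m : ℝ)⁻¹ * (m : ℝ) ^ 2 = m := by field_simp
  rw [e1]
  refine smul_le_smul_of_nonneg_left ?_ (by positivity)
  have e2 : ‖(inner B (t.symmL ℝ x (w j)) (t.symmL ℝ x (w j)) : B)‖ ≤ |c j| := by
    have := hc j x
    simp only [S, hx, one_smul] at this
    exact this.trans (le_abs_self _)
  -- With `b = ⟨vⱼ, a⟩`: conjugation gives `b g b* ≤ ‖g‖ b b*` for the Gram entry `g`, and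
  -- Cauchy-Schwarz in `B` gives `b b* ≤ ‖vⱼ‖² ⟨a, a⟩`.
  rw [CStarModule.inner_op_smul_left, CStarModule.inner_op_smul_right, mul_smul]
  refine (CStarAlgebra.star_right_conjugate_le_norm_smul
    (CStarModule.isSelfAdjoint_inner_self)).trans ?_
  refine (smul_le_smul_of_nonneg_right e2 (mul_star_self_nonneg _)).trans ?_
  refine smul_le_smul_of_nonneg_left ?_ (abs_nonneg _)
  rw [CStarModule.star_inner]
  exact CStarModule.inner_mul_inner_swap_le

end Trivialization

end Bundles

/-! ### Averaging kernels in convex sets and integration in charts -/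

section Geometry

/-- Partitions of unity at small scale `δ`, with averaging kernels at the same scale that are
supported in a given convex set. -/
theorem exists_averaging_kernels {n : ℕ} {C K O : Set (EuclideanSpace ℝ (Fin n))}
    (hC : Convex ℝ C) (hCi : (interior C).Nonempty) (hK : IsCompact K) (hKC : K ⊆ C)
    (hO : IsOpen O) (hKO : K ⊆ O) :
    ∃ A R δ₀ : ℝ, 0 ≤ A ∧ 0 < R ∧ 0 < δ₀ ∧ ∀ δ, 0 < δ → δ ≤ δ₀ →
      ∃ (ι : Type) (_ : Fintype ι) (φ ψ : ι → EuclideanSpace ℝ (Fin n) → ℝ) (κ : ℝ),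
        (∀ i, ContDiff ℝ ∞ (φ i)) ∧ (∀ i x, 0 ≤ φ i x) ∧ (∀ x ∈ K, ∑ i, φ i x = 1) ∧
        (∀ i, ContDiff ℝ ∞ (ψ i)) ∧ (∀ i, HasCompactSupport (ψ i)) ∧ (∀ i y, 0 ≤ ψ i y) ∧
        (∀ i, ∫ y, ψ i y = 1) ∧ (∀ i, tsupport (ψ i) ⊆ C ∩ O) ∧ 0 ≤ κ ∧ (∀ i y, ψ i y ≤ κ) ∧
        (∀ i x y, φ i x ≠ 0 → ψ i y ≠ 0 → ‖x - y‖ ≤ R * δ) ∧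
        κ * volume.real (Metric.closedBall (0 : EuclideanSpace ℝ (Fin n)) (R * δ)) ≤ A := by
  obtain ⟨p, hp⟩ := hCi
  obtain ⟨r₀, hr₀, hpC⟩ := Metric.nhds_basis_closedBall.mem_iff.1 (mem_interior_iff_mem_nhds.1 hp)
  obtain ⟨δ₁, hδ₁, hKδ⟩ := hK.exists_cthickening_subset_open hO hKO
  obtain ⟨R₀', hR₀'⟩ := hK.isBounded.subset_closedBall p
  set R₀ : ℝ := max R₀' 0 with hR₀
  have hR₀0 : 0 ≤ R₀ := le_max_right _ _
  have hKR : ∀ x ∈ K, ‖p - x‖ ≤ R₀ := fun x hx => by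
    have := hR₀' hx
    rw [Metric.mem_closedBall, dist_comm, dist_eq_norm] at this
    exact this.trans (le_max_left _ _)
  set R : ℝ := 1 + R₀ + r₀ with hR
  have hR0 : 0 < R := by positivity
  refine ⟨(2 * R / r₀) ^ n, R, min 1 (δ₁ / R), by positivity, hR0, by positivity,
    fun δ hδ hδδ => ?_⟩
  have hδ1 : δ ≤ 1 := hδδ.trans (min_le_left _ _)
  have hδR : R * δ ≤ δ₁ := by
    have := hδδ.trans (min_le_right _ _)
    rw [le_div_iff₀ hR0] at this
    linarith
  obtain ⟨t, htK, htf, hKt⟩ := hK.finite_cover_balls hδ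
  have : Fintype t := htf.fintype
  obtain ⟨f, hf⟩ := SmoothPartitionOfUnity.exists_isSubordinate
    (𝓘(ℝ, EuclideanSpace ℝ (Fin n))) hK.isClosed (fun x : t => Metric.ball (x : _) δ)
    (fun x => Metric.isOpen_ball) (by simpa [Set.iUnion_subtype] using hKt)
  -- Near the boundary of `C` a kernel centred at `x` would leave `C`. The contraction towards `x`
  -- with ratio `δ` maps the ball of radius `r₀` about the interior point `p`, which lies in `C`,
  -- onto the ball of radius `δ r₀` about `c x`; by convexity the image lies in `C`.
  let c : t → EuclideanSpace ℝ (Fin n) := fun x => (x : EuclideanSpace ℝ (Fin n)) + δ • (p - x)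
  let b : ∀ x : t, ContDiffBump (c x) := fun x =>
    ⟨δ * r₀ / 2, δ * r₀, by positivity, by linarith [mul_pos hδ hr₀]⟩
  have hcx : ∀ x : t, ‖c x - x‖ ≤ δ * R₀ := fun x => by
    simp only [c, add_sub_cancel_left, norm_smul, Real.norm_of_nonneg hδ.le]
    gcongr
    exact hKR x (htK x.2)
  have hts : ∀ x : t, tsupport ((b x).normed volume) = Metric.closedBall (c x) (δ * r₀) :=
    fun x => (b x).tsupport_normed_eq
  refine ⟨t, inferInstance, fun x => f x, fun x => (b x).normed volume,
    1 / volume.real (Metric.closedBall (0 : EuclideanSpace ℝ (Fin n)) (δ * r₀ / 2)),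
    fun x => (f x).contMDiff.contDiff, fun x y => f.nonneg x y, fun x hx => ?_,
    fun x => (b x).contDiff_normed, fun x => (b x).hasCompactSupport_normed,
    fun x y => (b x).nonneg_normed y, fun x => (b x).integral_normed, fun x => ?_, by positivity,
    fun x y => ?_, fun x y z hy hz => ?_, ?_⟩
  · rw [← f.sum_eq_one hx, finsum_eq_sum_of_fintype]
  · rw [hts]
    intro y hy
    rw [Metric.mem_closedBall, dist_eq_norm] at hy
    constructor
    · have hq : p + δ⁻¹ • (y - c x) ∈ C := hpC (by
        rw [mem_closedBall_iff_norm, add_sub_cancel_left, norm_smul, norm_inv,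
          Real.norm_of_nonneg hδ.le, inv_mul_le_iff₀ hδ]
        exact hy)
      -- The convex combination of `x` and a point of the ball about `p`; its weights use `δ ≤ 1`.
      have hy' : y = (1 - δ) • (x : EuclideanSpace ℝ (Fin n)) + δ • (p + δ⁻¹ • (y - c x)) := by
        rw [smul_add, smul_inv_smul₀ hδ.ne']
        simp only [c, smul_sub, sub_smul, one_smul]
        abel
      rw [hy']
      exact hC (hKC (htK x.2)) hq (by linarith) hδ.le (by ring)
    · refine hKδ (Metric.mem_cthickening_of_dist_le y x _ _ (htK x.2) ?_)
      rw [dist_eq_norm]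
      calc ‖y - x‖ = ‖(y - c x) + (c x - x)‖ := by rw [sub_add_sub_cancel]
        _ ≤ δ * r₀ + δ * R₀ := (norm_add_le _ _).trans (add_le_add hy (hcx x))
        _ ≤ R * δ := by rw [hR]; nlinarith
        _ ≤ δ₁ := hδR
  · have h := (b x).normed_le_div_measure_closedBall_rIn volume y
    rwa [Measure.real, Measure.addHaar_closedBall_center] at h
  · have h1 : y ∈ Metric.ball (x : EuclideanSpace ℝ (Fin n)) δ := hf x (subset_tsupport _ hy)
    have h2 : z ∈ Metric.closedBall (c x) (δ * r₀) := hts x ▸ subset_tsupport _ hz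
    rw [mem_ball_iff_norm] at h1
    rw [mem_closedBall_iff_norm, ← norm_neg, neg_sub] at h2
    have h3 := hcx x
    rw [← norm_neg, neg_sub] at h3
    calc ‖y - z‖ = ‖(y - x) + ((x - c x) + (c x - z))‖ := by congr 1; abel
      _ ≤ ‖y - x‖ + (‖(x - c x : EuclideanSpace ℝ (Fin n))‖ + ‖c x - z‖) :=
        (norm_add_le _ _).trans (by gcongr; exact norm_add_le _ _)
      _ ≤ δ + (δ * R₀ + δ * r₀) := by gcongr
      _ = R * δ := by rw [hR]; ring
  · rw [Measure.real, Measure.real, Measure.addHaar_closedBall _ _ (by positivity),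
      Measure.addHaar_closedBall _ _ (by positivity), ENNReal.toReal_mul, ENNReal.toReal_mul,
      ENNReal.toReal_ofReal (by positivity), ENNReal.toReal_ofReal (by positivity),
      finrank_euclideanSpace_fin]
    set v := (volume (Metric.ball (0 : EuclideanSpace ℝ (Fin n)) 1)).toReal with hv
    have hv0 : 0 < v := ENNReal.toReal_pos (Metric.measure_ball_pos _ _ one_pos).ne'
      measure_ball_lt_top.ne
    refine le_of_eq ?_
    -- The kernels are bounded by the inverse volume of a ball of radius `δ r₀ / 2`. The ratio of
    -- volumes is scale invariant, so `A` does not depend on `δ`.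
    have e1 : (R * δ) ^ n = (2 * R / r₀) ^ n * (δ * r₀ / 2) ^ n := by
      rw [← mul_pow]; congr 1; field_simp
    rw [e1]
    field_simp

variable {n : ℕ} {H : Type*} [TopologicalSpace H]
  {I : ModelWithCorners ℝ (EuclideanSpace ℝ (Fin n)) H}
  {M : Type*} [TopologicalSpace M] [ChartedSpace H M]

/-- With a boundary, the chart image of an open set is open only relative to the range of `I`. A
kernel supported in that range and in `O` has its support inside the chart image of `U`. -/
theorem OpenPartialHomeomorph.exists_isOpen_extend (e : OpenPartialHomeomorph M H) {U : Set M}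
    (hU : IsOpen U) (hUe : U ⊆ e.source) :
    ∃ O : Set (EuclideanSpace ℝ (Fin n)), IsOpen O ∧ (∀ x ∈ U, e.extend I x ∈ O) ∧
      ∀ y ∈ Set.range I ∩ O, y ∈ (e.extend I).target ∧ (e.extend I).symm y ∈ U := by
  refine ⟨I.symm ⁻¹' (e.target ∩ e.symm ⁻¹' U),
    (e.isOpen_inter_preimage_symm hU).preimage I.continuous_symm, fun x hx => ?_, ?_⟩
  · simp [e.map_source (hUe hx), e.left_inv (hUe hx), hx]
  · rintro y ⟨hy, hy1, hy2⟩
    rw [e.extend_target]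
    exact ⟨⟨hy1, hy⟩, hy2⟩

/-- Integration in a chart with respect to a smooth density. -/
theorem integral_eq_setIntegral_extend [MeasurableSpace M] [BorelSpace M] {μ : Measure M}
    {e : OpenPartialHomeomorph M H} {ρ : EuclideanSpace ℝ (Fin n) → ℝ}
    (hρc : ContinuousOn ρ (e.extend I).target) (hρ0 : ∀ y ∈ (e.extend I).target, 0 < ρ y)
    (hρ : ∀ A : Set M, MeasurableSet A → A ⊆ e.source →
      μ A = ∫⁻ y in e.extend I '' A, ENNReal.ofReal (ρ y))
    {G : Type*} [NormedAddCommGroup G] [NormedSpace ℝ G] {g : M → G} (hg : Continuous g)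
    (hg0 : ∀ x ∉ e.source, g x = 0) :
    ∫ x, g x ∂μ = ∫ y in (e.extend I).target, ρ y • g ((e.extend I).symm y) := by
  set φ := e.extend I with hφ
  have hsrc : MeasurableSet e.source := e.open_source.measurableSet
  have hφc : ContinuousOn φ e.source := by
    have := e.continuousOn_extend (I := I)
    rwa [e.extend_source] at this
  have htgt : MeasurableSet φ.target := by
    rw [hφ, e.extend_target]
    exact (e.open_target.preimage I.continuous_symm).measurableSet.inter
      I.isClosed_range.measurableSet
  have hφm : AEMeasurable φ (μ.restrict e.source) := hφc.aemeasurable hsrc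
  have hpre : ∀ A, MeasurableSet A → MeasurableSet (φ ⁻¹' A ∩ e.source) := fun A hA => by
    have h : MeasurableSet ((fun x : e.source => φ x) ⁻¹' A) :=
      (continuousOn_iff_continuous_domRestrict.1 hφc).measurable hA
    convert MeasurableSet.subtype_image hsrc h using 1
    ext x
    simp [and_comm]
  -- The density condition, restated: the push-forward of `μ` under the chart is Lebesgue measure on
  -- the target with density `ρ`.
  have hmap : (μ.restrict e.source).map φ
      = (volume.restrict φ.target).withDensity fun y => ENNReal.ofReal (ρ y) := by
    ext A hA
    have h0 : NullMeasurableSet (φ ⁻¹' A) (μ.restrict e.source) := hφm.nullMeasurable hA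
    rw [Measure.map_apply_of_aemeasurable hφm hA, withDensity_apply _ hA,
      Measure.restrict_apply₀ h0, hρ _ (hpre A hA) Set.inter_subset_right,
      Measure.restrict_restrict hA]
    congr 2
    ext y
    constructor
    · rintro ⟨x, ⟨hxA, hx⟩, rfl⟩
      exact ⟨hxA, φ.map_source (by rwa [hφ, e.extend_source])⟩
    · rintro ⟨hyA, hy⟩
      refine ⟨φ.symm y, ⟨?_, ?_⟩, φ.right_inv hy⟩
      · change φ (φ.symm y) ∈ A
        rwa [φ.right_inv hy]
      · have := φ.map_target hy
        rwa [hφ, e.extend_source] at this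
  have hGc : ContinuousOn (fun y => g (φ.symm y)) φ.target :=
    hg.comp_continuousOn e.continuousOn_extend_symm
  have hρm : AEMeasurable (fun y => ENNReal.ofReal (ρ y)) (volume.restrict φ.target) :=
    (hρc.aemeasurable htgt).ennreal_ofReal
  calc ∫ x, g x ∂μ = ∫ x in e.source, g x ∂μ :=
        (setIntegral_eq_integral_of_forall_compl_eq_zero hg0).symm
    _ = ∫ x in e.source, g (φ.symm (φ x)) ∂μ :=
        setIntegral_congr_fun hsrc fun x hx => by
          simp only [hφ]
          rw [e.extend_left_inv hx]
    _ = ∫ y, g (φ.symm y) ∂((μ.restrict e.source).map φ) := by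
        refine (integral_map hφm (f := fun y => g (φ.symm y)) ?_).symm
        rw [hmap]
        exact (hGc.aestronglyMeasurable htgt).mono_ac (withDensity_absolutelyContinuous _ _)
    _ = ∫ y in φ.target, (ENNReal.ofReal (ρ y)).toReal • g (φ.symm y) := by
        rw [hmap, integral_withDensity_eq_integral_toReal_smul₀ hρm
          (Eventually.of_forall fun y => ENNReal.ofReal_lt_top)]
    _ = ∫ y in φ.target, ρ y • g (φ.symm y) :=
        setIntegral_congr_fun htgt fun y hy => by
          simp only [ENNReal.toReal_ofReal (hρ0 y hy).le]

end Geometry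

/-! ### Approximation of cut-off sections by finite rank operators -/

section Approximation

variable {n : ℕ} {H : Type*} [TopologicalSpace H]
  {I : ModelWithCorners ℝ (EuclideanSpace ℝ (Fin n)) H}
  {M : Type*} [TopologicalSpace M] [ChartedSpace H M]
  {B : Type*} [CStarAlgebra B] [PartialOrder B] [StarOrderedRing B]
  {W : Type*} [NormedAddCommGroup W] [NormedSpace ℂ W] [Module B W] [CStarModule B W]
  {E : M → Type*} [TopologicalSpace (TotalSpace W E)]
  [∀ x, NormedAddCommGroup (E x)] [∀ x, NormedSpace ℂ (E x)] [∀ x, Module B (E x)]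
  [∀ x, CStarModule B (E x)] [FiberBundle W E] [VectorBundle ℝ W E]
  [IsManifold I ∞ M] [ContMDiffVectorBundle ∞ W E I] [IsHermitianBBundle I B W E]
  [MeasurableSpace M] {μ : Measure M}
  [T2Space M] [BorelSpace M] [IsFiniteMeasureOnCompacts μ] [μ.IsOpenPosMeasure]
  [CompleteSpace W] [Module.Finite B W]
  {e : OpenPartialHomeomorph M H}
  (t : Trivialization W (π W E)) [MemTrivializationAtlas t]

/-- In a chart and a trivialisation, weighted means of sections are given by inner products
with smooth sections. -/
theorem exists_sum_inner_smul_eq_integral (he : e ∈ atlas H M)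
    {ρ : EuclideanSpace ℝ (Fin n) → ℝ} (hρc : ContDiffOn ℝ ∞ ρ (e.extend I).target)
    (hρ0 : ∀ y ∈ (e.extend I).target, 0 < ρ y)
    (hρ : ∀ A : Set M, MeasurableSet A → A ⊆ e.source →
      μ A = ∫⁻ y in e.extend I '' A, ENNReal.ofReal (ρ y))
    (hE : IsHermitianBBundle I B W E) {χ : TestFun I M}
    (hχt : tsupport χ ⊆ t.baseSet) {m : ℕ} (w : Fin m → W)
    (hw : Submodule.span B (Set.range w) = ⊤) {ψ : EuclideanSpace ℝ (Fin n) → ℝ}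
    (hψ : ContDiff ℝ ∞ ψ) (hψc : HasCompactSupport ψ)
    (hψt : ∀ y ∈ tsupport ψ, y ∈ (e.extend I).target ∧ χ ((e.extend I).symm y) = 1) :
    ∃ x : Fin m → TestSec I B W E μ, ∀ (u : EuclideanSpace ℝ (Fin n) → W) (τ : TestSec I B W E μ),
      (∀ y, τ y = χ y • t.symmL ℝ y (u (e.extend I y))) →
      ∑ i, (inner B (x i) τ : B) • w i = ∫ y, ψ y • u y := by
  classical
  obtain ⟨ν, hν, hνw⟩ := IsHermitianBBundle.exists_dual_frame t hE hχt w hw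
  set φ := e.extend I with hφ
  set K : Set M := φ.symm '' tsupport ψ with hK
  have hKc : IsCompact K := hψc.isCompact.image_of_continuousOn
    (e.continuousOn_extend_symm.mono fun y hy => (hψt y hy).1)
  have hKs : K ⊆ e.source := by
    rintro _ ⟨y, hy, rfl⟩
    have := φ.map_target (hψt y hy).1
    rwa [hφ, e.extend_source] at this
  have hKχ : ∀ x ∈ K, χ x = 1 := by
    rintro _ ⟨y, hy, rfl⟩
    exact (hψt y hy).2
  have hKt : K ⊆ t.baseSet := fun x hx =>
    hχt (subset_tsupport _ (by rw [Function.mem_support, hKχ x hx]; exact one_ne_zero))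
  have hψK : ∀ x ∈ e.source, x ∉ K → ψ (φ x) = 0 := fun x hx hxK => by
    by_contra h
    refine hxK ⟨φ x, subset_tsupport _ h, ?_⟩
    exact e.extend_left_inv hx
  -- The dual frame weighted by `ψ / ρ`: the factor `ρ⁻¹` cancels the density of `μ`, and summing
  -- over `i` reconstructs `u`. The value is set to zero off `K`, where the chart and `ν` carry no
  -- information.
  let g : Fin m → M → W := fun i x => if x ∈ K then (ψ (φ x) * (ρ (φ x))⁻¹) • ν i x else 0
  have hge : ∀ i, ∀ x ∈ e.source, g i x = (ψ (φ x) * (ρ (φ x))⁻¹) • ν i x := fun i x hx => by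
    by_cases hxK : x ∈ K
    · simp only [g, if_pos hxK]
    · simp only [g, if_neg hxK, hψK x hx hxK, zero_mul, zero_smul]
  have hφs : ContMDiffOn I 𝓘(ℝ, EuclideanSpace ℝ (Fin n)) ∞ φ e.source :=
    e.contMDiffOn_extend (IsManifold.subset_maximalAtlas he)
  have hmaps : Set.MapsTo φ e.source φ.target := fun x hx =>
    φ.map_source (by rwa [hφ, e.extend_source])
  have hgs : ∀ i, ∀ x ∈ K, ContMDiffAt I 𝓘(ℝ, W) ∞ (g i) x := fun i x hx => by
    have hxs := e.open_source.mem_nhds (hKs hx)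
    have h1 : ContMDiffAt I 𝓘(ℝ, ℝ) ∞ (fun y => ψ (φ y)) x :=
      hψ.contMDiff.contMDiffAt.comp x (hφs.contMDiffAt hxs)
    have h2 : ContMDiffAt I 𝓘(ℝ, ℝ) ∞ (fun y => (ρ (φ y))⁻¹) x := by
      have h3 : ContDiffOn ℝ ∞ (fun y => (ρ y)⁻¹) φ.target :=
        hρc.inv fun y hy => (hρ0 y hy).ne'
      exact (h3.contMDiffOn.comp hφs hmaps).contMDiffAt hxs
    refine ((h1.mul h2).smul (hν i x (hKχ x hx))).congr_of_eventuallyEq ?_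
    filter_upwards [hxs] with y hy
    exact hge i y hy
  choose x hx using fun i => TestSec.exists_of_trivialization μ t hE hKc hKt (hgs i)
    (fun y hy => if_neg hy)
  refine ⟨x, fun u τ hτ => ?_⟩
  have hsum : ∀ y, ∑ i, (inner B (x i y) (τ y) : B) • w i
      = if y ∈ K then (ψ (φ y) * (ρ (φ y))⁻¹) • u (φ y) else 0 := fun y => by
    by_cases hy : y ∈ K
    · rw [if_pos hy]
      simp only [hx, g, if_pos hy, hτ, hKχ y hy, one_smul, map_smul,
        CStarModule.inner_smul_left_real, smul_assoc, ← Finset.smul_sum]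
      rw [hνw y (hKχ y hy)]
    · rw [if_neg hy]
      simp only [hx, g, if_neg hy, map_zero, CStarModule.inner_zero_left, zero_smul,
        Finset.sum_const_zero]
  have hcont : Continuous fun y => ∑ i, (inner B (x i y) (τ y) : B) • w i :=
    continuous_finsetSum _ fun i _ =>
      (CStarModule.smulVec (w i)).continuous.comp (TestSec.continuous_inner (x i) τ)
  have hint : ∑ i, (inner B (x i) τ : B) • w i
      = ∫ y, ∑ i, (inner B (x i y) (τ y) : B) • w i ∂μ := by
    have hi : ∀ i, Integrable (fun y => (inner B (x i y) (τ y) : B) • w i) μ := fun i =>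
      (CStarModule.smulVec (w i)).integrable_comp (TestSec.integrable_inner (x i) τ)
    rw [integral_finsetSum _ fun i _ => hi i]
    refine Finset.sum_congr rfl fun i _ => ?_
    exact ((CStarModule.smulVec (w i)).integral_comp_comm
      (TestSec.integrable_inner (x i) τ)).symm
  rw [hint, integral_eq_setIntegral_extend hρc.continuousOn hρ0 hρ hcont fun y hy => by
    rw [hsum, if_neg fun h => hy (hKs h)]]
  have hψz : ∀ y ∉ φ.target, ψ y • u y = 0 := fun y hy => by
    have : y ∉ tsupport ψ := fun h => hy (hψt y h).1
    rw [image_eq_zero_of_notMem_tsupport this, zero_smul]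
  rw [← setIntegral_eq_integral_of_forall_compl_eq_zero hψz]
  have htgt : MeasurableSet φ.target := by
    rw [hφ, e.extend_target]
    exact (e.open_target.preimage I.continuous_symm).measurableSet.inter
      I.isClosed_range.measurableSet
  refine setIntegral_congr_fun htgt fun y hy => ?_
  simp only [hsum]
  by_cases hyψ : y ∈ tsupport ψ
  · rw [if_pos ⟨y, hyψ, rfl⟩, φ.right_inv hy, smul_smul]
    congr 1
    have hne := (hρ0 y hy).ne'
    field_simp
  · have hyK : φ.symm y ∉ K := by
      rintro ⟨z, hz, hzy⟩
      exact hyψ (φ.symm.injOn (hψt z hz).1 hy hzy ▸ hz)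
    rw [if_neg hyK, smul_zero, image_eq_zero_of_notMem_tsupport hyψ, zero_smul]

/-- The inner product on `L²(M; E)` is controlled by that of the typical fibre in a chart. -/
theorem exists_inner_self_le_setIntegral
    {ρ : EuclideanSpace ℝ (Fin n) → ℝ} (hρc : ContDiffOn ℝ ∞ ρ (e.extend I).target)
    (hρ0 : ∀ y ∈ (e.extend I).target, 0 < ρ y)
    (hρ : ∀ A : Set M, MeasurableSet A → A ⊆ e.source →
      μ A = ∫⁻ y in e.extend I '' A, ENNReal.ofReal (ρ y))
    (hE : IsHermitianBBundle I B W E) {χ₁ χ : TestFun I M}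
    (hχ : tsupport χ ⊆ e.source ∩ t.baseSet) (h1 : ∀ x ∈ tsupport χ₁, χ x = 1) :
    ∃ c : ℝ, 0 ≤ c ∧ ∀ (d : EuclideanSpace ℝ (Fin n) → W), Continuous d →
      ∀ r : TestSec I B W E μ, (∀ x, r x = χ₁ x • t.symmL ℝ x (d (e.extend I x))) →
      (inner B r r : B) ≤ c • ∫ y in e.extend I '' tsupport χ₁, (inner B (d y) (d y) : B) := by
  obtain ⟨c₁, hc₁, hc₁b⟩ := IsHermitianBBundle.exists_inner_symmL_le (I := I) t hE
    (hχ.trans Set.inter_subset_right)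
  obtain ⟨c₂, hc₂, hc₂b⟩ := χ₁.exists_norm_le
  set φ := e.extend I with hφ
  have hsub : tsupport χ₁ ⊆ e.source := fun x hx =>
    (hχ (subset_tsupport _ (by rw [Function.mem_support, h1 x hx]; exact one_ne_zero))).1
  set K := φ '' tsupport χ₁ with hK
  have hφc : ContinuousOn φ e.source := by
    have := e.continuousOn_extend (I := I)
    rwa [e.extend_source] at this
  have hKc : IsCompact K :=
    χ₁.hasCompactSupport.isCompact.image_of_continuousOn (hφc.mono hsub)
  have hKt : K ⊆ φ.target := by
    rintro _ ⟨x, hx, rfl⟩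
    exact φ.map_source (by rw [hφ, e.extend_source]; exact hsub hx)
  obtain ⟨c₃, hc₃⟩ := hKc.exists_bound_of_continuousOn (hρc.continuousOn.mono hKt)
  -- The factors bound, in this order, the density on `K`, the square of the cutoff `χ₁`, and the
  -- fibre metric against that of `W`.
  refine ⟨max c₃ 0 * (c₂ ^ 2 * c₁), by positivity, fun d hd r hr => ?_⟩
  have hz : ∀ x ∉ tsupport χ₁, (inner B (r x) (r x) : B) = 0 := fun x hx => by
    rw [hr, image_eq_zero_of_notMem_tsupport hx, zero_smul, CStarModule.inner_zero_left]
  have hcont := TestSec.continuous_inner r r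
  have hsymm : ∀ y ∈ K, φ.symm y ∈ tsupport χ₁ := by
    rintro _ ⟨x, hx, rfl⟩
    rwa [φ.left_inv (by rw [hφ, e.extend_source]; exact hsub hx)]
  rw [TestSec.inner_def, integral_eq_setIntegral_extend hρc.continuousOn hρ0 hρ hcont
    fun x hx => hz x fun h => hx (hsub h), ← integral_smul]
  have htgt : MeasurableSet φ.target := by
    rw [hφ, e.extend_target]
    exact (e.open_target.preimage I.continuous_symm).measurableSet.inter
      I.isClosed_range.measurableSet
  rw [setIntegral_eq_of_subset_of_forall_sdiff_eq_zero htgt hKt fun y hy => by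
    rw [hz, smul_zero]
    intro h
    exact hy.2 ⟨_, h, φ.right_inv hy.1⟩]
  refine setIntegral_mono_on ?_ ?_ hKc.measurableSet fun y hy => ?_
  · exact ((hρc.continuousOn.mono hKt).smul
      (hcont.comp_continuousOn (e.continuousOn_extend_symm.mono hKt))).integrableOn_compact hKc
  · have hdd : Continuous fun y => (inner B (d y) (d y) : B) :=
      CStarModule.continuous_inner.comp (hd.prodMk hd)
    exact (hdd.const_smul _).continuousOn.integrableOn_compact hKc
  · have hy' := hsymm y hy
    simp only [hr]
    rw [φ.right_inv (hKt hy), CStarModule.inner_smul_smul_complex, mul_smul]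
    refine smul_le_smul ((Real.le_norm_self _).trans ((hc₃ y hy).trans (le_max_left _ _))) ?_
      (hρ0 y (hKt hy)).le ?_
    · rw [mul_smul]
      refine smul_le_smul ?_ (hc₁b _ (h1 _ hy') _) (by positivity)
        (smul_nonneg hc₁ CStarModule.inner_self_nonneg)
      gcongr
      exact hc₂b _
    · exact smul_nonneg (by positivity) CStarModule.inner_self_nonneg

end Approximation

section Rellich

variable {n : ℕ} {H : Type*} [TopologicalSpace H]
  {I : ModelWithCorners ℝ (EuclideanSpace ℝ (Fin n)) H}
  {M : Type*} [TopologicalSpace M] [ChartedSpace H M]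
  {B : Type*} [CStarAlgebra B] [PartialOrder B] [StarOrderedRing B]
  {W : Type*} [NormedAddCommGroup W] [NormedSpace ℂ W] [Module B W] [CStarModule B W]
  {E : M → Type*} [TopologicalSpace (TotalSpace W E)]
  [∀ x, NormedAddCommGroup (E x)] [∀ x, NormedSpace ℂ (E x)] [∀ x, Module B (E x)]
  [∀ x, CStarModule B (E x)] [FiberBundle W E] [VectorBundle ℝ W E]
  [IsManifold I ∞ M] [ContMDiffVectorBundle ∞ W E I] [IsHermitianBBundle I B W E]
  [MeasurableSpace M] {μ : Measure M}
  [T2Space M] [BorelSpace M] [IsFiniteMeasureOnCompacts μ] [μ.IsOpenPosMeasure]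
  [CompleteSpace W] [Module.Finite B W]

/-- In a chart and a trivialisation, cut-off sections of Sobolev class are approximated by finite
rank operators, with an error controlled by the Sobolev norm. -/
theorem exists_finiteRank_approx (hE : IsHermitianBBundle I B W E) (hμ : IsSmoothDensity I μ)
    {e : OpenPartialHomeomorph M H} (he : e ∈ atlas H M)
    (t : Trivialization W (π W E)) [MemTrivializationAtlas t] {χ₁ χ : TestFun I M}
    (hχ : tsupport χ ⊆ e.source ∩ t.baseSet) (h1 : ∀ᶠ x in 𝓝ˢ (tsupport χ₁), χ x = 1)
    {s σ : ℝ} (hσ0 : 0 < σ) (hσ1 : σ ≤ 1) (hσs : σ ≤ s) :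
    ∃ C δ₀ : ℝ, 0 ≤ C ∧ 0 < δ₀ ∧ ∀ δ, 0 < δ → δ ≤ δ₀ →
      ∃ P ∈ IsBCompact.finiteRank B (L2Sec I B W E μ) (L2Sec I B W E μ),
        ∀ (u : SchwartzMap (EuclideanSpace ℝ (Fin n)) W) (τ : TestSec I B W E μ),
          (∀ x, τ x = χ x • t.symm x (u (e.extend I x))) →
          ‖L2Sec.mul χ₁ (τ : L2Sec I B W E μ) - P τ‖ ≤ C * δ ^ σ * sobolevNorm B s u := by
  obtain ⟨ρ, hρc, hρ0, hρ⟩ := hμ e he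
  obtain ⟨V, hV, hV1, hVχ⟩ := eventually_nhdsSet_iff_exists.1 h1
  have hχt : tsupport χ ⊆ t.baseSet := hχ.trans Set.inter_subset_right
  have h1' : ∀ x ∈ tsupport χ₁, χ x = 1 := fun x hx => hVχ x (hV1 hx)
  have hVs : V ⊆ tsupport χ := fun x hx =>
    subset_tsupport _ (by rw [Function.mem_support, hVχ x hx]; exact one_ne_zero)
  have hsub : tsupport χ₁ ⊆ e.source := fun x hx => (hχ (hVs (hV1 hx))).1
  have hsubt : tsupport χ₁ ⊆ t.baseSet := fun x hx => hχt (hVs (hV1 hx))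
  obtain ⟨O, hO, hVO, hOV⟩ := e.exists_isOpen_extend (I := I) hV
    (fun x hx => (hχ (hVs hx)).1)
  set φ := e.extend I with hφ
  have hφc : ContinuousOn φ e.source := by
    have := e.continuousOn_extend (I := I)
    rwa [e.extend_source] at this
  set K := φ '' tsupport χ₁ with hK
  have hKc : IsCompact K :=
    χ₁.hasCompactSupport.isCompact.image_of_continuousOn (hφc.mono hsub)
  have hKr : K ⊆ Set.range I := by
    rintro _ ⟨x, hx, rfl⟩
    exact ⟨e x, rfl⟩
  have hKO : K ⊆ O := by
    rintro _ ⟨x, hx, rfl⟩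
    exact hVO x (hV1 hx)
  obtain ⟨A, R, δ₀, hA, hR, hδ₀, hker⟩ := exists_averaging_kernels I.convex_range
    I.nonempty_interior hKc hKr hO hKO
  obtain ⟨c, hc, hcb⟩ := exists_inner_self_le_setIntegral t hρc hρ0 hρ hE hχ h1'
  obtain ⟨m, w, hw⟩ := Module.Finite.exists_fin (R := B) (M := W)
  refine ⟨√(c * (A * (4 * (2 * Real.pi * R) ^ (2 * σ)))), δ₀, Real.sqrt_nonneg _, hδ₀,
    fun δ hδ hδδ => ?_⟩
  obtain ⟨ι, _, p, q, κ, hp, hp0, hp1, hq, hqc, hq0, hq1, hqt, hκ, hqκ, hpq, hκA⟩ := hker δ hδ hδδ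
  choose x hx using fun j => exists_sum_inner_smul_eq_integral (μ := μ) t he hρc hρ0 hρ hE hχt w hw
    (hq j) (hqc j) (fun y hy => ⟨(hOV y (hqt j hy)).1, hVχ _ (hOV y (hqt j hy)).2⟩)
  have hy' : ∀ (j : ι) (i : Fin m), ∀ z ∈ tsupport χ₁,
      ContMDiffAt I 𝓘(ℝ, W) ∞ (fun z => χ₁ z • p j (φ z) • w i) z := fun j i z hz => by
    have h2 : ContMDiffAt I 𝓘(ℝ, EuclideanSpace ℝ (Fin n)) ∞ φ z :=
      e.contMDiffAt_extend (IsManifold.subset_maximalAtlas he) (hsub hz)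
    have h3 : ContMDiffAt I 𝓘(ℝ, W) ∞ (fun z => p j (φ z) • w i) z :=
      ((hp j).contMDiff.contMDiffAt.comp z h2).smul contMDiffAt_const
    exact ((ContinuousLinearMap.lsmul ℝ ℂ : ℂ →L[ℝ] W →L[ℝ] W).contMDiff.contMDiffAt.comp z
      (χ₁.contMDiff z)).clm_apply h3
  choose y hy using fun j i => TestSec.exists_of_trivialization μ t hE
    χ₁.hasCompactSupport.isCompact hsubt (hy' j i) (fun z hz => by
      rw [image_eq_zero_of_notMem_tsupport hz, zero_smul])
  -- In coordinates this is `u ↦ χ₁ ∑ⱼ pⱼ ∫ qⱼ u`: the sections `x j i` compute the mean of `u`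
  -- against `qⱼ`, and `y j i` spreads its components by `pⱼ`. It depends on `δ` but not on `u`.
  refine ⟨∑ j, ∑ i, CStarModule.rankOne (B := B) (x j i : L2Sec I B W E μ)
    (y j i : L2Sec I B W E μ), Submodule.sum_mem _ fun j _ => Submodule.sum_mem _ fun i _ =>
      IsBCompact.rankOne_mem _ _, fun u τ hτ => ?_⟩
  have hτ' : ∀ z, τ z = χ z • t.symmL ℝ z (u (φ z)) := fun z => by
    by_cases hz : z ∈ t.baseSet
    · rw [hτ, t.symmL_apply hz]
    · have : χ z = 0 := image_eq_zero_of_notMem_tsupport fun h => hz (hχt h)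
      rw [hτ, this, zero_smul, zero_smul]
  set r : TestSec I B W E μ := TestSec.mul χ₁ τ - ∑ j, ∑ i, (inner B (x j i) τ : B) • y j i with hr
  have hPr : L2Sec.mul χ₁ (τ : L2Sec I B W E μ) - (∑ j, ∑ i,
      CStarModule.rankOne (B := B) (x j i : L2Sec I B W E μ) (y j i : L2Sec I B W E μ)) τ
      = (r : L2Sec I B W E μ) := by
    simp only [sum_apply, CStarModule.rankOne_apply, L2Sec.mul_coe,
      CStarModule.completion_inner_coe]
    rw [hr, UniformSpace.Completion.coe_sub]
    congr 1
    simp only [← UniformSpace.Completion.coe_smul]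
    have hsum : ∀ {α : Type} (S : Finset α) (f : α → TestSec I B W E μ),
        ((∑ a ∈ S, f a : TestSec I B W E μ) : L2Sec I B W E μ)
          = ∑ a ∈ S, (f a : L2Sec I B W E μ) := fun S f =>
      map_sum (UniformSpace.Completion.toCompl (α := TestSec I B W E μ)) f S
    simp only [hsum]
  -- The error in coordinates, to which the Euclidean averaging estimate applies with `r = R δ`.
  let d : EuclideanSpace ℝ (Fin n) → W := fun z => u z - ∑ j, p j z • ∫ y, q j y • u y
  have hd : Continuous d := u.continuous.sub (continuous_finsetSum _ fun j _ =>
    (hp j).continuous.smul continuous_const)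
  have hrd : ∀ z, r z = χ₁ z • t.symmL ℝ z (d (φ z)) := fun z => by
    have e0 : r z = χ₁ z • τ z - ∑ j, ∑ i, (inner B (x j i) τ : B) • y j i z := by
      rw [hr, sub_eq_add_neg, ← neg_one_smul ℂ, TestSec.add_apply, TestSec.smul_apply,
        neg_one_smul, ← sub_eq_add_neg, TestSec.mul_apply, TestSec.sum_apply]
      simp only [TestSec.sum_apply, TestSec.base_smul_apply]
    have e1 : χ₁ z • τ z = χ₁ z • t.symmL ℝ z (u (φ z)) := by
      by_cases hz : z ∈ tsupport χ₁
      · rw [hτ', h1' z hz, one_smul]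
      · rw [image_eq_zero_of_notMem_tsupport hz, zero_smul, zero_smul]
    have e2 : ∀ j, ∑ i, (inner B (x j i) τ : B) • y j i z
        = χ₁ z • t.symmL ℝ z (p j (φ z) • ∫ y, q j y • u y) := fun j => by
      rw [← hx j u τ hτ', Finset.smul_sum, map_sum, Finset.smul_sum]
      refine Finset.sum_congr rfl fun i _ => ?_
      rw [hy, ← t.symmL_base_smul hE, ← t.symmL_complex_smul hE, smul_comm _ (χ₁ z),
        smul_comm _ (p j (φ z))]
    rw [e0, e1, Finset.sum_congr rfl fun j _ => e2 j, ← Finset.smul_sum, ← smul_sub, ← map_sum,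
      ← map_sub]
  set Z : B := ∫ ξ, (1 + ‖ξ‖ ^ 2) ^ s • (inner B (𝓕 u ξ) (𝓕 u ξ) : B) with hZ
  have hZ0 : 0 ≤ Z := integral_nonneg fun ξ =>
    smul_nonneg (by positivity) CStarModule.inner_self_nonneg
  have hmain : (inner B r r : B)
      ≤ (c * (A * (4 * (2 * Real.pi * R) ^ (2 * σ))) * (δ ^ σ) ^ 2) • Z := by
    refine (hcb d hd r hrd).trans ?_
    have h2 := SchwartzMap.integral_inner_sub_average_le (B := B) hσ0 hσ1 hσs hKc
      (fun j => (hp j).continuous) hp0 hp1 (fun j => (hq j).continuous) hqc hq0 hq1 hκ hqκ hpq u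
    refine (smul_le_smul_of_nonneg_left h2 hc).trans ?_
    rw [smul_smul]
    refine smul_le_smul_of_nonneg_right ?_ hZ0
    have e3 : (2 * Real.pi * (R * δ)) ^ (2 * σ) = (2 * Real.pi * R) ^ (2 * σ) * (δ ^ σ) ^ 2 := by
      rw [← mul_assoc, Real.mul_rpow (by positivity) hδ.le, ← Real.rpow_natCast,
        ← Real.rpow_mul hδ.le]
      congr 2
      push_cast
      ring
    rw [e3]
    calc c * (κ * volume.real (Metric.closedBall (0 : EuclideanSpace ℝ (Fin n)) (R * δ))
          * (4 * ((2 * Real.pi * R) ^ (2 * σ) * (δ ^ σ) ^ 2)))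
        ≤ c * (A * (4 * ((2 * Real.pi * R) ^ (2 * σ) * (δ ^ σ) ^ 2))) := by gcongr
      _ = _ := by ring
  rw [hPr, UniformSpace.Completion.norm_coe, sobolevNorm]
  refine le_of_sq_le_sq ?_ (by positivity)
  rw [CStarModule.norm_sq_eq B, mul_pow, mul_pow, Real.sq_sqrt (by positivity),
    Real.sq_sqrt (norm_nonneg _)]
  have hr0 : (0 : B) ≤ inner B r r :=
    integral_nonneg fun z => CStarModule.inner_self_nonneg
  refine (CStarAlgebra.norm_le_norm_of_nonneg_of_le hr0 hmain).trans ?_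
  rw [norm_smul, Real.norm_of_nonneg (by positivity)]

end Rellich

/-! ### Finite rank operators and uniformity of pointwise rates -/

section FiniteRank

variable {B : Type*} [CStarAlgebra B] [PartialOrder B] [StarOrderedRing B]
  {X : Type*} [NormedAddCommGroup X] [NormedSpace ℂ X] [Module B X] [CStarModule B X]
  {Y : Type*} [NormedAddCommGroup Y] [NormedSpace ℂ Y] [Module B Y] [CStarModule B Y]
  {Z : Type*} [NormedAddCommGroup Z] [NormedSpace ℂ Z] [Module B Z] [CStarModule B Z]

theorem IsBCompact.finiteRank_comp {P : X →L[ℂ] Y} (hP : P ∈ IsBCompact.finiteRank B X Y)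
    {A : Z →L[ℂ] X} (hA : IsAdjointable B A) : P.comp A ∈ IsBCompact.finiteRank B Z Y := by
  obtain ⟨A', hA'⟩ := hA
  refine Submodule.span_induction ?_ ?_ ?_ ?_ hP
  · rintro R ⟨x, y, hR⟩
    have : R = CStarModule.rankOne (B := B) x y := ContinuousLinearMap.ext hR
    rw [this, IsBCompact.rankOne_comp hA']
    exact IsBCompact.rankOne_mem _ _
  · rw [ContinuousLinearMap.zero_comp]
    exact zero_mem _
  · intro R S _ _ hR hS
    rw [ContinuousLinearMap.add_comp]
    exact add_mem hR hS
  · intro z R _ hR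
    rw [ContinuousLinearMap.smul_comp]
    exact Submodule.smul_mem _ _ hR

/-- If operators on a Banach space are approximated at a given rate at every vector, then they are
approximated in norm. -/
theorem exists_norm_le_of_pointwise_rate {G F : Type*} [NormedAddCommGroup G] [NormedSpace ℂ G]
    [CompleteSpace G] [NormedAddCommGroup F] [NormedSpace ℂ F] {σ δ₀ : ℝ} (hσ : 0 < σ)
    (hδ₀ : 0 < δ₀) (T : ℝ → G →L[ℂ] F)
    (hT : ∀ f, ∃ c : ℝ, ∀ δ, 0 < δ → δ ≤ δ₀ → ‖T δ f‖ ≤ c * δ ^ σ) {ε : ℝ} (hε : 0 < ε) :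
    ∃ δ, 0 < δ ∧ δ ≤ δ₀ ∧ ‖T δ‖ < ε := by
  -- The operators `δ^{-σ} T_δ` are bounded at each vector, hence uniformly in norm; so `‖T_δ‖` is
  -- at most a constant times `δ^σ` and tends to zero.
  obtain ⟨c, hc⟩ := banach_steinhaus
    (g := fun δ : Set.Ioc (0 : ℝ) δ₀ => ((((δ : ℝ) ^ σ)⁻¹ : ℝ) : ℂ) • T δ) fun f => by
    obtain ⟨c, hc⟩ := hT f
    refine ⟨c, fun δ => ?_⟩
    have hδ : 0 < (δ : ℝ) ^ σ := Real.rpow_pos_of_pos δ.2.1 _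
    rw [smul_apply, norm_smul, Complex.norm_real, Real.norm_of_nonneg (inv_nonneg.2 hδ.le),
      inv_mul_le_iff₀ hδ, mul_comm]
    exact hc δ δ.2.1 δ.2.2
  have hlim : Tendsto (fun δ : ℝ => (|c| + 1) * δ ^ σ) (𝓝[>] 0) (𝓝 0) := by
    have h := ((Real.continuousAt_rpow_const 0 σ (Or.inr hσ.le)).tendsto.const_mul
      (|c| + 1)).mono_left (nhdsWithin_le_nhds (s := Set.Ioi 0))
    rwa [Real.zero_rpow hσ.ne', mul_zero] at h
  obtain ⟨δ, hδε, hδ0, hδδ⟩ := ((hlim.eventually_lt_const hε).and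
    (Ioc_mem_nhdsGT hδ₀)).exists
  refine ⟨δ, hδ0, hδδ, lt_of_le_of_lt ?_ hδε⟩
  have hδ : 0 < δ ^ σ := Real.rpow_pos_of_pos hδ0 _
  have h : ‖(((δ ^ σ)⁻¹ : ℝ) : ℂ) • T δ‖ ≤ c := hc ⟨δ, hδ0, hδδ⟩
  rw [norm_smul, Complex.norm_real, Real.norm_of_nonneg (inv_nonneg.2 hδ.le),
    inv_mul_le_iff₀ hδ] at h
  rw [mul_comm]
  exact h.trans (by gcongr; linarith [le_abs_self c])

end FiniteRank

/-! ### Relative compactness of multiplication operators -/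

section Rellich

variable {n : ℕ} {H : Type*} [TopologicalSpace H]
  {I : ModelWithCorners ℝ (EuclideanSpace ℝ (Fin n)) H}
  {M : Type*} [TopologicalSpace M] [ChartedSpace H M]
  {B : Type*} [CStarAlgebra B] [PartialOrder B] [StarOrderedRing B]
  {W : Type*} [NormedAddCommGroup W] [NormedSpace ℂ W] [Module B W] [CStarModule B W]
  {E : M → Type*} [TopologicalSpace (TotalSpace W E)]
  [∀ x, NormedAddCommGroup (E x)] [∀ x, NormedSpace ℂ (E x)] [∀ x, Module B (E x)]
  [∀ x, CStarModule B (E x)] [FiberBundle W E] [VectorBundle ℝ W E]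
  [IsManifold I ∞ M] [ContMDiffVectorBundle ∞ W E I] [IsHermitianBBundle I B W E]
  [MeasurableSpace M] {μ : Measure M}
  [T2Space M] [BorelSpace M] [IsFiniteMeasureOnCompacts μ] [μ.IsOpenPosMeasure]
  [CompleteSpace W] [Module.Finite B W]
  {Y : Type*} [NormedAddCommGroup Y] [NormedSpace ℂ Y] [Module B Y] [CStarModule B Y]
  [CompleteSpace Y] {D : L2Sec I B W E μ →ₗ.[B] Y}

open UnboundedOp

/-- The compactness of the inclusion of a local Sobolev space, in a chart and a trivialisation. -/
theorem UnboundedOp.IsRegular.isBCompact_mul_of_chart (hE : IsHermitianBBundle I B W E)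
    (hμ : IsSmoothDensity I μ) (hD : IsRegular D) {s : ℝ} (hs : 0 < s)
    (hdom : ∀ f ∈ D.domain, MemSobolevLoc s f)
    {e : OpenPartialHomeomorph M H} (he : e ∈ atlas H M)
    (t : Trivialization W (π W E)) [MemTrivializationAtlas t] {χ₁ χ : TestFun I M}
    (hχ : tsupport χ ⊆ e.source ∩ t.baseSet) (h1 : ∀ᶠ x in 𝓝ˢ (tsupport χ₁), χ x = 1) :
    IsBCompact B ((L2Sec.mul χ₁).comp (GraphDomain.inclL D)) := by
  have := GraphDomain.completeSpace hD.isClosed_graph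
  have hσ : 0 < min s 1 := lt_min hs one_pos
  obtain ⟨C, δ₀, hC, hδ₀, happ⟩ := exists_finiteRank_approx hE hμ he t hχ h1 hσ
    (min_le_right _ _) (min_le_left _ _)
  -- Extended by zero outside `0 < δ ≤ δ₀`, so that `P` can be chosen as a function of all real `δ`.
  have happ' : ∀ δ : ℝ, ∃ P ∈ IsBCompact.finiteRank B (L2Sec I B W E μ) (L2Sec I B W E μ),
      0 < δ → δ ≤ δ₀ → ∀ (u : SchwartzMap (EuclideanSpace ℝ (Fin n)) W) (τ : TestSec I B W E μ),
        (∀ x, τ x = χ x • t.symm x (u (e.extend I x))) →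
        ‖L2Sec.mul χ₁ (τ : L2Sec I B W E μ) - P τ‖ ≤ C * δ ^ (min s 1) * sobolevNorm B s u :=
    fun δ => by
    by_cases h : 0 < δ ∧ δ ≤ δ₀
    · obtain ⟨P, hP, hPb⟩ := happ δ h.1 h.2
      exact ⟨P, hP, fun _ _ => hPb⟩
    · exact ⟨0, zero_mem _, fun h2 h3 => absurd ⟨h2, h3⟩ h⟩
  choose P hP hPb using happ'
  have hmul : (L2Sec.mul χ₁ : L2Sec I B W E μ →L[ℂ] L2Sec I B W E μ)
      = (L2Sec.mul χ₁).comp (L2Sec.mul χ) := L2Sec.mul_eq_comp fun x => by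
    by_cases hx : x ∈ tsupport χ₁
    · rw [h1.self_of_nhdsSet x hx, mul_one]
    · rw [image_eq_zero_of_notMem_tsupport hx, zero_mul]
  refine IsBCompact.of_forall_exists fun ε hε => ?_
  -- The rate at a fixed `f`: for `j ≥ N` the Sobolev approximants satisfy `‖uⱼ‖ ≤ 1 + ‖u_N‖`, and
  -- the bound passes to the limit because `χ₁ - P δ` is continuous on `L²`. The constant may depend
  -- on `f` in an uncontrolled way.
  have hT : ∀ f, ∃ c : ℝ, ∀ δ, 0 < δ → δ ≤ δ₀ →
      ‖(L2Sec.mul χ₁ - P δ).comp ((L2Sec.mul χ).comp (GraphDomain.inclL D)) f‖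
        ≤ c * δ ^ min s 1 := fun f => by
    obtain ⟨u, hu, τ, hτ, hlim⟩ := hdom (GraphDomain.inclL D f) f.2 e he t χ hχ
    obtain ⟨N, hN⟩ := hu 1 one_pos
    refine ⟨C * (1 + sobolevNorm B s (u N)), fun δ hδ hδδ => ?_⟩
    have hlim' := (((L2Sec.mul χ₁ - P δ).continuous.tendsto _).comp hlim).norm
    refine le_of_tendsto hlim' (Filter.eventually_atTop.2 ⟨N, fun j hj => ?_⟩)
    have h2 := hPb δ hδ hδδ (u j - u N) (τ j - τ N) fun x => by
      have e1 : (τ j - τ N) x = τ j x - τ N x := rfl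
      rw [e1, hτ, hτ, ← smul_sub]
      by_cases hx : x ∈ t.baseSet
      · rw [← t.symmL_apply (R := ℝ) hx, ← t.symmL_apply (R := ℝ) hx,
          ← t.symmL_apply (R := ℝ) hx, ← map_sub]
        rfl
      · have : χ x = 0 := image_eq_zero_of_notMem_tsupport fun h => hx (hχ h).2
        rw [this, zero_smul, zero_smul]
    have h3 := hPb δ hδ hδδ (u N) (τ N) (hτ N)
    have e2 : (L2Sec.mul χ₁ - P δ : L2Sec I B W E μ →L[ℂ] L2Sec I B W E μ) (τ j : L2Sec I B W E μ)
        = (L2Sec.mul χ₁ ((τ j - τ N : TestSec I B W E μ) : L2Sec I B W E μ)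
            - P δ ((τ j - τ N : TestSec I B W E μ) : L2Sec I B W E μ))
          + (L2Sec.mul χ₁ (τ N : L2Sec I B W E μ) - P δ (τ N : L2Sec I B W E μ)) := by
      rw [UniformSpace.Completion.coe_sub, sub_apply, map_sub, map_sub]
      abel
    change ‖(L2Sec.mul χ₁ - P δ : L2Sec I B W E μ →L[ℂ] L2Sec I B W E μ)
      (τ j : L2Sec I B W E μ)‖ ≤ _
    rw [e2]
    have h4 : 0 ≤ C * δ ^ min s 1 := by positivity
    calc _ ≤ C * δ ^ min s 1 * sobolevNorm B s (u j - u N)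
          + C * δ ^ min s 1 * sobolevNorm B s (u N) := (norm_add_le _ _).trans (add_le_add h2 h3)
      _ ≤ C * δ ^ min s 1 * 1 + C * δ ^ min s 1 * sobolevNorm B s (u N) := by
          gcongr
          exact (hN j hj N le_rfl).le
      _ = _ := by ring
  obtain ⟨δ, -, -, hδε⟩ := exists_norm_le_of_pointwise_rate hσ hδ₀
    (fun δ => (L2Sec.mul χ₁ - P δ).comp ((L2Sec.mul χ).comp (GraphDomain.inclL D))) hT hε
  -- The composition keeps finite rank because multiplication by `χ` and the inclusion of the domain
  -- are adjointable.
  refine ⟨(P δ).comp ((L2Sec.mul χ).comp (GraphDomain.inclL D)),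
    IsBCompact.finiteRank_comp (hP δ)
      ((L2Sec.isAdjointable_mul χ).comp hD.isAdjointable_inclL), ?_⟩
  rw [hmul, ContinuousLinearMap.comp_assoc, ← ContinuousLinearMap.sub_comp]
  exact hδε

variable [SecondCountableTopology M]

/-- If the domain of a regular operator consists of sections of local Sobolev class of positive
order, then compactly supported functions are `B`-compact relative to the operator. -/
theorem UnboundedOp.IsRegular.isBCompact_mul (hE : IsHermitianBBundle I B W E)
    (hμ : IsSmoothDensity I μ) (hD : IsRegular D) {s : ℝ} (hs : 0 < s)
    (hdom : ∀ f ∈ D.domain, MemSobolevLoc s f) (k : TestFun I M) :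
    IsBCompact B ((L2Sec.mul k).comp (GraphDomain.inclL D)) := by
  classical
  -- A partition of unity on the support of `k` splits it into pieces, each supported where one
  -- chart and one trivialisation are both defined.
  let U : M → Set M := fun x => (chartAt H x).source ∩ (trivializationAt W E x).baseSet
  have hUo : ∀ x, IsOpen (U x) := fun x =>
    (chartAt H x).open_source.inter (trivializationAt W E x).open_baseSet
  have hUx : ∀ x, x ∈ U x := fun x =>
    ⟨mem_chart_source H x, FiberBundle.mem_baseSet_trivializationAt' x⟩
  obtain ⟨S, hS⟩ := k.hasCompactSupport.isCompact.elim_finite_subcover U hUo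
    fun x _ => Set.mem_iUnion.2 ⟨x, hUx x⟩
  have : LocallyCompactSpace M := Manifold.locallyCompact_of_finiteDimensional I
  obtain ⟨p, hp⟩ := SmoothPartitionOfUnity.exists_isSubordinate I (isClosed_tsupport k)
    (fun x : S => U x) (fun x => hUo x) (by simpa [Set.iUnion_subtype] using hS)
  let l : S → TestFun I M := fun x =>
    { toFun := fun z => (p x z : ℂ) * k z
      contMDiff := ((ContinuousLinearMap.mul ℝ ℂ).contMDiff.comp
        (Complex.ofRealCLM.contMDiff.comp (p x).contMDiff)).clm_apply k.contMDiff
      hasCompactSupport := k.hasCompactSupport.mul_left }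
  have hsum : ∀ z, k z = ∑ x, l x z := fun z => by
    change k z = ∑ x, (p x z : ℂ) * k z
    by_cases hz : z ∈ tsupport k
    · have h := p.sum_eq_one hz
      rw [finsum_eq_sum_of_fintype] at h
      rw [← Finset.sum_mul, ← Complex.ofReal_sum, h, Complex.ofReal_one, one_mul]
    · rw [image_eq_zero_of_notMem_tsupport hz]
      simp
  have hlU : ∀ x, tsupport (l x) ⊆ U x := fun x => by
    refine (closure_mono fun z hz => ?_).trans (hp x)
    intro h
    refine hz ?_
    change (p x z : ℂ) * k z = 0
    rw [h, Complex.ofReal_zero, zero_mul]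
  rw [L2Sec.mul_sum Finset.univ l k hsum, ContinuousLinearMap.finsetSum_comp]
  refine IsBCompact.sum _ fun x _ => ?_
  obtain ⟨χ, hχ, hχ1⟩ := TestFun.exists_cutoff I (l x).hasCompactSupport.isCompact (hUo x) (hlU x)
  exact hD.isBCompact_mul_of_chart hE hμ hs hdom (chart_mem_atlas H (x : M))
    (trivializationAt W E (x : M)) hχ hχ1

end Rellich

/-! ### From finitely many functionals to a compactly supported multiplier -/

section Localization

variable {n : ℕ} {H : Type*} [TopologicalSpace H]
  {I : ModelWithCorners ℝ (EuclideanSpace ℝ (Fin n)) H}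
  {M : Type*} [TopologicalSpace M] [ChartedSpace H M]
  {B : Type*} [CStarAlgebra B] [PartialOrder B] [StarOrderedRing B]
  {W : Type*} [NormedAddCommGroup W] [NormedSpace ℂ W] [Module B W] [CStarModule B W]
  {E : M → Type*} [TopologicalSpace (TotalSpace W E)]
  [∀ x, NormedAddCommGroup (E x)] [∀ x, NormedSpace ℂ (E x)] [∀ x, Module B (E x)]
  [∀ x, CStarModule B (E x)] [FiberBundle W E] [VectorBundle ℝ W E]
  [IsManifold I ∞ M] [ContMDiffVectorBundle ∞ W E I] [IsHermitianBBundle I B W E]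
  [MeasurableSpace M] {μ : Measure M}
  [T2Space M] [BorelSpace M] [IsFiniteMeasureOnCompacts μ] [μ.IsOpenPosMeasure]
  [SecondCountableTopology M]

/-- Finitely many compactly supported sections only see a compact part of the manifold. -/
theorem L2Sec.exists_inner_eq_inner_mul {S : Set (L2Sec I B W E μ)} (hSf : S.Finite)
    (hS : S ⊆ Set.range fun σ : TestSec I B W E μ => (σ : L2Sec I B W E μ)) :
    ∃ k : TestFun I M, ∀ x ∈ S, ∀ f : L2Sec I B W E μ,
      (inner B x f : B) = inner B x (L2Sec.mul k f) := by
  choose σ hσ using fun x : S => hS x.2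
  have := hSf.to_subtype
  choose K hK hK0 using fun τ : TestSec I B W E μ => τ.2.2
  obtain ⟨χ, -, hχ⟩ := TestFun.exists_cutoff I
    (isCompact_iUnion fun x : S => hK (σ x)) isOpen_univ (Set.subset_univ _)
  -- The conjugate, since `χ` acts on the first argument of the inner product: `⟨x, f⟩ = ⟨χ x, f⟩ =
  -- ⟨x, χ̄ f⟩`.
  refine ⟨χ.conj, fun x hx f => ?_⟩
  rw [← L2Sec.inner_mul_left]
  have h : TestSec.mul χ (σ ⟨x, hx⟩) = σ ⟨x, hx⟩ := by
    ext z
    rw [TestSec.mul_apply]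
    by_cases hz : z ∈ K (σ ⟨x, hx⟩)
    · rw [hχ.self_of_nhdsSet z (Set.mem_iUnion_of_mem ⟨x, hx⟩ hz), one_smul]
    · rw [show σ ⟨x, hx⟩ z = 0 from hK0 _ z hz, smul_zero]
  have h2 := hσ ⟨x, hx⟩
  simp only at h2
  rw [← h2, L2Sec.mul_coe, h]

/-- The finitely many functionals controlling `f` can be taken in the dense space of test sections.
A cutoff equal to one on all their supports leaves them unchanged, so they depend on `kf` only. -/
theorem UnboundedOp.IsLeftBFredholm.exists_bound_mul
    {Y : Type*} [NormedAddCommGroup Y] [NormedSpace ℂ Y] [Module B Y] [CStarModule B Y]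
    {D : L2Sec I B W E μ →ₗ.[B] Y} (hD : UnboundedOp.IsLeftBFredholm D) :
    ∃ k : TestFun I M, ∃ C : ℝ, ∀ f : D.domain,
      ‖(f : L2Sec I B W E μ)‖ ≤ C * (‖L2Sec.mul k (f : L2Sec I B W E μ)‖ + ‖D f‖) := by
  obtain ⟨t, C, ht, hC⟩ := hD.exists_bound
    (UniformSpace.Completion.denseRange_coe (α := TestSec I B W E μ))
  obtain ⟨k, hk⟩ := L2Sec.exists_inner_eq_inner_mul t.finite_toSet ht
  refine ⟨k, max C 0 * (∑ x ∈ t, ‖x‖ + 1), fun f => (hC f).trans ?_⟩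
  have h1 : ∑ x ∈ t, ‖(inner B x (f : L2Sec I B W E μ) : B)‖
      ≤ (∑ x ∈ t, ‖x‖) * ‖L2Sec.mul k (f : L2Sec I B W E μ)‖ := by
    rw [Finset.sum_mul]
    refine Finset.sum_le_sum fun x hx => ?_
    rw [hk x hx]
    exact CStarModule.norm_inner_le (A := B) (L2Sec I B W E μ)
  have h2 : 0 ≤ ∑ x ∈ t, ‖x‖ := Finset.sum_nonneg fun x _ => norm_nonneg x
  have h3 : 0 ≤ ∑ x ∈ t, ‖(inner B x (f : L2Sec I B W E μ) : B)‖ :=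
    Finset.sum_nonneg fun x _ => norm_nonneg _
  rw [mul_assoc]
  calc _ ≤ max C 0 * (∑ x ∈ t, ‖(inner B x (f : L2Sec I B W E μ) : B)‖ + ‖D f‖) := by
        gcongr
        exact le_max_left _ _
    _ ≤ _ := by
        gcongr
        rw [add_mul, mul_add, one_mul]
        nlinarith [norm_nonneg (D f), norm_nonneg (L2Sec.mul k (f : L2Sec I B W E μ)),
          mul_nonneg h2 (norm_nonneg (D f))]

end Localization

end

/-! ### The equivalences -/

theorem theorem1p3
    -- a smooth manifold, possibly with boundary, with a smooth positive density
    {n : ℕ} {H : Type*} [TopologicalSpace H]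
    (I : ModelWithCorners ℝ (EuclideanSpace ℝ (Fin n)) H)
    {M : Type*} [TopologicalSpace M] [ChartedSpace H M] [IsManifold I ∞ M]
    [T2Space M] [SecondCountableTopology M] [MeasurableSpace M] [BorelSpace M]
    (μ : Measure M) [IsFiniteMeasureOnCompacts μ] [μ.IsOpenPosMeasure]
    (hμ : IsSmoothDensity I μ)
    -- a unital C⋆-algebra
    (B : Type*) [CStarAlgebra B] [PartialOrder B] [StarOrderedRing B]
    -- a Hermitian vector `B`-bundle `E` with finitely generated projective fibre `W`
    (W : Type*) [NormedAddCommGroup W] [NormedSpace ℂ W] [CompleteSpace W] [Module B W]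
    [CStarModule B W] [Module.Finite B W] [Module.Projective B W]
    (E : M → Type*) [TopologicalSpace (TotalSpace W E)]
    [∀ x, NormedAddCommGroup (E x)] [∀ x, NormedSpace ℂ (E x)] [∀ x, Module B (E x)]
    [∀ x, CStarModule B (E x)] [FiberBundle W E] [VectorBundle ℝ W E]
    [ContMDiffVectorBundle ∞ W E I] [IsHermitianBBundle I B W E]
    -- a Hermitian vector `B`-bundle `F` with finitely generated projective fibre `V`
    (V : Type*) [NormedAddCommGroup V] [NormedSpace ℂ V] [CompleteSpace V] [Module B V]
    [CStarModule B V] [Module.Finite B V] [Module.Projective B V]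
    (F : M → Type*) [TopologicalSpace (TotalSpace V F)]
    [∀ x, NormedAddCommGroup (F x)] [∀ x, NormedSpace ℂ (F x)] [∀ x, Module B (F x)]
    [∀ x, CStarModule B (F x)] [FiberBundle V F] [VectorBundle ℝ V F]
    [ContMDiffVectorBundle ∞ V F I] [IsHermitianBBundle I B V F]
    -- a regular operator with domain in a local Sobolev space of positive order
    (D : L2Sec I B W E μ →ₗ.[B] L2Sec I B V F μ)
    (hD : UnboundedOp.IsRegular D)
    (s : ℝ) (hs : 0 < s) (hdom : ∀ f ∈ D.domain, MemSobolevLoc s f) :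
    List.TFAE [
      UnboundedOp.IsLeftBFredholm D,
      ∃ k : TestFun I M, (∀ x, 0 ≤ k x) ∧ UnboundedOp.IsInvertibleAdd (L2Sec.mul k) D,
      ∃ k : TestFun I M, ∃ 𝓒 : Submodule B (L2Sec I B W E μ), UnboundedOp.IsCore D 𝓒 ∧
        ∃ C : ℝ, ∀ f : D.domain, (f : L2Sec I B W E μ) ∈ 𝓒 →
          ‖(f : L2Sec I B W E μ)‖ ≤ C * (‖L2Sec.mul k (f : L2Sec I B W E μ)‖ + ‖D f‖)] := by
  tfae_have 1 → 3 := by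
    intro h
    obtain ⟨k, C, hC⟩ := h.exists_bound_mul
    exact ⟨k, D.domain, UnboundedOp.isCore_domain D, C, fun f _ => hC f⟩
  tfae_have 2 → 3 := by
    rintro ⟨k, hk, h⟩
    -- A nonnegative complex number is real, so multiplication by `k` is symmetric.
    have hconj : k.conj = k := by
      have h1 : k.conj.toFun = k.toFun := funext fun x => (IsSelfAdjoint.of_nonneg (hk x)).star_eq
      cases k
      simpa [TestFun.conj] using h1
    obtain ⟨C, hC⟩ := h.exists_bound fun x y => by
      rw [L2Sec.inner_mul_left, hconj]
    exact ⟨k, D.domain, UnboundedOp.isCore_domain D, C, fun f _ => hC f⟩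
  tfae_have 3 → 2 := by
    rintro ⟨k, 𝓒, h𝓒, C, hC⟩
    -- The function `k` of 3 need not be nonnegative; `|k|²` is, and multiplication by it is `K*K`,
    -- with `K` multiplication by `k`.
    refine ⟨k.conj.times k, k.times_nonneg, ?_⟩
    rw [L2Sec.mul_eq_comp fun x => k.conj.times_apply k x]
    exact hD.invertible_of_bound (L2Sec.mul k) (L2Sec.mul k.conj) (L2Sec.inner_mul_left k) C
      (h𝓒.bound (L2Sec.mul k) C hC)
  tfae_have 3 → 1 := by
    rintro ⟨k, 𝓒, h𝓒, C, hC⟩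
    exact hD.isLeftBFredholm_of_bound (L2Sec.mul k) (L2Sec.mul k.conj) (L2Sec.inner_mul_left k) C
      (h𝓒.bound (L2Sec.mul k) C hC) (hD.isBCompact_mul inferInstance hμ hs hdom k)
  tfae_finish
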